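/- Theorem. A coloured Muller game is $\mathcal G=(V_0,V_1,E,c,(\mathcal F_0,\mathcal F_1))$, where $V=V_0\sqcup V_1$ is a finite nonempty set of positions, $E\subseteq (V_0\times V_1)\cup(V_1\times V_0)$ is a set of edges such that every position has an outgoing edge, $c:V\to C$ is a colouring by a finite set $C$ of colours with $|C|\le|V|$, and $(\mathcal F_0,\mathcal F_1)$ is a partition of $2^C$. From position $v$, the owner of the current position ($\sigma$ if it lies in $V_\sigma$) chooses the next edge; Player $\sigma$ wins an infinite play $\rho$ if the set $c(\mathsf{Inf}(\rho))$ of colours of the positions visited infinitely often is in $\mathcal F_\sigma$, and $Win_\sigma(\mathcal G)$ is the set of positions from which Player $\sigma$ has a winning strategy (which may depend on the whole history). There is an algorithm that, given an explicit representation of any coloured Muller game $\mathcal G$ (listing the positions with their owners and colours, the edges, and the members of $\mathcal F_0$ and $\mathcal F_1$ as $|C|$-bit integers, edges and sets in arbitrary order), computes the partition of $V$ into $Win_0(\mathcal G)$ and $Win_1(\mathcal G)$ in time $O(2^{|V|}\,|C|\,|E|)$ and space $O(|\mathcal G|+2^{|V|}\,|V|)$. Here $|\mathcal G|=|V|+|E|+(|\mathcal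 F_0|+|\mathcal F_1|)\,|C|$; the machine is a word RAM whose words (registers and memory cells) have $O(|V|)$ bits and whose arithmetic ($+$, truncated $-$, $\times$, integer quotient and remainder), comparison, and indirect load/store instructions take unit time; time is the number of executed steps, and space is the total number of bits of all memory words and registers, the input included. The program and the implied constants do not depend on $\mathcal G$. -/

import Mathlib

/-! ### Coloured Muller games

Players `0` and `1` are the Booleans `false` and `true`. -/

/-- An arena on the finite set of positions `V = V₀ ∪ V₁`; `V_σ` is `{v | owner v = σ}`. -/
structure Arena (V : Type*) [Fintype V] [DecidableEq V] where
  owner : V → Bool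
  E : Finset (V × V)
  bipartite : ∀ e ∈ E, owner e.1 ≠ owner e.2
  exists_succ : ∀ u, ∃ v, (u, v) ∈ E

/-- A coloured Muller game: an arena, a colouring `c : V → C`, and a partition
`(F false, F true)` of the set of all subsets of `C`. -/
structure ColouredMullerGame (V C : Type*) [Fintype V] [DecidableEq V] [Fintype C]
    [DecidableEq C] extends Arena V where
  c : V → C
  F : Bool → Finset (Finset C)
  union_eq : F false ∪ F true = Finset.univ
  inter_eq : F false ∩ F true = ∅

namespace Arena

variable {V : Type*} [Fintype V] [DecidableEq V] (A : Arena V)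

/-- Plays: infinite sequences of positions along edges. -/
def IsPlay (ρ : ℕ → V) : Prop := ∀ i, (ρ i, ρ (i + 1)) ∈ A.E

/-- The initial segment `ρ 0, …, ρ i`. -/
def history (ρ : ℕ → V) (i : ℕ) : List V := (List.range (i + 1)).map ρ

/-- A strategy of Player `σ`: it sends each initial segment of a play that ends in a
position `v` of Player `σ` to a successor of `v` (other values do not matter). -/
def IsStrategy (σ : Bool) (s : List V → V) : Prop :=
  ∀ ρ, A.IsPlay ρ → ∀ i, A.owner (ρ i) = σ → (ρ i, s (history ρ i)) ∈ A.E

/-- In `ρ` all moves of Player `σ` are made according to `s`. -/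
def Follows (σ : Bool) (s : List V → V) (ρ : ℕ → V) : Prop :=
  ∀ i, A.owner (ρ i) = σ → ρ (i + 1) = s (history ρ i)

/-- The infinity set of a sequence of positions. -/
def infinitySet (ρ : ℕ → V) : Set V := {v | ∃ᶠ i in Filter.atTop, ρ i = v}

end Arena

namespace ColouredMullerGame

variable {V C : Type*} [Fintype V] [DecidableEq V] [Fintype C] [DecidableEq C]
  (G : ColouredMullerGame V C)

/-- Player `σ` wins the play `ρ`: the set of colours `c(Inf(ρ))` belongs to `F σ`. -/
def WinsPlay (σ : Bool) (ρ : ℕ → V) : Prop :=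
  ∃ X ∈ G.F σ, (X : Set C) = G.c '' Arena.infinitySet ρ

/-- The winning region of Player `σ`: positions from which Player `σ` has a strategy that
wins every play that follows it. -/
def Win (σ : Bool) : Set V :=
  {v | ∃ s, G.IsStrategy σ s ∧
    ∀ ρ, G.IsPlay ρ → ρ 0 = v → G.Follows σ s ρ → G.WinsPlay σ ρ}

/-- The size of the explicit representation, which lists the positions, the edges, and the
sets in the winning conditions (each as a `|C|`-bit string). -/
def size : ℕ :=
  Fintype.card V + G.E.card + ((G.F false).card + (G.F true).card) * Fintype.card C

end ColouredMullerGame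

/-! ### The word RAM

A machine with `s` memory words and `r` registers, all of them `w` bits long.  Programs are
structured; each elementary instruction and each evaluation of a test costs one step. -/

namespace RAM

/-- Arithmetic instructions on natural numbers (subtraction is truncated at `0`, and
division by `0` follows the conventions `a / 0 = 0`, `a % 0 = a`). -/
inductive Op
  | add | sub | mul | div | mod

def Op.eval : Op → ℕ → ℕ → ℕ
  | add, a, b => a + b
  | sub, a, b => a - b
  | mul, a, b => a * b
  | div, a, b => a / b
  | mod, a, b => a % b

inductive Test
  | lt | le | eq | ne

def Test.Holds : Test → ℕ → ℕ → Prop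
  | lt, a, b => a < b
  | le, a, b => a ≤ b
  | eq, a, b => a = b
  | ne, a, b => a ≠ b

/-- Programs with `r` registers. -/
inductive Cmd (r : ℕ)
  /-- no operation -/
  | skip
  /-- `R[d] := a` -/
  | const (d : Fin r) (a : ℕ)
  /-- `R[d] := R[a]` -/
  | move (d a : Fin r)
  /-- `R[d] := R[a] o R[b]` -/
  | arith (o : Op) (d a b : Fin r)
  /-- `R[d] := M[R[a]]` -/
  | load (d a : Fin r)
  /-- `M[R[a]] := R[b]` -/
  | store (a b : Fin r)
  | seq (p q : Cmd r)
  /-- if `R[a] τ R[b]` then `p` else `q` -/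
  | cond (τ : Test) (a b : Fin r) (p q : Cmd r)
  /-- while `R[a] τ R[b]` do `p` -/
  | loop (τ : Test) (a b : Fin r) (p : Cmd r)

structure State (r : ℕ) where
  reg : Fin r → ℕ
  mem : ℕ → ℕ

def State.setReg {r : ℕ} (σ : State r) (d : Fin r) (a : ℕ) : State r :=
  { σ with reg := Function.update σ.reg d a }

def State.setMem {r : ℕ} (σ : State r) (i a : ℕ) : State r :=
  { σ with mem := Function.update σ.mem i a }

/-- `Exec s w p σ t σ'`: on a machine with `s` memory words of `w` bits, the program `p`
started in `σ` halts in `σ'` after exactly `t` steps.  A computation that would use an address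
`≥ s` or produce a number `≥ 2 ^ w` has no execution. -/
inductive Exec {r : ℕ} (s w : ℕ) : Cmd r → State r → ℕ → State r → Prop
  | skip (σ) : Exec s w .skip σ 1 σ
  | const (σ d a) (h : a < 2 ^ w) : Exec s w (.const d a) σ 1 (σ.setReg d a)
  | move (σ d a) : Exec s w (.move d a) σ 1 (σ.setReg d (σ.reg a))
  | arith (σ o d a b) (h : Op.eval o (σ.reg a) (σ.reg b) < 2 ^ w) :
      Exec s w (.arith o d a b) σ 1 (σ.setReg d (Op.eval o (σ.reg a) (σ.reg b)))
  | load (σ d a) (h : σ.reg a < s) :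
      Exec s w (.load d a) σ 1 (σ.setReg d (σ.mem (σ.reg a)))
  | store (σ a b) (h : σ.reg a < s) :
      Exec s w (.store a b) σ 1 (σ.setMem (σ.reg a) (σ.reg b))
  | seq {p q σ₁ σ₂ σ₃ t₁ t₂} (h₁ : Exec s w p σ₁ t₁ σ₂) (h₂ : Exec s w q σ₂ t₂ σ₃) :
      Exec s w (.seq p q) σ₁ (t₁ + t₂) σ₃
  | condTrue {τ a b p q σ σ' t} (h : Test.Holds τ (σ.reg a) (σ.reg b))
      (hp : Exec s w p σ t σ') : Exec s w (.cond τ a b p q) σ (t + 1) σ'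
  | condFalse {τ a b p q σ σ' t} (h : ¬ Test.Holds τ (σ.reg a) (σ.reg b))
      (hq : Exec s w q σ t σ') : Exec s w (.cond τ a b p q) σ (t + 1) σ'
  | loopDone {τ a b p σ} (h : ¬ Test.Holds τ (σ.reg a) (σ.reg b)) :
      Exec s w (.loop τ a b p) σ 1 σ
  | loopStep {τ a b p σ₁ σ₂ σ₃ t₁ t₂} (h : Test.Holds τ (σ₁.reg a) (σ₁.reg b))
      (h₁ : Exec s w p σ₁ t₁ σ₂) (h₂ : Exec s w (.loop τ a b p) σ₂ t₂ σ₃) :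
      Exec s w (.loop τ a b p) σ₁ (t₁ + t₂ + 1) σ₃

/-- The input `x` stands in the first memory words; everything else is `0`. -/
def initState (r : ℕ) (x : List ℕ) : State r where
  reg := fun _ => 0
  mem := fun i => x.getD i 0

/-- The program `p` runs on input `x` within `s` memory words of `w` bits (the input, which
has to fit, included), and halts after `t` steps with the memory contents `m`. -/
def RunsTo {r : ℕ} (p : Cmd r) (x : List ℕ) (s w t : ℕ) (m : ℕ → ℕ) : Prop :=
  x.length ≤ s ∧ (∀ a ∈ x, a < 2 ^ w) ∧
    ∃ σ' : State r, Exec s w p (initState r x) t σ' ∧ σ'.mem = m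

end RAM

/-! ### Games as inputs -/

/-- The binary integer coding a set of colours. -/
def setCode {k : ℕ} (X : Finset (Fin k)) : ℕ := ∑ j ∈ X, 2 ^ (j : ℕ)

/-- `x` is an explicit representation of `G`: the numbers `|V|, |C|, |E|, |F₀|, |F₁|`, the
owners of the positions, their colours, the edges, the codes of the members of `F₀`, and
those of the members of `F₁`; the edges and the members of `F₀`, `F₁` are listed without
repetition, in any order. -/
def IsRepresentation {n k : ℕ} (G : ColouredMullerGame (Fin n) (Fin k)) (x : List ℕ) : Prop :=
  ∃ (es : List (Fin n × Fin n)) (Fs : Bool → List (Finset (Fin k))),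
    es.Nodup ∧ es.toFinset = G.E ∧
    (∀ σ, (Fs σ).Nodup ∧ (Fs σ).toFinset = G.F σ) ∧
    x = [n, k, es.length, (Fs false).length, (Fs true).length]
      ++ List.ofFn (fun v => (G.owner v).toNat)
      ++ List.ofFn (fun v => (G.c v : ℕ))
      ++ es.flatMap (fun e => [(e.1 : ℕ), (e.2 : ℕ)])
      ++ (Fs false).map setCode
      ++ (Fs true).map setCode

set_option linter.unusedSectionVars false
set_option linter.constructorNameAsVariable false

namespace ColouredMullerGame

section Regions

variable {V C : Type} [Fintype V] [DecidableEq V] [Fintype C] [DecidableEq C]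
  (G : ColouredMullerGame V C)

theorem infinitySet_shift (ρ : ℕ → V) (N : ℕ) :
    Arena.infinitySet (fun i => ρ (i + N)) = Arena.infinitySet ρ := by
  ext v
  simp only [Arena.infinitySet, Set.mem_ofPred_eq, Filter.frequently_atTop]
  constructor
  · intro h a
    obtain ⟨b, hb, e⟩ := h a
    exact ⟨b + N, by omega, e⟩
  · intro h a
    obtain ⟨b, hb, e⟩ := h (a + N)
    exact ⟨b - N, by omega, by rw [Nat.sub_add_cancel (by omega)]; exact e⟩

theorem winsPlay_of_shift {σ : Bool} {ρ : ℕ → V} (N : ℕ)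
    (h : G.WinsPlay σ (fun i => ρ (i + N))) : G.WinsPlay σ ρ := by
  unfold WinsPlay at h ⊢
  rwa [infinitySet_shift] at h

/-- A graph over the subgame on `S` that represents a winning strategy of Player `σ` with
memory: nodes carry positions, a node of Player `σ` has some successor, a node of the
opponent has a successor for each of the moves in `S`, and all infinite paths are won. -/
structure WinGraph (σ : Bool) (S : Finset V) (Q : Type) where
  pos : Q → V
  R : Q → Q → Prop
  mem : ∀ q, pos q ∈ S
  edge : ∀ {q q'}, R q q' → (pos q, pos q') ∈ G.E
  own : ∀ q, G.owner (pos q) = σ → ∃ q', R q q'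
  opp : ∀ q, G.owner (pos q) ≠ σ → ∀ u ∈ S, (pos q, u) ∈ G.E → ∃ q', R q q' ∧ pos q' = u
  win : ∀ f : ℕ → Q, (∀ i, R (f i) (f (i + 1))) → G.WinsPlay σ (fun i => pos (f i))

/-- Player `σ` wins the subgame on `S` from `v`. -/
def WinsFrom (σ : Bool) (S : Finset V) (v : V) : Prop :=
  ∃ (Q : Type) (g : G.WinGraph σ S Q) (q : Q), g.pos q = v

/-- Every position of `S` has a successor in `S`. -/
def IsSubarena (S : Finset V) : Prop := ∀ u ∈ S, ∃ w ∈ S, (u, w) ∈ G.E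

/-- `A` is the attractor of Player `σ` to `T` in the subgame on `S`. -/
structure IsAttractor (σ : Bool) (S T A : Finset V) : Prop where
  target : ∀ v ∈ S, v ∈ T → v ∈ A
  subset : A ⊆ S
  eq_empty : T = ∅ → A = ∅
  closed_own : ∀ u ∈ S, u ∉ A → G.owner u = σ → ∀ w ∈ A, (u, w) ∉ G.E
  closed_opp : ∀ u ∈ S, u ∉ A → G.owner u ≠ σ → (∃ w ∈ S, (u, w) ∈ G.E) →
    ∃ w ∈ S, w ∉ A ∧ (u, w) ∈ G.E
  rank : ∃ r : V → ℕ, ∀ u ∈ A, u ∉ T →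
    (G.owner u = σ → ∃ w ∈ A, (u, w) ∈ G.E ∧ r w < r u) ∧
    (G.owner u ≠ σ → ∀ w ∈ S, (u, w) ∈ G.E → w ∈ A ∧ r w < r u)

inductive SigmaRel {ι : Type} {Q : ι → Type} (R : ∀ i, Q i → Q i → Prop) :
    (Σ i, Q i) → (Σ i, Q i) → Prop
  | mk {i q q'} (h : R i q q') : SigmaRel R ⟨i, q⟩ ⟨i, q'⟩

variable {G}

/-- One winning graph covers the whole winning region. -/
theorem exists_winGraph (σ : Bool) (S : Finset V) :
    ∃ (Q : Type) (g : G.WinGraph σ S Q), ∀ v, G.WinsFrom σ S v → ∃ q, g.pos q = v := by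
  classical
  have h : ∀ v : {v // G.WinsFrom σ S v}, ∃ (Q : Type) (g : G.WinGraph σ S Q) (q : Q),
    g.pos q = v := fun v => v.2
  choose Q g q hq using h
  refine ⟨Σ i, Q i, ⟨fun x => (g x.1).pos x.2, SigmaRel (fun i => (g i).R), ?_, ?_, ?_, ?_, ?_⟩,
    fun v hv => ⟨⟨⟨v, hv⟩, q _⟩, hq _⟩⟩
  · exact fun x => (g x.1).mem x.2
  · rintro _ _ ⟨h⟩
    exact (g _).edge h
  · rintro ⟨i, x⟩ hx
    obtain ⟨y, hy⟩ := (g i).own x hx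
    exact ⟨⟨i, y⟩, ⟨hy⟩⟩
  · rintro ⟨i, x⟩ hx u hu hE
    obtain ⟨y, hy, e⟩ := (g i).opp x hx u hu hE
    exact ⟨⟨i, y⟩, ⟨hy⟩, e⟩
  · intro f hf
    have key : ∀ t, ∃ y, f t = ⟨(f 0).1, y⟩ := by
      intro t
      induction t with
      | zero => exact ⟨(f 0).2, rfl⟩
      | succ t ih =>
        obtain ⟨y, hy⟩ := ih
        have h1 := hf t
        rw [hy] at h1
        generalize f (t + 1) = z at h1
        cases h1 with
        | mk h => exact ⟨_, rfl⟩
    choose y hy using key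
    generalize (f 0).1 = i at y hy
    have h2 : ∀ t, (g i).R (y t) (y (t + 1)) := by
      intro t
      have h1 := hf t
      rw [hy, hy (t + 1)] at h1
      cases h1 with
      | mk h => exact h
    have h3 := (g i).win y h2
    obtain rfl : f = fun t => ⟨i, y t⟩ := funext hy
    exact h3

theorem winsFrom_of_step {σ : Bool} {S : Finset V} {v : V} (hv : v ∈ S)
    (hown : G.owner v = σ → ∃ w, (v, w) ∈ G.E ∧ G.WinsFrom σ S w)
    (hopp : G.owner v ≠ σ → ∀ w ∈ S, (v, w) ∈ G.E → G.WinsFrom σ S w) :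
    G.WinsFrom σ S v := by
  obtain ⟨Q, g, hg⟩ := exists_winGraph (G := G) σ S
  let R : Option Q → Option Q → Prop := fun x y =>
    match x, y with
    | none, some q => (v, g.pos q) ∈ G.E
    | some q, some q' => g.R q q'
    | _, none => False
  let pos : Option Q → V := fun x => x.elim v g.pos
  refine ⟨Option Q, ⟨pos, R, ?_, ?_, ?_, ?_, ?_⟩, none, rfl⟩
  · rintro (_ | q)
    exacts [hv, g.mem q]
  · rintro (_ | q) (_ | q') h
    exacts [h.elim, h, h.elim, g.edge h]
  · rintro (_ | q) h
    · obtain ⟨w, hw, hw'⟩ := hown h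
      obtain ⟨q, rfl⟩ := hg w hw'
      exact ⟨some q, hw⟩
    · obtain ⟨q', hq'⟩ := g.own q h
      exact ⟨some q', hq'⟩
  · rintro (_ | q) h u hu hE
    · obtain ⟨q, rfl⟩ := hg u (hopp h u hu hE)
      exact ⟨some q, hE, rfl⟩
    · obtain ⟨q', hq', e⟩ := g.opp q h u hu hE
      exact ⟨some q', hq', e⟩
  · intro f hf
    have key : ∀ t, ∃ q, f (t + 1) = some q := by
      intro t
      have h := hf t
      rcases hx : f (t + 1) with _ | q
      · rw [hx] at h
        rcases hy : f t with _ | q' <;> rw [hy] at h <;> exact h.elim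
      · exact ⟨q, rfl⟩
    choose y hy using key
    have h2 : ∀ t, g.R (y t) (y (t + 1)) := by
      intro t
      have h := hf (t + 1)
      rw [hy, hy] at h
      exact h
    refine G.winsPlay_of_shift 1 ?_
    simpa [hy, pos] using g.win y h2

theorem IsAttractor.winsFrom {σ : Bool} {S T A : Finset V} (hA : G.IsAttractor σ S T A)
    (hT : ∀ v ∈ T, G.WinsFrom σ S v) {v : V} (hv : v ∈ A) : G.WinsFrom σ S v := by
  obtain ⟨r, hr⟩ := hA.rank
  induction h : r v using Nat.strong_induction_on generalizing v with
  | _ m ih =>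
    by_cases hvT : v ∈ T
    · exact hT v hvT
    · obtain ⟨h1, h2⟩ := hr v hv hvT
      refine winsFrom_of_step (hA.subset hv) ?_ ?_
      · intro ho
        obtain ⟨w, hw, hE, hlt⟩ := h1 ho
        exact ⟨w, hE, ih _ (h ▸ hlt) hw rfl⟩
      · intro ho w hw hE
        obtain ⟨hwA, hlt⟩ := h2 ho w hw hE
        exact ih _ (h ▸ hlt) hwA rfl

theorem IsAttractor.isSubarena {σ : Bool} {S T A : Finset V} (hA : G.IsAttractor σ S T A)
    (hS : G.IsSubarena S) : G.IsSubarena (S \ A) := by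
  intro u hu
  rw [Finset.mem_sdiff] at hu
  by_cases ho : G.owner u = σ
  · obtain ⟨w, hw, hE⟩ := hS u hu.1
    exact ⟨w, Finset.mem_sdiff.2 ⟨hw, fun h => hA.closed_own u hu.1 hu.2 ho w h hE⟩, hE⟩
  · obtain ⟨w, hw, hwA, hE⟩ := hA.closed_opp u hu.1 hu.2 ho (hS u hu.1)
    exact ⟨w, Finset.mem_sdiff.2 ⟨hw, hwA⟩, hE⟩

/-- The opponent of the attracting player wins in the whole game from where they win outside
the attractor. -/
theorem IsAttractor.winsFrom_of_sdiff {σ : Bool} {S T A : Finset V}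
    (hA : G.IsAttractor (!σ) S T A) {v : V} (hv : G.WinsFrom σ (S \ A) v) :
    G.WinsFrom σ S v := by
  obtain ⟨Q, g, q, rfl⟩ := hv
  refine ⟨Q, ⟨g.pos, g.R, fun q => (Finset.mem_sdiff.1 (g.mem q)).1, g.edge, g.own, ?_, g.win⟩,
    q, rfl⟩
  intro q hq u hu hE
  refine g.opp q hq u (Finset.mem_sdiff.2 ⟨hu, fun h => ?_⟩) hE
  have hm := Finset.mem_sdiff.1 (g.mem q)
  exact hA.closed_own _ hm.1 hm.2 (by cases h : G.owner (g.pos q) <;> cases σ <;> simp_all) u h hE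

/-- A player who wins from all positions of `A` and wins the subgame outside `A` from `v` wins
from `v`. -/
theorem winsFrom_of_winsFrom_sdiff {σ : Bool} {S A : Finset V}
    (hA : ∀ v ∈ A, G.WinsFrom σ S v) {v : V} (hv : G.WinsFrom σ (S \ A) v) :
    G.WinsFrom σ S v := by
  obtain ⟨Q, g, q, rfl⟩ := hv
  obtain ⟨Q', g', hg'⟩ := exists_winGraph (G := G) σ S
  let R : Q ⊕ Q' → Q ⊕ Q' → Prop := fun x y =>
    match x, y with
    | .inl q, .inl q' => g.R q q'
    | .inl q, .inr q' => (g.pos q, g'.pos q') ∈ G.E ∧ G.owner (g.pos q) ≠ σ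
    | .inr _, .inl _ => False
    | .inr q, .inr q' => g'.R q q'
  let pos : Q ⊕ Q' → V := fun x => x.elim g.pos g'.pos
  refine ⟨Q ⊕ Q', ⟨pos, R, ?_, ?_, ?_, ?_, ?_⟩, .inl q, rfl⟩
  · rintro (q | q)
    exacts [(Finset.mem_sdiff.1 (g.mem q)).1, g'.mem q]
  · rintro (q | q) (q' | q') h
    exacts [g.edge h, h.1, h.elim, g'.edge h]
  · rintro (q | q) h
    · obtain ⟨q', h'⟩ := g.own q h
      exact ⟨.inl q', h'⟩
    · obtain ⟨q', h'⟩ := g'.own q h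
      exact ⟨.inr q', h'⟩
  · rintro (q | q) h u hu hE
    · by_cases huA : u ∈ A
      · obtain ⟨q', rfl⟩ := hg' u (hA u huA)
        exact ⟨.inr q', ⟨hE, h⟩, rfl⟩
      · obtain ⟨q', h', e⟩ := g.opp q h u (Finset.mem_sdiff.2 ⟨hu, huA⟩) hE
        exact ⟨.inl q', h', e⟩
    · obtain ⟨q', h', e⟩ := g'.opp q h u hu hE
      exact ⟨.inr q', h', e⟩
  · intro f hf
    by_cases hc : ∃ t q', f t = .inr q'
    · obtain ⟨t, q', ht⟩ := hc
      have key : ∀ i, ∃ y, f (i + t) = .inr y := by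
        intro i
        induction i with
        | zero => exact ⟨q', by rw [zero_add, ht]⟩
        | succ i ih =>
          obtain ⟨y, hy⟩ := ih
          have h := hf (i + t)
          rw [hy] at h
          rw [show i + 1 + t = i + t + 1 by omega]
          rcases hx : f (i + t + 1) with x | x
          · rw [hx] at h
            exact h.elim
          · exact ⟨x, rfl⟩
      choose y hy using key
      refine G.winsPlay_of_shift t ?_
      have h2 := g'.win y (by
        intro i
        have h := hf (i + t)
        rw [hy, show i + t + 1 = i + 1 + t by omega, hy] at h
        exact h)
      simpa [hy, pos] using h2
    · have key : ∀ i, ∃ y, f i = .inl y := by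
        intro i
        rcases hx : f i with x | x
        · exact ⟨x, rfl⟩
        · exact (hc ⟨i, x, hx⟩).elim
      choose y hy using key
      have h2 := g.win y (by
        intro i
        have h := hf i
        rw [hy, hy] at h
        exact h)
      simpa [hy, pos] using h2

theorem exists_seq_infinitely_often {K : Finset C} (hK : K.Nonempty) :
    ∃ a : ℕ → C, (∀ i, a i ∈ K) ∧ ∀ x ∈ K, ∀ N, ∃ i, N ≤ i ∧ a i = x := by
  have hpos : 0 < K.card := hK.card_pos
  refine ⟨fun i => (K.equivFin.symm ⟨i % K.card, Nat.mod_lt _ hpos⟩ : K), fun i => by simp, ?_⟩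
  intro x hx N
  refine ⟨N * K.card + K.equivFin ⟨x, hx⟩, ?_, ?_⟩
  · nlinarith
  · have : (N * K.card + (K.equivFin ⟨x, hx⟩ : ℕ)) % K.card = K.equivFin ⟨x, hx⟩ := by
      rw [Nat.mul_add_mod_self_right, Nat.mod_eq_of_lt (K.equivFin ⟨x, hx⟩).2]
    simp [this]

section Cycling

variable {σ : Bool} {S : Finset V} {a : ℕ → C} {A : ℕ → Finset V} {r : ℕ → V → ℕ} {Q : ℕ → Type}
  (g : ∀ i, G.WinGraph σ (S \ A i) (Q i))

def cyclePos : (Σ i, Q i ⊕ {v // v ∈ A i}) → V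
  | ⟨i, .inl q⟩ => (g i).pos q
  | ⟨_, .inr v⟩ => v

inductive CycleRel (a : ℕ → C) (r : ℕ → V → ℕ) :
    (Σ i, Q i ⊕ {v // v ∈ A i}) → (Σ i, Q i ⊕ {v // v ∈ A i}) → Prop
  | stay {i q q'} (h : (g i).R q q') : CycleRel a r ⟨i, .inl q⟩ ⟨i, .inl q'⟩
  | enter {i} {q : Q i} {v} (ho : G.owner ((g i).pos q) ≠ σ) (h : ((g i).pos q, v.1) ∈ G.E) :
      CycleRel a r ⟨i, .inl q⟩ ⟨i, .inr v⟩
  | down {i} {v w : {v // v ∈ A i}} (hc : G.c v ≠ a i) (hE : (v.1, w.1) ∈ G.E)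
      (h : r i w < r i v) : CycleRel a r ⟨i, .inr v⟩ ⟨i, .inr w⟩
  | next {i} {v : {v // v ∈ A i}} {x} (hc : G.c v = a i)
      (hE : (v.1, cyclePos g ⟨i + 1, x⟩) ∈ G.E) : CycleRel a r ⟨i, .inr v⟩ ⟨i + 1, x⟩

theorem CycleRel.index {x y} (h : CycleRel g a r x y) :
    y.1 = x.1 ∨ y.1 = x.1 + 1 ∧ G.c (cyclePos g x) = a x.1 := by
  cases h with
  | stay h => exact .inl rfl
  | enter _ h => exact .inl rfl
  | down _ _ h => exact .inl rfl
  | next h _ => exact .inr ⟨rfl, h⟩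

theorem CycleRel.not_inr (f : ℕ → Σ i, Q i ⊕ {v // v ∈ A i})
    (hf : ∀ t, CycleRel g a r (f t) (f (t + 1))) {i : ℕ} (hi : ∀ t, (f t).1 = i) (t : ℕ)
    (v : {v // v ∈ A i}) : f t ≠ ⟨i, .inr v⟩ := by
  induction h : r i v using Nat.strong_induction_on generalizing v t with
  | _ m ih =>
    intro ht
    have h1 := hf t
    have h2 := hi (t + 1)
    rw [ht] at h1
    rcases hx : f (t + 1) with ⟨j, y⟩
    rw [hx] at h1 h2
    cases h1 with
    | down _ _ hlt => exact ih _ (h ▸ hlt) _ _ rfl hx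
    | next _ _ => simp at h2

end Cycling

/-- If Player `σ` owns the set of all colours of `S` and, for each colour, wins everywhere
outside the attractor to that colour, then Player `σ` wins everywhere in `S`. -/
theorem winsFrom_of_attractors {σ : Bool} {S : Finset V} (hS : G.IsSubarena S)
    (hF : S.image G.c ∈ G.F σ) (A : C → Finset V)
    (hA : ∀ j ∈ S.image G.c, G.IsAttractor σ S (Finset.univ.filter (G.c · = j)) (A j))
    (hw : ∀ j ∈ S.image G.c, ∀ v ∈ S \ A j, G.WinsFrom σ (S \ A j) v) {v : V} (hv : v ∈ S) :
    G.WinsFrom σ S v := by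
  classical
  obtain ⟨a, haK, hainf⟩ := exists_seq_infinitely_often (K := S.image G.c)
    ⟨G.c v, Finset.mem_image_of_mem _ hv⟩
  have h1 : ∀ i, ∃ (Q : Type) (g : G.WinGraph σ (S \ A (a i)) Q),
      ∀ v, G.WinsFrom σ (S \ A (a i)) v → ∃ q, g.pos q = v := fun i => exists_winGraph _ _
  choose Q g hg using h1
  have h2 := fun i => (hA (a i) (haK i)).rank
  choose r hr using h2
  have cover : ∀ i, ∀ u ∈ S, ∃ x, cyclePos g ⟨i, x⟩ = u := by
    intro i u hu
    by_cases huA : u ∈ A (a i)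
    · exact ⟨.inr ⟨u, huA⟩, rfl⟩
    · obtain ⟨q, hq⟩ := hg i u (hw _ (haK i) u (Finset.mem_sdiff.2 ⟨hu, huA⟩))
      exact ⟨.inl q, hq⟩
  have hmem : ∀ x, cyclePos g x ∈ S := by
    rintro ⟨i, q | v⟩
    · exact (Finset.mem_sdiff.1 ((g i).mem q)).1
    · exact (hA _ (haK i)).subset v.2
  obtain ⟨x0, hx0⟩ := cover 0 v hv
  refine ⟨_, ⟨cyclePos g, CycleRel g a r, hmem, ?_, ?_, ?_, ?_⟩, ⟨0, x0⟩, hx0⟩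
  · intro x y h
    cases h with
    | stay h => exact (g _).edge h
    | enter _ h => exact h
    | down _ h _ => exact h
    | next _ h => exact h
  · rintro ⟨i, q | u⟩ ho
    · obtain ⟨q', hq'⟩ := (g i).own q ho
      exact ⟨_, .stay hq'⟩
    · by_cases hc : G.c u = a i
      · obtain ⟨w, hw, hE⟩ := hS u ((hA _ (haK i)).subset u.2)
        obtain ⟨x, rfl⟩ := cover (i + 1) w hw
        exact ⟨_, .next hc hE⟩
      · obtain ⟨w, hw, hE, hlt⟩ := (hr i u u.2 (by simpa using hc)).1 ho
        exact ⟨_, .down (w := ⟨w, hw⟩) hc hE hlt⟩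
  · rintro ⟨i, q | u⟩ ho w hwS hE
    · by_cases hwA : w ∈ A (a i)
      · exact ⟨_, .enter (v := ⟨w, hwA⟩) ho hE, rfl⟩
      · obtain ⟨q', hq', e⟩ := (g i).opp q ho w (Finset.mem_sdiff.2 ⟨hwS, hwA⟩) hE
        exact ⟨_, .stay hq', e⟩
    · by_cases hc : G.c u = a i
      · obtain ⟨x, rfl⟩ := cover (i + 1) w hwS
        exact ⟨_, .next hc hE, rfl⟩
      · obtain ⟨hwA, hlt⟩ := (hr i u u.2 (by simpa using hc)).2 ho w hwS hE
        exact ⟨_, .down (w := ⟨w, hwA⟩) hc hE hlt, rfl⟩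
  · intro f hf
    have hmono : Monotone fun t => (f t).1 := monotone_nat_of_le_succ fun t => by
      rcases (hf t).index with h | h <;> omega
    by_cases hunb : ∀ N, ∃ t, N < (f t).1
    · refine ⟨_, hF, ?_⟩
      ext j
      simp only [Finset.coe_image, Set.mem_image, Finset.mem_coe]
      constructor
      · rintro ⟨u, hu, rfl⟩
        by_contra hno
        have h3 : ∀ w, ∀ᶠ t in Filter.atTop, ¬ (cyclePos g (f t) = w ∧ G.c w = G.c u) := by
          intro w
          by_cases hcw : G.c w = G.c u
          · have h4 : ¬ ∃ᶠ t in Filter.atTop, cyclePos g (f t) = w :=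
              fun h => hno ⟨w, h, hcw⟩
            filter_upwards [Filter.not_frequently.1 h4] with t ht h5
            exact ht h5.1
          · exact Filter.Eventually.of_forall fun t h => hcw h.2
        obtain ⟨N, hN⟩ := Filter.eventually_atTop.1 (Filter.eventually_all.2 h3)
        obtain ⟨i, hi, hai⟩ := hainf _ (Finset.mem_image_of_mem G.c hu) (f N).1
        have hex := hunb i
        have hlt := Nat.find_spec hex
        have hNt : N < Nat.find hex := by
          by_contra h
          have := hmono (not_lt.1 h)
          simp only at this
          omega
        obtain ⟨t, ht⟩ : ∃ t, Nat.find hex = t + 1 := ⟨Nat.find hex - 1, by omega⟩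
        have hle := Nat.find_min hex (m := t) (by omega)
        rw [ht] at hlt
        rcases (hf t).index with h | h
        · omega
        · exact hN t (by omega) _ ⟨rfl, by rw [h.2, ← hai]; congr 1; omega⟩
      · rintro ⟨w, hw', rfl⟩
        obtain ⟨t, ht⟩ := Filter.Frequently.exists hw'
        exact ⟨w, ht ▸ hmem _, rfl⟩
    · push Not at hunb
      obtain ⟨t0, ht0⟩ : ∃ t0, (f t0).1 = Nat.find hunb := by
        by_contra hno
        push Not at hno
        have h3 := Nat.find_spec hunb
        rcases Nat.eq_zero_or_pos (Nat.find hunb) with h4 | h4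
        · exact hno 0 (by have := h3 0; omega)
        · refine Nat.find_min hunb (m := Nat.find hunb - 1) (by omega) fun t => ?_
          have := h3 t
          have := hno t
          omega
      have hconst : ∀ t, (f (t + t0)).1 = Nat.find hunb := fun t =>
        le_antisymm (Nat.find_spec hunb _) (ht0 ▸ hmono (Nat.le_add_left _ _))
      generalize Nat.find hunb = i at ht0 hconst
      have hshift : ∀ t, CycleRel g a r (f (t + t0)) (f (t + 1 + t0)) := fun t => by
        rw [show t + 1 + t0 = t + t0 + 1 by omega]
        exact hf _
      have key : ∀ t, ∃ q, f (t + t0) = ⟨i, .inl q⟩ := by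
        intro t
        have h3 := hconst t
        have h4 := CycleRel.not_inr g (fun t => f (t + t0)) hshift hconst t
        rcases hx : f (t + t0) with ⟨j, q | v⟩
        · rw [hx] at h3
          cases h3
          exact ⟨q, rfl⟩
        · rw [hx] at h3
          cases h3
          exact (h4 v hx).elim
      choose y hy using key
      refine G.winsPlay_of_shift t0 ?_
      have h5 := (g i).win y (by
        intro t
        have h := hshift t
        rw [hy, hy] at h
        cases h with
        | stay h => exact h)
      simpa [hy, cyclePos] using h5

/-! ### Strategies -/

theorem history_succ (ρ : ℕ → V) (i : ℕ) :
    Arena.history ρ (i + 1) = Arena.history ρ i ++ [ρ (i + 1)] := by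
  simp [Arena.history, List.range_succ]

theorem getLast_history (ρ : ℕ → V) (i : ℕ) (d : V) :
    (Arena.history ρ i).getLast?.getD d = ρ i := by
  cases i with
  | zero => rfl
  | succ i => simp [history_succ]

theorem win_of_winsFrom {σ : Bool} {v : V} (h : G.WinsFrom σ Finset.univ v) : v ∈ G.Win σ := by
  classical
  obtain ⟨Q, g, q0, hq0⟩ := h
  choose succ hsucc using G.exists_succ
  have h1 : ∀ q, ∃ q', G.owner (g.pos q) = σ → g.R q q' := fun q => by
    by_cases ho : G.owner (g.pos q) = σ
    · obtain ⟨q', h⟩ := g.own q ho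
      exact ⟨q', fun _ => h⟩
    · exact ⟨q, fun h => (ho h).elim⟩
  choose nxt hnxt using h1
  have h2 : ∀ q u, ∃ q', G.owner (g.pos q) ≠ σ → (g.pos q, u) ∈ G.E → g.R q q' ∧ g.pos q' = u := by
    intro q u
    by_cases ho : G.owner (g.pos q) ≠ σ ∧ (g.pos q, u) ∈ G.E
    · obtain ⟨q', h⟩ := g.opp q ho.1 u (Finset.mem_univ _) ho.2
      exact ⟨q', fun _ _ => h⟩
    · exact ⟨q, fun h h' => (ho ⟨h, h'⟩).elim⟩
  choose resp hresp using h2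
  let upd : Q → V → Q := fun q u => if G.owner (g.pos q) = σ then nxt q else resp q u
  let step : Option Q → V → Option Q := fun m u => some (m.elim q0 fun q => upd q u)
  let move : List V → V := fun l => ((l.foldl step none).elim v fun q => g.pos (nxt q))
  let s : List V → V := fun l =>
    if (l.getLast?.getD v, move l) ∈ G.E then move l else succ (l.getLast?.getD v)
  refine ⟨s, ?_, ?_⟩
  · intro ρ hρ i ho
    simp only [s, getLast_history]
    split
    · assumption
    · exact hsucc _
  · intro ρ hρ h0 hfol
    let f : ℕ → Q := fun i => Nat.rec q0 (fun i q => upd q (ρ (i + 1))) i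
    have hf0 : f 0 = q0 := rfl
    have hf1 : ∀ i, f (i + 1) = upd (f i) (ρ (i + 1)) := fun i => rfl
    have hmem : ∀ i, (Arena.history ρ i).foldl step none = some (f i) := by
      intro i
      induction i with
      | zero => rfl
      | succ i ih => simp [history_succ, ih, step, hf1]
    have hstep : ∀ i, g.pos (f i) = ρ i → g.R (f i) (f (i + 1)) ∧ g.pos (f (i + 1)) = ρ (i + 1) := by
      intro i hi
      by_cases ho : G.owner (g.pos (f i)) = σ
      · have hR := hnxt _ ho
        have hu : f (i + 1) = nxt (f i) := by simp [hf1, upd, ho]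
        have hE := g.edge hR
        rw [hi] at hE
        refine ⟨hu ▸ hR, ?_⟩
        rw [hfol i (hi ▸ ho)]
        simp only [s, move, getLast_history, hmem, Option.elim_some, if_pos hE, hu]
      · have hE := hρ i
        rw [← hi] at hE
        have := hresp (f i) (ρ (i + 1)) ho hE
        simpa [hf1, upd, ho] using this
    have hpos : ∀ i, g.pos (f i) = ρ i := by
      intro i
      induction i with
      | zero => rw [hf0, hq0, h0]
      | succ i ih => exact (hstep i ih).2
    have := g.win f fun i => (hstep i (hpos i)).1
    simpa [hpos] using this

theorem strategy_edge {σ : Bool} {s : List V → V} (hs : G.IsStrategy σ s) (ρ : ℕ → V) (i : ℕ)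
    (hρ : ∀ t < i, (ρ t, ρ (t + 1)) ∈ G.E) (ho : G.owner (ρ i) = σ) :
    (ρ i, s (Arena.history ρ i)) ∈ G.E := by
  choose succ hsucc using G.exists_succ
  let ρ' : ℕ → V := fun t => succ^[t - i] (ρ (min t i))
  have h1 : ∀ t ≤ i, ρ' t = ρ t := fun t ht => by
    simp [ρ', Nat.sub_eq_zero_of_le ht, min_eq_left ht]
  have hplay : G.IsPlay ρ' := by
    intro t
    rcases lt_or_ge t i with h | h
    · rw [h1 t h.le, h1 (t + 1) h]
      exact hρ t h
    · have : ρ' (t + 1) = succ (ρ' t) := by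
        simp only [ρ']
        rw [min_eq_right h, min_eq_right (by omega), show t + 1 - i = t - i + 1 by omega,
          Function.iterate_succ_apply']
      rw [this]
      exact hsucc _
  have h2 : Arena.history ρ' i = Arena.history ρ i := by
    refine List.map_congr_left fun t ht => h1 t ?_
    have := List.mem_range.1 ht
    omega
  have := hs ρ' hplay i (by rw [h1 i le_rfl]; exact ho)
  rwa [h1 i le_rfl, h2] at this

theorem win_disjoint {v : V} (h0 : v ∈ G.Win false) (h1 : v ∈ G.Win true) : False := by
  obtain ⟨s0, hs0, hw0⟩ := h0
  obtain ⟨s1, hs1, hw1⟩ := h1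
  let mv : List V → V := fun l => if G.owner (l.getLast?.getD v) = false then s0 l else s1 l
  let H : ℕ → List V := fun i => Nat.rec [v] (fun _ l => l ++ [mv l]) i
  have hH : ∀ i, H (i + 1) = H i ++ [mv (H i)] := fun _ => rfl
  let ρ : ℕ → V := fun i => (H i).getLast?.getD v
  have hhist : ∀ i, Arena.history ρ i = H i := by
    intro i
    induction i with
    | zero => rfl
    | succ i ih => simp [history_succ, ih, hH, ρ]
  have hρ : ∀ i, ρ (i + 1) = mv (Arena.history ρ i) := fun i => by
    rw [hhist]
    simp [ρ, hH]
  have hmv0 : ∀ i, G.owner (ρ i) = false → ρ (i + 1) = s0 (Arena.history ρ i) := fun i h => by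
    rw [hρ]
    simp only [mv, getLast_history, h, if_true]
  have hmv1 : ∀ i, G.owner (ρ i) = true → ρ (i + 1) = s1 (Arena.history ρ i) := fun i h => by
    rw [hρ]
    simp [mv, getLast_history, h]
  have hplay : G.IsPlay ρ := by
    intro i
    induction i using Nat.strong_induction_on with
    | _ i ih =>
      cases h : G.owner (ρ i)
      · rw [hmv0 i h]
        exact strategy_edge hs0 ρ i ih h
      · rw [hmv1 i h]
        exact strategy_edge hs1 ρ i ih h
  obtain ⟨X, hX, eX⟩ := hw0 ρ hplay rfl hmv0
  obtain ⟨Y, hY, eY⟩ := hw1 ρ hplay rfl hmv1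
  have : X = Y := Finset.coe_injective (eX.trans eY.symm)
  subst this
  have := Finset.mem_inter.2 ⟨hX, hY⟩
  rw [G.inter_eq] at this
  simp at this

/-! ### The recursion over subgames -/

/-- `D` is a solution of the subgame on `S`; nothing is required of the winning regions when
`S` is no subarena. -/
structure IsSolution (G : ColouredMullerGame V C) (S : Finset V) (D : Bool → Finset V) : Prop where
  subset : ∀ τ, D τ ⊆ S
  compl : ∀ τ, D (!τ) = S \ D τ
  winsFrom : G.IsSubarena S → ∀ τ, ∀ v ∈ D τ, G.WinsFrom τ S v

theorem IsSolution.of_single {S : Finset V} {σ : Bool} {Y : Finset V} (hY : Y ⊆ S)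
    (h1 : G.IsSubarena S → ∀ v ∈ Y, G.WinsFrom σ S v)
    (h2 : G.IsSubarena S → ∀ v ∈ S \ Y, G.WinsFrom (!σ) S v) :
    G.IsSolution S (fun τ => if τ = σ then Y else S \ Y) := by
  refine ⟨fun τ => ?_, fun τ => ?_, fun hS τ v hv => ?_⟩
  · by_cases h : τ = σ <;> simp [h, hY]
  · cases τ <;> cases σ <;> simp [Finset.sdiff_sdiff_eq_self hY]
  · by_cases h : τ = σ
    · subst h
      exact h1 hS v (by simpa using hv)
    · rw [show τ = !σ by cases τ <;> cases σ <;> simp_all]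
      exact h2 hS v (by simpa [h] using hv)

/-- The owner of the colours of `S` wins everywhere if no attractor leaves anything to the
opponent. -/
theorem isSolution_of_forall_empty {σ : Bool} {S : Finset V} (hF : S.image G.c ∈ G.F σ)
    (h : ∀ j ∈ S.image G.c, ∃ A D, G.IsAttractor σ S (Finset.univ.filter (G.c · = j)) A ∧
      G.IsSolution (S \ A) D ∧ D (!σ) = ∅) :
    G.IsSolution S (fun τ => if τ = σ then S else S \ S) := by
  classical
  refine .of_single subset_rfl (fun hS v hv => ?_) (by simp)
  choose! A D hA hD he using h
  refine winsFrom_of_attractors hS hF A hA (fun j hj u hu => ?_) hv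
  refine (hD j hj).winsFrom ((hA j hj).isSubarena hS) σ u ?_
  have := (hD j hj).compl σ
  rw [he j hj] at this
  exact (Finset.sdiff_eq_empty_iff_subset.1 this.symm) hu

/-- Otherwise, it suffices to remove the attractor to a part of the opponent's region. -/
theorem isSolution_of_attractor {σ : Bool} {S A T X B : Finset V} {D D' : Bool → Finset V}
    (hA : G.IsAttractor σ S T A) (hD : G.IsSolution (S \ A) D) (hX : X = D (!σ))
    (hB : G.IsAttractor (!σ) S X B) (hD' : G.IsSolution (S \ B) D') :
    G.IsSolution S (fun τ => if τ = σ then D' σ else S \ D' σ) := by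
  have hwin : G.IsSubarena S → ∀ v ∈ B, G.WinsFrom (!σ) S v := fun hS v hv => by
    refine hB.winsFrom (fun u hu => ?_) hv
    subst hX
    have := hD.winsFrom (hA.isSubarena hS) (!σ) u hu
    refine IsAttractor.winsFrom_of_sdiff (σ := !σ) (T := T) (A := A) ?_ this
    rwa [Bool.not_not]
  refine .of_single ((hD'.subset σ).trans Finset.sdiff_subset) (fun hS v hv => ?_)
    (fun hS v hv => ?_)
  · exact hB.winsFrom_of_sdiff (hD'.winsFrom (hB.isSubarena hS) σ v hv)
  · rw [Finset.mem_sdiff] at hv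
    by_cases hvB : v ∈ B
    · exact hwin hS v hvB
    · refine winsFrom_of_winsFrom_sdiff (hwin hS) (hD'.winsFrom (hB.isSubarena hS) (!σ) v ?_)
      rw [hD'.compl σ]
      simp [hv.1, hv.2, hvB]

theorem IsSolution.mem_win_iff {D : Bool → Finset V} (h : G.IsSolution Finset.univ D) (v : V)
    (σ : Bool) : v ∈ G.Win σ ↔ decide (v ∈ D true) = σ := by
  have hS : G.IsSubarena Finset.univ := fun u _ => by
    obtain ⟨w, hw⟩ := G.exists_succ u
    exact ⟨w, Finset.mem_univ _, hw⟩
  have hin : ∀ τ, v ∈ D τ → v ∈ G.Win τ := fun τ hv => win_of_winsFrom (h.winsFrom hS τ v hv)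
  have hc := h.compl true
  by_cases hv : v ∈ D true
  · have := hin true hv
    cases σ
    · simpa [hv] using fun h' => win_disjoint h' this
    · simpa [hv]
  · have := hin false (by rw [show false = !true from rfl, hc]; simp [hv])
    cases σ
    · simpa [hv]
    · simpa [hv] using fun h' => win_disjoint this h'

end Regions

end ColouredMullerGame

/-! ### A language with arrays

Programs over an unbounded store of named arrays, a scalar variable being cell `0` of its
array.  They are compiled to RAM programs: the array `inp` is the initial part of the memory,
and the others are interleaved behind it. -/

namespace Imp

/-- The array names. -/
inductive Id
  | inp | n | k | m | f0 | f1 | N | pow | own | col | colm | src | tgt | pr | deg | tf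
  | S | cs | sg | X | Y | T | P | A | hd | tl | v | e | i | j | u | d | cnt | q | w
  deriving DecidableEq

theorem Id.ctorIdx_injective : Function.Injective Id.ctorIdx := by
  intro a b h
  have := congrArg Id.ofNat h
  rwa [Id.ofNat_ctorIdx, Id.ofNat_ctorIdx] at this

theorem Id.ctorIdx_lt (a : Id) : a.ctorIdx < 64 := by
  cases a <;> decide

abbrev Store := Id → ℕ → ℕ

def Store.put (σ : Store) (a : Id) (i b : ℕ) : Store :=
  fun a' i' => if a' = a ∧ i' = i then b else σ a' i'

inductive Expr
  | lit (a : ℕ)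
  | get (a : Id) (e : Expr)
  | op (o : RAM.Op) (e f : Expr)

namespace Expr

instance (a : ℕ) : OfNat Expr a := ⟨lit a⟩
instance : Add Expr := ⟨op .add⟩
instance : Sub Expr := ⟨op .sub⟩
instance : Mul Expr := ⟨op .mul⟩
instance : Div Expr := ⟨op .div⟩
instance : Mod Expr := ⟨op .mod⟩

/-- A scalar variable. -/
abbrev var (a : Id) : Expr := get a (lit 0)

def eval (σ : Store) : Expr → ℕ
  | lit a => a
  | get a e => σ a (e.eval σ)
  | op o e f => o.eval (e.eval σ) (f.eval σ)

/-- All array accesses are below the limits. -/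
def InRange (lim : Id → ℕ) (σ : Store) : Expr → Prop
  | lit _ => True
  | get a e => e.InRange lim σ ∧ e.eval σ < lim a
  | op _ e f => e.InRange lim σ ∧ f.InRange lim σ

def size : Expr → ℕ
  | lit _ => 1
  | get _ e => e.size
  | op _ e f => e.size + f.size

def cost : Expr → ℕ
  | lit _ => 1
  | get _ e => e.cost + 6
  | op _ e f => e.cost + f.cost + 1

def SmallLits : Expr → Bool
  | lit a => a < 64
  | get _ e => e.SmallLits
  | op _ e f => e.SmallLits && f.SmallLits

theorem size_pos (e : Expr) : 0 < e.size := by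
  induction e with
  | lit => simp [size]
  | get _ e ih => exact ih
  | op _ e f ih => simp only [size]; omega

theorem eval_lt {σ : Store} {lim : Id → ℕ} {b : ℕ} (hb : 64 ≤ b)
    (hσ : ∀ a i, i < lim a → σ a i < b) {e : Expr} (he : e.InRange lim σ) (hl : e.SmallLits) :
    e.eval σ < b ^ e.size := by
  induction e with
  | lit a =>
    simp only [SmallLits, decide_eq_true_eq] at hl
    simp only [eval, size, pow_one]
    omega
  | get a e ih =>
    calc σ a (e.eval σ) < b := hσ _ _ he.2
      _ = b ^ 1 := (pow_one b).symm
      _ ≤ b ^ e.size := Nat.pow_le_pow_right (by omega) e.size_pos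
  | op o e f ihe ihf =>
    simp only [SmallLits, Bool.and_eq_true] at hl
    have h1 := ihe he.1 hl.1
    have h2 := ihf he.2 hl.2
    simp only [eval, size, pow_add]
    have h3 : b ^ e.size ≤ b ^ e.size * b ^ f.size := Nat.le_mul_of_pos_right _ (by positivity)
    cases o <;> simp only [RAM.Op.eval]
    · nlinarith
    · exact ((Nat.sub_le _ _).trans_lt h1).trans_le h3
    · exact Nat.mul_lt_mul'' h1 h2
    · exact ((Nat.div_le_self _ _).trans_lt h1).trans_le h3
    · exact ((Nat.mod_le _ _).trans_lt h1).trans_le h3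

end Expr

def reg (d : ℕ) : Fin 16 := Fin.ofNat 16 d

theorem reg_ne {c d : ℕ} (hc : c < 16) (hd : d < 16) (h : c ≠ d) : reg c ≠ reg d := by
  simp only [reg, Fin.ofNat, ne_eq, Fin.mk.injEq]
  omega

open RAM (Cmd State Exec)

/-- Replaces an index in register `d` by the address; register `0` holds the base address. -/
def addrCmd (a : Id) (d : ℕ) : Cmd 16 :=
  if a = .inp then .skip else
    .seq (.const (reg (d + 1)) 64) <| .seq (.arith .mul (reg d) (reg d) (reg (d + 1))) <|
    .seq (.const (reg (d + 1)) a.ctorIdx) <| .seq (.arith .add (reg d) (reg d) (reg (d + 1)))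
    (.arith .add (reg d) (reg d) (reg 0))

def addr (base : ℕ) (a : Id) (i : ℕ) : ℕ := if a = .inp then i else i * 64 + a.ctorIdx + base

def Expr.compile : Expr → ℕ → Cmd 16
  | lit a, d => .const (reg d) a
  | get a e, d => .seq (e.compile d) (.seq (addrCmd a d) (.load (reg d) (reg d)))
  | op o e f, d => .seq (e.compile d) (.seq (f.compile (d + 1))
      (.arith o (reg d) (reg d) (reg (d + 1))))

/-- The parameters of a simulation: the limits of the array indices, the limit of the values, the
base address, and the size and the word length of the machine. -/
structure Limits where
  lim : Id → ℕ
  b : ℕ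
  base : ℕ
  s : ℕ
  w : ℕ
  le_b : 64 ≤ b
  pow_le : b ^ 10 ≤ 2 ^ w
  s_le : s ≤ 2 ^ w
  inp_le : lim .inp ≤ base
  base_le : base ≤ s
  addr_lt : ∀ a, a ≠ .inp → ∀ i < lim a, i * 64 + 64 + base ≤ s

variable {L : Limits}

theorem Limits.addr_lt_s {a : Id} {i : ℕ} (h : i < L.lim a) : addr L.base a i < L.s := by
  unfold addr
  split
  · rename_i ha
    have := L.inp_le
    have := L.base_le
    subst ha
    omega
  · rename_i ha
    have := L.addr_lt a ha i h
    have := a.ctorIdx_lt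
    omega

theorem Limits.addr_inj {a a' : Id} {i i' : ℕ} (h : i < L.lim a) (h' : i' < L.lim a')
    (e : addr L.base a i = addr L.base a' i') : a = a' ∧ i = i' := by
  unfold addr at e
  have h1 := a.ctorIdx_lt
  have h2 := a'.ctorIdx_lt
  have h3 := L.inp_le
  split at e <;> split at e
  · subst_vars
    exact ⟨rfl, rfl⟩
  · subst_vars
    omega
  · subst_vars
    omega
  · exact ⟨Id.ctorIdx_injective (by omega), by omega⟩

/-- The machine state `μ` represents the store `σ`. -/
structure Rep (L : Limits) (σ : Store) (μ : State 16) : Prop where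
  reg_zero : μ.reg (reg 0) = L.base
  mem : ∀ a i, i < L.lim a → μ.mem (addr L.base a i) = σ a i
  lt : ∀ a i, i < L.lim a → σ a i < L.b

theorem exec_addrCmd {a : Id} {d : ℕ} (hd : 0 < d) (hd' : d + 1 < 16) {μ : State 16}
    (h0 : μ.reg (reg 0) = L.base) (hi : μ.reg (reg d) < L.lim a) :
    ∃ t ≤ 5, ∃ μ', Exec L.s L.w (addrCmd a d) μ t μ' ∧ μ'.mem = μ.mem ∧
      μ'.reg (reg d) = addr L.base a (μ.reg (reg d)) ∧
      ∀ c < d, μ'.reg (reg c) = μ.reg (reg c) := by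
  unfold addrCmd addr
  split
  · exact ⟨1, by omega, μ, .skip μ, rfl, rfl, fun _ _ => rfl⟩
  · rename_i ha
    have h1 := L.addr_lt a ha _ hi
    have h2 := L.s_le
    have h3 := a.ctorIdx_lt
    have h4 : 64 < 2 ^ L.w :=
      ((by norm_num : 64 < 64 ^ 10).trans_le (Nat.pow_le_pow_left L.le_b 10)).trans_le L.pow_le
    have e1 : reg d ≠ reg (d + 1) := reg_ne (by omega) hd' (by omega)
    have e2 : reg 0 ≠ reg (d + 1) := reg_ne (by omega) hd' (by omega)
    have e3 : reg 0 ≠ reg d := reg_ne (by omega) (by omega) (by omega)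
    refine ⟨1 + (1 + (1 + (1 + 1))), by omega, _, .seq (.const _ _ _ (by omega)) <|
      .seq (.arith _ _ _ _ _ ?_) <| .seq (.const _ _ _ (by omega)) <|
      .seq (.arith _ _ _ _ _ ?_) (.arith _ _ _ _ _ ?_), ?_, ?_, ?_⟩
    · simp [State.setReg, RAM.Op.eval, e1]
      omega
    · simp [State.setReg, RAM.Op.eval, e1]
      omega
    · simp [State.setReg, RAM.Op.eval, e1, e2, e3, h0]
      omega
    · rfl
    · simp [State.setReg, RAM.Op.eval, e1, e2, e3, h0]
    · intro c hc
      have e4 : reg c ≠ reg (d + 1) := reg_ne (by omega) hd' (by omega)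
      have e5 : reg c ≠ reg d := reg_ne (by omega) (by omega) (by omega)
      simp [State.setReg, Function.update_apply, e4, e5]

theorem Expr.exec_compile {σ : Store} {e : Expr} {d : ℕ} (hd : 0 < d) (hd' : d + e.size < 16)
    (hs : e.size ≤ 10) {μ : State 16} (hμ : Rep L σ μ) (he : e.InRange L.lim σ)
    (hl : e.SmallLits) :
    ∃ t ≤ e.cost, ∃ μ', Exec L.s L.w (e.compile d) μ t μ' ∧ μ'.mem = μ.mem ∧
      μ'.reg (reg d) = e.eval σ ∧ ∀ c < d, μ'.reg (reg c) = μ.reg (reg c) := by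
  have hb := L.le_b
  have hlt := eval_lt hb hμ.lt he hl
  have hw : e.eval σ < 2 ^ L.w :=
    (hlt.trans_le (Nat.pow_le_pow_right (by omega) hs)).trans_le L.pow_le
  induction e generalizing d μ with
  | lit a =>
    refine ⟨1, le_rfl, _, .const _ _ _ hw, rfl, by simp [State.setReg, eval], fun c hc => ?_⟩
    have e5 : reg c ≠ reg d := reg_ne (by simp only [size] at hd'; omega)
      (by simp only [size] at hd'; omega) (by omega)
    simp [State.setReg, e5]
  | get a e ih =>
    have hp := e.size_pos
    simp only [size] at hd' hs
    have hlt' := eval_lt hb hμ.lt he.1 hl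
    obtain ⟨t, ht, μ1, hx1, hm1, hr1, hc1⟩ := ih hd hd' hs hμ he.1 hl hlt'
      ((hlt'.trans_le (Nat.pow_le_pow_right (by omega) hs)).trans_le L.pow_le)
    obtain ⟨t2, ht2, μ2, hx2, hm2, hr2, hc2⟩ := exec_addrCmd (L := L) (a := a) hd (by omega)
      (μ := μ1) (by rw [hc1 0 hd, hμ.reg_zero]) (by rw [hr1]; exact he.2)
    rw [hr1] at hr2
    refine ⟨t + (t2 + 1), by simp only [cost]; omega, _,
      .seq hx1 (.seq hx2 (.load _ _ _ ?_)), ?_, ?_, ?_⟩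
    · rw [hr2]
      exact Limits.addr_lt_s he.2
    · simp [State.setReg, hm2, hm1]
    · simp [State.setReg, hr2, hm2, hm1, hμ.mem _ _ he.2, eval]
    · intro c hc
      have e5 : reg c ≠ reg d := reg_ne (by omega) (by omega) (by omega)
      simp [State.setReg, e5, hc2 c hc, hc1 c hc]
  | op o e f ihe ihf =>
    have hp := e.size_pos
    have hp2 := f.size_pos
    simp only [size] at hd' hs
    simp only [SmallLits, Bool.and_eq_true] at hl
    have hlt1 := eval_lt hb hμ.lt he.1 hl.1
    have hlt2 := eval_lt hb hμ.lt he.2 hl.2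
    obtain ⟨t, ht, μ1, hx1, hm1, hr1, hc1⟩ := ihe hd (by omega) (by omega) hμ he.1 hl.1 hlt1
      ((hlt1.trans_le (Nat.pow_le_pow_right (by omega) (by omega))).trans_le L.pow_le)
    obtain ⟨t2, ht2, μ2, hx2, hm2, hr2, hc2⟩ := ihf (d := d + 1) (by omega) (by omega) (by omega)
      (μ := μ1) ⟨by rw [hc1 0 hd, hμ.reg_zero], by rw [hm1]; exact hμ.mem, hμ.lt⟩ he.2 hl.2 hlt2
      ((hlt2.trans_le (Nat.pow_le_pow_right (by omega) (by omega))).trans_le L.pow_le)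
    have hr3 : μ2.reg (reg d) = e.eval σ := by rw [hc2 d (by omega), hr1]
    refine ⟨t + (t2 + 1), by simp only [cost]; omega, _,
      .seq hx1 (.seq hx2 (.arith _ _ _ _ _ ?_)), ?_, ?_, ?_⟩
    · rw [hr2, hr3]
      exact hw
    · simp [State.setReg, hm2, hm1]
    · simp [State.setReg, hr2, hr3, eval]
    · intro c hc
      have e5 : reg c ≠ reg d := reg_ne (by omega) (by omega) (by omega)
      simp [State.setReg, e5, hc2 c (by omega), hc1 c hc]

inductive Prog
  | skip
  /-- `a[i] := e` -/
  | put (a : Id) (i e : Expr)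
  | seq (p q : Prog)
  | ite (τ : RAM.Test) (e f : Expr) (p q : Prog)
  | whl (τ : RAM.Test) (e f : Expr) (p : Prog)

namespace Prog

def compile : Prog → Cmd 16
  | skip => .skip
  | put a i e => .seq (i.compile 1) (.seq (addrCmd a 1) (.seq (e.compile 2)
      (.store (reg 1) (reg 2))))
  | seq p q => .seq p.compile q.compile
  | ite τ e f p q => .seq (.seq (e.compile 1) (f.compile 2))
      (.cond τ (reg 1) (reg 2) p.compile q.compile)
  | whl τ e f p => .seq (.seq (e.compile 1) (f.compile 2))
      (.loop τ (reg 1) (reg 2) (.seq p.compile (.seq (e.compile 1) (f.compile 2))))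

/-- The expressions are small enough to be evaluated in the registers. -/
def Small : Prog → Bool
  | skip => true
  | put _ i e => i.size ≤ 10 && e.size ≤ 10 && i.cost + e.cost ≤ 200 && i.SmallLits && e.SmallLits
  | seq p q => p.Small && q.Small
  | ite _ e f p q => e.size ≤ 10 && f.size ≤ 10 && e.cost + f.cost ≤ 200 && e.SmallLits &&
      f.SmallLits && p.Small && q.Small
  | whl _ e f p => e.size ≤ 10 && f.size ≤ 10 && e.cost + f.cost ≤ 200 && e.SmallLits &&
      f.SmallLits && p.Small

/-- The arrays that are assigned to. -/
def mods : Prog → List Id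
  | skip => []
  | put a _ _ => [a]
  | seq p q => p.mods ++ q.mods
  | ite _ _ _ p q => p.mods ++ q.mods
  | whl _ _ _ p => p.mods

/-- `Runs L p σ t σ'`: within the limits `L`, `p` leads from `σ` to `σ'` in `t` steps. -/
inductive Runs (L : Limits) : Prog → Store → ℕ → Store → Prop
  | skip (σ) : Runs L .skip σ 1 σ
  | put {σ a i e} (hi : i.InRange L.lim σ) (he : e.InRange L.lim σ) (hi' : i.eval σ < L.lim a)
      (he' : e.eval σ < L.b) : Runs L (.put a i e) σ 1 (σ.put a (i.eval σ) (e.eval σ))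
  | seq {p q σ₁ σ₂ σ₃ t₁ t₂} (h₁ : Runs L p σ₁ t₁ σ₂) (h₂ : Runs L q σ₂ t₂ σ₃) :
      Runs L (.seq p q) σ₁ (t₁ + t₂) σ₃
  | iteTrue {τ e f p q σ σ' t} (he : e.InRange L.lim σ) (hf : f.InRange L.lim σ)
      (h : RAM.Test.Holds τ (e.eval σ) (f.eval σ)) (hp : Runs L p σ t σ') :
      Runs L (.ite τ e f p q) σ (t + 1) σ'
  | iteFalse {τ e f p q σ σ' t} (he : e.InRange L.lim σ) (hf : f.InRange L.lim σ)
      (h : ¬ RAM.Test.Holds τ (e.eval σ) (f.eval σ)) (hq : Runs L q σ t σ') :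
      Runs L (.ite τ e f p q) σ (t + 1) σ'
  | whlDone {τ e f p σ} (he : e.InRange L.lim σ) (hf : f.InRange L.lim σ)
      (h : ¬ RAM.Test.Holds τ (e.eval σ) (f.eval σ)) : Runs L (.whl τ e f p) σ 1 σ
  | whlStep {τ e f p σ₁ σ₂ σ₃ t₁ t₂} (he : e.InRange L.lim σ₁) (hf : f.InRange L.lim σ₁)
      (h : RAM.Test.Holds τ (e.eval σ₁) (f.eval σ₁)) (h₁ : Runs L p σ₁ t₁ σ₂)
      (h₂ : Runs L (.whl τ e f p) σ₂ t₂ σ₃) : Runs L (.whl τ e f p) σ₁ (t₁ + t₂ + 1) σ₃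

theorem Runs.frame {p : Prog} {σ σ' : Store} {t : ℕ} (h : Runs L p σ t σ') {a : Id}
    (ha : a ∉ p.mods) : σ' a = σ a := by
  induction h with
  | skip => rfl
  | put hi he hi' he' =>
    funext j
    have : a ≠ _ := fun h => ha (List.mem_singleton.2 h)
    simp [Store.put, this]
  | seq _ _ ih1 ih2 =>
    simp only [mods, List.mem_append, not_or] at ha
    rw [ih2 ha.2, ih1 ha.1]
  | iteTrue _ _ _ _ ih =>
    simp only [mods, List.mem_append, not_or] at ha
    exact ih ha.1
  | iteFalse _ _ _ _ ih =>
    simp only [mods, List.mem_append, not_or] at ha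
    exact ih ha.2
  | whlDone => rfl
  | whlStep _ _ _ _ _ ih1 ih2 => rw [ih2 ha, ih1 ha]

theorem exec_pair {σ : Store} {e f : Expr} (h1 : e.size ≤ 10) (h2 : f.size ≤ 10)
    (hl1 : e.SmallLits) (hl2 : f.SmallLits) (he : e.InRange L.lim σ) (hf : f.InRange L.lim σ)
    {μ : State 16} (hμ : Rep L σ μ) :
    ∃ t ≤ e.cost + f.cost, ∃ μ', Exec L.s L.w (.seq (e.compile 1) (f.compile 2)) μ t μ' ∧
      Rep L σ μ' ∧ μ'.reg (reg 1) = e.eval σ ∧ μ'.reg (reg 2) = f.eval σ := by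
  obtain ⟨t, ht, μ1, hx1, hm1, hr1, hc1⟩ := e.exec_compile (d := 1) (by omega) (by omega) h1 hμ
    he hl1
  have hμ1 : Rep L σ μ1 := ⟨by rw [hc1 0 (by omega), hμ.reg_zero], by rw [hm1]; exact hμ.mem,
    hμ.lt⟩
  obtain ⟨t2, ht2, μ2, hx2, hm2, hr2, hc2⟩ := f.exec_compile (d := 2) (by omega) (by omega) h2
    hμ1 hf hl2
  exact ⟨t + t2, by omega, μ2, .seq hx1 hx2, ⟨by rw [hc2 0 (by omega), hμ1.reg_zero],
    by rw [hm2]; exact hμ1.mem, hμ.lt⟩, by rw [hc2 1 (by omega), hr1], hr2⟩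

theorem Runs.exec_compile {p : Prog} {σ σ' : Store} {t : ℕ} (h : Runs L p σ t σ') (hp : p.Small)
    {μ : State 16} (hμ : Rep L σ μ) :
    ∃ t' ≤ 300 * t, ∃ μ', Exec L.s L.w p.compile μ t' μ' ∧ Rep L σ' μ' := by
  induction h generalizing μ with
  | skip σ => exact ⟨1, by omega, μ, .skip _, hμ⟩
  | @put σ a i e hi he hi' he' =>
    simp only [Small, Bool.and_eq_true, decide_eq_true_eq] at hp
    obtain ⟨⟨⟨⟨h1, h2⟩, hc⟩, hl1⟩, hl2⟩ := hp
    obtain ⟨t, ht, μ1, hx1, hm1, hr1, hc1⟩ := i.exec_compile (d := 1) (by omega) (by omega) h1 hμ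
      hi hl1
    obtain ⟨t2, ht2, μ2, hx2, hm2, hr2, hc2⟩ := exec_addrCmd (L := L) (a := a) (d := 1)
      (by omega) (by omega) (μ := μ1) (by rw [hc1 0 (by omega), hμ.reg_zero])
      (by rw [hr1]; exact hi')
    have hμ2 : Rep L σ μ2 := ⟨by rw [hc2 0 (by omega), hc1 0 (by omega), hμ.reg_zero],
      by rw [hm2, hm1]; exact hμ.mem, hμ.lt⟩
    obtain ⟨t3, ht3, μ3, hx3, hm3, hr3, hc3⟩ := e.exec_compile (d := 2) (by omega) (by omega) h2
      hμ2 he hl2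
    have h4 : μ3.reg (reg 1) = addr L.base a (i.eval σ) := by
      rw [hc3 1 (by omega), hr2, hr1]
    refine ⟨t + (t2 + (t3 + 1)), by omega, _, .seq hx1 (.seq hx2 (.seq hx3 (.store _ _ _ ?_))),
      ?_, ?_, ?_⟩
    · rw [h4]
      exact Limits.addr_lt_s hi'
    · simp only [State.setMem]
      rw [hc3 0 (by omega), hμ2.reg_zero]
    · intro a' i' h'
      simp only [State.setMem, h4, hr3, Store.put, Function.update_apply]
      by_cases hx : a' = a ∧ i' = i.eval σ
      · rw [if_pos hx, if_pos (by rw [hx.1, hx.2])]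
      · rw [if_neg hx, if_neg (fun h => hx (Limits.addr_inj h' hi' h)), hm3]
        exact hμ2.mem _ _ h'
    · intro a' i' h'
      simp only [Store.put]
      split
      · exact he'
      · exact hμ.lt _ _ h'
  | seq _ _ ih1 ih2 =>
    simp only [Small, Bool.and_eq_true] at hp
    obtain ⟨t1, ht1, μ1, hx1, hμ1⟩ := ih1 hp.1 hμ
    obtain ⟨t2, ht2, μ2, hx2, hμ2⟩ := ih2 hp.2 hμ1
    exact ⟨t1 + t2, by omega, μ2, .seq hx1 hx2, hμ2⟩
  | iteTrue he hf h _ ih =>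
    simp only [Small, Bool.and_eq_true, decide_eq_true_eq] at hp
    obtain ⟨⟨⟨⟨⟨⟨h1, h2⟩, hc⟩, hl1⟩, hl2⟩, hp⟩, hq⟩ := hp
    obtain ⟨t, ht, μ1, hx1, hμ1, e1, e2⟩ := exec_pair h1 h2 hl1 hl2 he hf hμ
    obtain ⟨t2, ht2, μ2, hx2, hμ2⟩ := ih hp hμ1
    exact ⟨t + (t2 + 1), by omega, μ2, .seq hx1 (.condTrue (by rwa [e1, e2]) hx2), hμ2⟩
  | iteFalse he hf h _ ih =>
    simp only [Small, Bool.and_eq_true, decide_eq_true_eq] at hp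
    obtain ⟨⟨⟨⟨⟨⟨h1, h2⟩, hc⟩, hl1⟩, hl2⟩, hp⟩, hq⟩ := hp
    obtain ⟨t, ht, μ1, hx1, hμ1, e1, e2⟩ := exec_pair h1 h2 hl1 hl2 he hf hμ
    obtain ⟨t2, ht2, μ2, hx2, hμ2⟩ := ih hq hμ1
    exact ⟨t + (t2 + 1), by omega, μ2, .seq hx1 (.condFalse (by rwa [e1, e2]) hx2), hμ2⟩
  | whlDone he hf h =>
    simp only [Small, Bool.and_eq_true, decide_eq_true_eq] at hp
    obtain ⟨⟨⟨⟨⟨h1, h2⟩, hc⟩, hl1⟩, hl2⟩, hp⟩ := hp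
    obtain ⟨t, ht, μ1, hx1, hμ1, e1, e2⟩ := exec_pair h1 h2 hl1 hl2 he hf hμ
    exact ⟨t + 1, by omega, μ1, .seq hx1 (.loopDone (by rwa [e1, e2])), hμ1⟩
  | whlStep he hf h _ _ ih1 ih2 =>
    have hp0 := hp
    simp only [Small, Bool.and_eq_true, decide_eq_true_eq] at hp
    obtain ⟨⟨⟨⟨⟨h1, h2⟩, hc⟩, hl1⟩, hl2⟩, hp⟩ := hp
    obtain ⟨t, ht, μ1, hx1, hμ1, e1, e2⟩ := exec_pair h1 h2 hl1 hl2 he hf hμ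
    obtain ⟨t2, ht2, μ2, hx2, hμ2⟩ := ih1 hp hμ1
    obtain ⟨t3, ht3, μ3, hx3, hμ3⟩ := ih2 hp0 hμ2
    cases hx3 with
    | seq hy1 hy2 =>
      rename_i ν s1 s2
      exact ⟨t + (t2 + s1 + s2 + 1), by omega, μ3,
        .seq hx1 (.loopStep (by rwa [e1, e2]) (.seq hx2 hy1) hy2), hμ3⟩

end Prog

end Imp

namespace Imp

open Imp.Expr Imp.Prog

variable {L : Limits}

@[simp] theorem Store.put_apply (σ : Store) (a : Id) (i b : ℕ) (a' : Id) (i' : ℕ) :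
    σ.put a i b a' i' = if a' = a ∧ i' = i then b else σ a' i' := rfl

theorem Store.put_of_ne (σ : Store) {a a' : Id} (i b : ℕ) (h : a' ≠ a) : σ.put a i b a' = σ a' := by
  funext i'
  simp [h]

namespace Expr

variable (σ : Store) (lim : Id → ℕ) (a : ℕ) (x : Id) (e f : Expr)

@[simp] theorem eval_ofNat : (no_index (OfNat.ofNat a) : Expr).eval σ = a := rfl
@[simp] theorem eval_lit : (lit a).eval σ = a := rfl
@[simp] theorem eval_get : (get x e).eval σ = σ x (e.eval σ) := rfl
@[simp] theorem eval_add : (e + f).eval σ = e.eval σ + f.eval σ := rfl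
@[simp] theorem eval_sub : (e - f).eval σ = e.eval σ - f.eval σ := rfl
@[simp] theorem eval_mul : (e * f).eval σ = e.eval σ * f.eval σ := rfl
@[simp] theorem eval_div : (e / f).eval σ = e.eval σ / f.eval σ := rfl
@[simp] theorem eval_mod : (e % f).eval σ = e.eval σ % f.eval σ := rfl
@[simp] theorem inRange_ofNat : (no_index (OfNat.ofNat a) : Expr).InRange lim σ := trivial
@[simp] theorem inRange_lit : (lit a).InRange lim σ := trivial
@[simp] theorem inRange_get : (get x e).InRange lim σ ↔ e.InRange lim σ ∧ e.eval σ < lim x := .rfl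
@[simp] theorem inRange_add : (e + f).InRange lim σ ↔ e.InRange lim σ ∧ f.InRange lim σ := .rfl
@[simp] theorem inRange_sub : (e - f).InRange lim σ ↔ e.InRange lim σ ∧ f.InRange lim σ := .rfl
@[simp] theorem inRange_mul : (e * f).InRange lim σ ↔ e.InRange lim σ ∧ f.InRange lim σ := .rfl
@[simp] theorem inRange_div : (e / f).InRange lim σ ↔ e.InRange lim σ ∧ f.InRange lim σ := .rfl
@[simp] theorem inRange_mod : (e % f).InRange lim σ ↔ e.InRange lim σ ∧ f.InRange lim σ := .rfl

end Expr

@[simp] theorem _root_.RAM.Test.holds_lt (a b : ℕ) : RAM.Test.lt.Holds a b ↔ a < b := .rfl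
@[simp] theorem _root_.RAM.Test.holds_eq (a b : ℕ) : RAM.Test.eq.Holds a b ↔ a = b := .rfl
@[simp] theorem _root_.RAM.Test.holds_ne (a b : ℕ) : RAM.Test.ne.Holds a b ↔ a ≠ b := .rfl

/-- From `σ`, the program `p` halts after some number `t` of steps in a store `σ'` with
`Q σ' t`. -/
def Wp (L : Limits) (p : Prog) (σ : Store) (Q : Store → ℕ → Prop) : Prop :=
  ∃ t σ', Runs L p σ t σ' ∧ Q σ' t

theorem Wp.mono {p : Prog} {σ : Store} {Q Q' : Store → ℕ → Prop} (h : Wp L p σ Q)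
    (hQ : ∀ σ' t, Q σ' t → Q' σ' t) : Wp L p σ Q' := by
  obtain ⟨t, σ', h, hq⟩ := h
  exact ⟨t, σ', h, hQ _ _ hq⟩

/-- The two stores agree outside `l`. -/
def Agree (l : List Id) (σ σ' : Store) : Prop := ∀ a ∉ l, σ' a = σ a

theorem Wp.frame {p : Prog} {σ : Store} {Q : Store → ℕ → Prop} (h : Wp L p σ Q) :
    Wp L p σ (fun σ' t => Q σ' t ∧ Agree p.mods σ σ') := by
  obtain ⟨t, σ', h, hq⟩ := h
  exact ⟨t, σ', h, hq, fun a ha => h.frame ha⟩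

theorem Wp.skip {σ : Store} {Q : Store → ℕ → Prop} (h : Q σ 1) : Wp L .skip σ Q :=
  ⟨1, σ, .skip σ, h⟩

theorem Wp.seq {p q : Prog} {σ : Store} {Q : Store → ℕ → Prop}
    (h : Wp L p σ (fun σ' t => Wp L q σ' (fun σ'' t' => Q σ'' (t + t')))) :
    Wp L (.seq p q) σ Q := by
  obtain ⟨t, σ', h, t', σ'', h', hq⟩ := h
  exact ⟨_, _, .seq h h', hq⟩

theorem Wp.put {a : Id} {i e : Expr} {σ : Store} {Q : Store → ℕ → Prop}
    (hi : i.InRange L.lim σ) (he : e.InRange L.lim σ) (hi' : i.eval σ < L.lim a)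
    (he' : e.eval σ < L.b) (hQ : Q (σ.put a (i.eval σ) (e.eval σ)) 1) :
    Wp L (.put a i e) σ Q :=
  ⟨_, _, .put hi he hi' he', hQ⟩

theorem Wp.put_seq {a : Id} {i e : Expr} {q : Prog} {σ : Store} {Q : Store → ℕ → Prop}
    (hi : i.InRange L.lim σ) (he : e.InRange L.lim σ) (hi' : i.eval σ < L.lim a)
    (he' : e.eval σ < L.b)
    (hq : Wp L q (σ.put a (i.eval σ) (e.eval σ)) (fun σ' t => Q σ' (1 + t))) :
    Wp L (.seq (.put a i e) q) σ Q :=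
  .seq (.put hi he hi' he' hq)

theorem Wp.ite {τ : RAM.Test} {e f : Expr} {p q : Prog} {σ : Store} {Q : Store → ℕ → Prop}
    (he : e.InRange L.lim σ) (hf : f.InRange L.lim σ)
    (hp : τ.Holds (e.eval σ) (f.eval σ) → Wp L p σ (fun σ' t => Q σ' (t + 1)))
    (hq : ¬ τ.Holds (e.eval σ) (f.eval σ) → Wp L q σ (fun σ' t => Q σ' (t + 1))) :
    Wp L (.ite τ e f p q) σ Q := by
  by_cases h : τ.Holds (e.eval σ) (f.eval σ)
  · obtain ⟨t, σ', h', hQ⟩ := hp h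
    exact ⟨_, _, .iteTrue he hf h h', hQ⟩
  · obtain ⟨t, σ', h', hQ⟩ := hq h
    exact ⟨_, _, .iteFalse he hf h h', hQ⟩

/-- The rule for loops, with an invariant `I` that carries a potential, which pays for the
steps. -/
theorem Wp.whl {τ : RAM.Test} {e f : Expr} {p : Prog} {σ : Store} (I : ℕ → Store → Prop)
    {φ : ℕ} (h0 : I φ σ)
    (hr : ∀ φ σ, I φ σ → e.InRange L.lim σ ∧ f.InRange L.lim σ)
    (hp : ∀ φ σ, I φ σ → τ.Holds (e.eval σ) (f.eval σ) →
      Wp L p σ (fun σ' t => ∃ φ', I φ' σ' ∧ t + 1 + φ' ≤ φ)) :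
    Wp L (.whl τ e f p) σ
      (fun σ' t => (∃ φ', I φ' σ') ∧ ¬ τ.Holds (e.eval σ') (f.eval σ') ∧ t ≤ φ + 1) := by
  induction φ using Nat.strong_induction_on generalizing σ with
  | _ φ ih =>
    by_cases hc : τ.Holds (e.eval σ) (f.eval σ)
    · obtain ⟨t, σ', hrun, φ', hI, ht⟩ := hp φ σ h0 hc
      obtain ⟨t', σ'', hrun', hI', hc', ht'⟩ := ih φ' (by omega) hI
      exact ⟨_, _, .whlStep (hr φ σ h0).1 (hr φ σ h0).2 hc hrun hrun', hI', hc', by omega⟩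
    · exact ⟨_, _, .whlDone (hr φ σ h0).1 (hr φ σ h0).2 hc, ⟨φ, h0⟩, hc, by omega⟩

/-- `for x < y do p`, for scalars `x`, `y`. -/
def Prog.forLoop (x y : Id) (p : Prog) : Prog :=
  .seq (.put x 0 0) (.whl .lt (var x) (var y) (.seq p (.put x 0 (var x + 1))))

theorem Wp.forLoop {x y : Id} {p : Prog} {σ : Store} {N : ℕ} (c : ℕ) (J : ℕ → Store → Prop)
    (hxy : x ≠ y) (hx : x ∉ p.mods) (hy : y ∉ p.mods) (hN : σ y 0 = N) (hNb : N < L.b)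
    (hb : 0 < L.b) (hxl : 0 < L.lim x) (hyl : 0 < L.lim y) (h0 : J 0 (σ.put x 0 0))
    (hp : ∀ i < N, ∀ σ', Agree (x :: p.mods) σ σ' → σ' x 0 = i → J i σ' →
      Wp L p σ' (fun σ'' t => t ≤ c ∧ J (i + 1) (σ''.put x 0 (i + 1)))) :
    Wp L (.forLoop x y p) σ (fun σ' t => J N σ' ∧ Agree (x :: p.mods) σ σ' ∧ σ' x 0 = N ∧
      t ≤ N * (c + 2) + 2) := by
  have hyx : y ≠ x := hxy.symm
  refine .put_seq trivial trivial hxl hb ?_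
  refine (Wp.whl (φ := N * (c + 2)) (fun φ σ' => ∃ i ≤ N, φ = (N - i) * (c + 2) ∧ σ' x 0 = i ∧
    Agree (x :: p.mods) σ σ' ∧ J i σ')
    ⟨0, by omega, by simp, by simp, fun a ha => ?_, h0⟩ ?_ ?_).mono ?_
  · rw [List.mem_cons, not_or] at ha
    exact σ.put_of_ne _ _ ha.1
  · intro _ σ' _
    simp [hxl, hyl]
  · rintro _ σ' ⟨i, hi, rfl, hix, hag, hJ⟩ hlt
    have hy' : σ' y 0 = N := by rw [hag y (by simp [hyx, hy]), hN]
    simp only [eval_get, eval_lit, RAM.Test.holds_lt, hy', hix] at hlt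
    refine .seq ((hp i hlt σ' hag hix hJ).frame.mono fun σ'' t h => ?_)
    obtain ⟨⟨ht, hJ'⟩, hag'⟩ := h
    have hix' : σ'' x 0 = i := by rw [hag' x hx, hix]
    refine .put trivial (by simp [hxl]) hxl (by simp [hix']; omega) 
      ⟨(N - (i + 1)) * (c + 2), ⟨i + 1, by omega, rfl, ?_, ?_, ?_⟩, ?_⟩
    · simp [hix']
    · intro a ha
      have ha' := ha
      rw [List.mem_cons, not_or] at ha'
      rw [Store.put_of_ne _ _ _ ha'.1, hag' a ha'.2, hag a ha]
    · simpa [hix'] using hJ'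
    · obtain ⟨k, rfl⟩ : ∃ k, N = i + 1 + k := ⟨N - (i + 1), by omega⟩
      rw [show i + 1 + k - i = k + 1 by omega, show i + 1 + k - (i + 1) = k by omega]
      nlinarith
  · rintro σ' t ⟨⟨_, i, hi, -, hix, hag, hJ⟩, hlt, ht⟩
    have hy' : σ' y 0 = N := by rw [hag y (by simp [hyx, hy]), hN]
    simp only [eval_get, eval_lit, RAM.Test.holds_lt, hy', hix] at hlt
    obtain rfl : i = N := by omega
    exact ⟨hJ, hag, hix, by omega⟩

end Imp

section SetCode

variable {k : ℕ}

@[simp] theorem setCode_empty : setCode (∅ : Finset (Fin k)) = 0 := rfl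

theorem setCode_insert {X : Finset (Fin k)} {u : Fin k} (h : u ∉ X) :
    setCode (insert u X) = setCode X + 2 ^ (u : ℕ) := by
  rw [setCode, Finset.sum_insert h, add_comm]
  rfl

theorem setCode_sdiff {S A : Finset (Fin k)} (h : A ⊆ S) :
    setCode (S \ A) = setCode S - setCode A := by
  have := Finset.sum_sdiff (f := fun j : Fin k => 2 ^ (j : ℕ)) h
  simp only [setCode]
  omega

theorem setCode_lt (X : Finset (Fin k)) : setCode X < 2 ^ k := by
  have := Nat.geomSum_lt (m := 2) (n := k) (s := X.map Fin.valEmbedding) le_rfl (by simp)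
  simpa [setCode] using this

theorem setCode_bit (X : Finset (Fin k)) (u : Fin k) :
    setCode X / 2 ^ (u : ℕ) % 2 = if u ∈ X then 1 else 0 := by
  have h1 : setCode X = ∑ j ∈ X with j < u, 2 ^ (j : ℕ) + ∑ j ∈ X with ¬ j < u, 2 ^ (j : ℕ) :=
    (Finset.sum_filter_add_sum_filter_not X _ _).symm
  have h2 : ∑ j ∈ X with j < u, 2 ^ (j : ℕ) < 2 ^ (u : ℕ) := by
    have := Nat.geomSum_lt (m := 2) (n := u) (s := (X.filter (· < u)).map Fin.valEmbedding)
      le_rfl (by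
        simp only [Finset.mem_map, Finset.mem_filter, forall_exists_index, and_imp]
        rintro _ x _ hx rfl
        exact hx)
    simpa using this
  have h3 : ∃ q, ∑ j ∈ X with ¬ j < u, 2 ^ (j : ℕ)
      = 2 ^ (u : ℕ) * ((if u ∈ X then 1 else 0) + 2 * q) := by
    have h4 : 2 ^ (u + 1 : ℕ) ∣ ∑ j ∈ (X.filter (¬ · < u)).erase u, 2 ^ (j : ℕ) := by
      refine Finset.dvd_sum fun j hj => pow_dvd_pow 2 ?_
      simp only [Finset.mem_erase, Finset.mem_filter, not_lt, Fin.le_def, ne_eq, Fin.ext_iff] at hj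
      omega
    obtain ⟨q, hq⟩ := h4
    refine ⟨q, ?_⟩
    by_cases hu : u ∈ X
    · rw [← Finset.add_sum_erase _ _ (Finset.mem_filter.2 ⟨hu, lt_irrefl u⟩), hq, if_pos hu]
      ring
    · rw [Finset.erase_eq_of_notMem (by simp [hu])] at hq
      rw [hq, if_neg hu]
      ring
  obtain ⟨q, hq⟩ := h3
  rw [h1, hq, Nat.add_mul_div_left _ _ (by positivity), Nat.div_eq_of_lt h2, zero_add,
    Nat.add_mul_mod_self_left]
  split <;> rfl

theorem setCode_injective : Function.Injective (setCode : Finset (Fin k) → ℕ) := by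
  intro X Y h
  ext u
  have h1 := setCode_bit X u
  rw [h, setCode_bit Y u] at h1
  split at h1 <;> split at h1 <;> simp_all

theorem exists_setCode_eq {a : ℕ} (h : a < 2 ^ k) : ∃ X : Finset (Fin k), setCode X = a := by
  let f : Finset (Fin k) → Fin (2 ^ k) := fun X => ⟨setCode X, setCode_lt X⟩
  have hf : Function.Injective f := fun X Y e => setCode_injective (Fin.mk.inj e)
  have hb := (Fintype.bijective_iff_injective_and_card f).2 ⟨hf, by simp⟩
  obtain ⟨X, hX⟩ := hb.2 ⟨a, h⟩
  exact ⟨X, Fin.mk.inj hX⟩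

theorem setCode_univ : setCode (Finset.univ : Finset (Fin k)) = 2 ^ k - 1 := by
  have h := setCode_lt (Finset.univ : Finset (Fin k))
  obtain ⟨X, hX⟩ := exists_setCode_eq (k := k) (a := 2 ^ k - 1) (by omega)
  have : setCode X ≤ setCode Finset.univ := Finset.sum_le_sum_of_subset (Finset.subset_univ X)
  omega

theorem setCode_sdiff_lt {S A : Finset (Fin k)} (h : A ⊆ S) (hA : A.Nonempty) :
    setCode (S \ A) < setCode S := by
  have h1 : setCode A ≤ setCode S := Finset.sum_le_sum_of_subset h
  have h2 : 0 < setCode A := Finset.sum_pos (fun _ _ => by positivity) hA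
  rw [setCode_sdiff h]
  omega

theorem setCode_eq_zero {X : Finset (Fin k)} : setCode X = 0 ↔ X = ∅ :=
  ⟨fun h => setCode_injective (h.trans setCode_empty.symm), fun h => h ▸ setCode_empty⟩

end SetCode

namespace ColouredMullerGame

variable {V C : Type} [Fintype V] [DecidableEq V] [Fintype C] [DecidableEq C]
  (G : ColouredMullerGame V C)

/-- `l` is built up from positions in `T` by adding positions from which Player `p` can force a
move to an earlier one. -/
inductive Derived (p : Bool) (S T : Finset V) : List V → Prop
  | init {l} (h : ∀ u ∈ l, u ∈ T) : Derived p S T l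
  | snoc {l u} (h : Derived p S T l) (h0 : l ≠ []) (h1 : G.owner u = p → ∃ w ∈ l, (u, w) ∈ G.E)
      (h2 : G.owner u ≠ p → ∀ w ∈ S, (u, w) ∈ G.E → w ∈ l) : Derived p S T (l ++ [u])

variable {G}

theorem Derived.rank {p : Bool} {S T : Finset V} {l : List V} (h : G.Derived p S T l)
    (hl : l.Nodup) (u : V) (hu : u ∈ l) (huT : u ∉ T) :
    (G.owner u = p → ∃ w ∈ l, (u, w) ∈ G.E ∧ l.idxOf w < l.idxOf u) ∧
    (G.owner u ≠ p → ∀ w ∈ S, (u, w) ∈ G.E → w ∈ l ∧ l.idxOf w < l.idxOf u) := by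
  induction h with
  | init h => exact (huT (h u hu)).elim
  | @snoc l a _ _ h1 h2 ih =>
    rw [List.nodup_append] at hl
    have ha : a ∉ l := fun h => hl.2.2 a h a (by simp) rfl
    have hi : ∀ w ∈ l, (l ++ [a]).idxOf w = l.idxOf w := fun w hw => List.idxOf_append_of_mem hw
    rcases List.mem_append.1 hu with hu' | hu'
    · obtain ⟨g1, g2⟩ := ih hl.1 hu'
      refine ⟨fun ho => ?_, fun ho w hw hE => ?_⟩
      · obtain ⟨w, hw, hE, hlt⟩ := g1 ho
        exact ⟨w, List.mem_append_left _ hw, hE, by rwa [hi w hw, hi u hu']⟩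
      · obtain ⟨hw, hlt⟩ := g2 ho w hw hE
        exact ⟨List.mem_append_left _ hw, by rwa [hi w hw, hi u hu']⟩
    · obtain rfl : u = a := by simpa using hu'
      have hlast : ∀ w ∈ l, (l ++ [u]).idxOf w < (l ++ [u]).idxOf u := fun w hw => by
        rw [hi w hw, List.idxOf_append_of_notMem ha]
        exact (List.idxOf_lt_length_of_mem hw).trans_le (Nat.le_add_right _ _)
      refine ⟨fun ho => ?_, fun ho w hw hE => ?_⟩
      · obtain ⟨w, hw, hE⟩ := h1 ho
        exact ⟨w, List.mem_append_left _ hw, hE, hlast w hw⟩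
      · have := h2 ho w hw hE
        exact ⟨List.mem_append_left _ this, hlast w this⟩

theorem Derived.eq_nil {p : Bool} {S : Finset V} {l : List V} (h : G.Derived p S ∅ l) :
    l = [] := by
  induction h with
  | init h => exact List.eq_nil_iff_forall_not_mem.2 fun u hu => Finset.notMem_empty _ (h u hu)
  | snoc _ h0 _ _ ih => exact (h0 ih).elim

variable (G) in
/-- The state of the attractor computation: the positions `l` found so far, the edges `R`
processed so far, and the numbers `cnt u` of edges in `S` from `u` not yet processed. -/
structure AttrState (p : Bool) (S T : Finset V) (l : List V) (R : Finset (V × V)) (cnt : V → ℕ) :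
    Prop where
  nodup : l.Nodup
  subset : ∀ u ∈ l, u ∈ S
  target : ∀ u ∈ S, u ∈ T → u ∈ l
  derived : G.Derived p S T l
  mem : ∀ x ∈ R, x.2 ∈ l
  cnt_eq : ∀ u ∈ S, u ∉ l → cnt u = (G.E.filter fun x => x.1 = u ∧ x.2 ∈ S ∧ x ∉ R).card
  own : ∀ u ∈ S, u ∉ l → G.owner u = p → ∀ x ∈ R, x.1 ≠ u
  opp : ∀ u ∈ S, u ∉ l → G.owner u ≠ p → (∃ w ∈ S, (u, w) ∈ G.E) →
    ∃ w ∈ S, (u, w) ∈ G.E ∧ (u, w) ∉ R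

namespace AttrState

variable {p : Bool} {S T : Finset V} {l : List V} {R : Finset (V × V)} {cnt : V → ℕ} {u v : V}

theorem isAttractor (h : G.AttrState p S T l R cnt) (hR : ∀ x ∈ G.E, x.2 ∈ l → x ∈ R) :
    G.IsAttractor p S T l.toFinset where
  target u hu huT := List.mem_toFinset.2 (h.target u hu huT)
  subset u hu := h.subset u (List.mem_toFinset.1 hu)
  eq_empty hT := by
    subst hT
    rw [h.derived.eq_nil, List.toFinset_nil]
  closed_own u hu hul ho w hw hE := by
    rw [List.mem_toFinset] at hul hw
    exact h.own u hu hul ho _ (hR _ hE hw) rfl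
  closed_opp u hu hul ho hex := by
    rw [List.mem_toFinset] at hul
    obtain ⟨w, hw, hE, hwR⟩ := h.opp u hu hul ho hex
    exact ⟨w, hw, fun hwl => hwR (hR _ hE (List.mem_toFinset.1 hwl)), hE⟩
  rank := by
    refine ⟨l.idxOf, fun u hu huT => ?_⟩
    simpa only [List.mem_toFinset] using h.derived.rank h.nodup u (List.mem_toFinset.1 hu) huT

theorem skip (h : G.AttrState p S T l R cnt) (hv : v ∈ l) (hu : u ∈ S → u ∈ l) :
    G.AttrState p S T l (insert (u, v) R) cnt where
  nodup := h.nodup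
  subset := h.subset
  target := h.target
  derived := h.derived
  mem := by
    simp only [Finset.mem_insert, forall_eq_or_imp]
    exact ⟨hv, h.mem⟩
  cnt_eq w hw hwl := by
    rw [h.cnt_eq w hw hwl]
    congr 1
    refine Finset.filter_congr fun x _ => ?_
    simp only [Finset.mem_insert, not_or]
    refine and_congr_right fun hx => and_congr_right fun _ => ?_
    rw [iff_and_self]
    rintro _ rfl
    obtain rfl : u = w := hx
    exact hwl (hu hw)
  own w hw hwl ho := by
    simp only [Finset.mem_insert, forall_eq_or_imp]
    exact ⟨fun e => hwl (e ▸ hu (e ▸ hw)), h.own w hw hwl ho⟩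
  opp w hw hwl ho hex := by
    obtain ⟨z, hz, hE, hR⟩ := h.opp w hw hwl ho hex
    refine ⟨z, hz, hE, ?_⟩
    simp only [Finset.mem_insert, Prod.mk.injEq, not_or]
    exact ⟨fun e => hwl (e.1 ▸ hu (e.1 ▸ hw)), hR⟩

theorem cnt_insert (h : G.AttrState p S T l R cnt) (hv : v ∈ l) (hu : u ∈ S) (hul : u ∉ l)
    (hE : (u, v) ∈ G.E) (hR : (u, v) ∉ R) :
    cnt u - 1 = (G.E.filter fun x => x.1 = u ∧ x.2 ∈ S ∧ x ∉ insert (u, v) R).card := by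
  have : (G.E.filter fun x => x.1 = u ∧ x.2 ∈ S ∧ x ∉ insert (u, v) R)
      = (G.E.filter fun x => x.1 = u ∧ x.2 ∈ S ∧ x ∉ R).erase (u, v) := by
    ext x
    simp only [Finset.mem_filter, Finset.mem_insert, Finset.mem_erase, not_or]
    tauto
  rw [this, h.cnt_eq u hu hul, Finset.card_erase_of_mem]
  simp [hE, hR, h.subset v hv]

theorem decrement (h : G.AttrState p S T l R cnt) (hv : v ∈ l) (hu : u ∈ S) (hul : u ∉ l)
    (hE : (u, v) ∈ G.E) (hR : (u, v) ∉ R) (ho : G.owner u ≠ p) (hc : cnt u - 1 ≠ 0) :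
    G.AttrState p S T l (insert (u, v) R) (Function.update cnt u (cnt u - 1)) where
  nodup := h.nodup
  subset := h.subset
  target := h.target
  derived := h.derived
  mem := by
    simp only [Finset.mem_insert, forall_eq_or_imp]
    exact ⟨hv, h.mem⟩
  cnt_eq w hw hwl := by
    by_cases hwu : w = u
    · subst hwu
      rw [Function.update_self]
      exact h.cnt_insert hv hu hul hE hR
    · rw [Function.update_of_ne hwu, h.cnt_eq w hw hwl]
      congr 1
      refine Finset.filter_congr fun x _ => ?_
      simp only [Finset.mem_insert, not_or]
      refine and_congr_right fun hx => and_congr_right fun _ => ?_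
      rw [iff_and_self]
      rintro _ rfl
      exact hwu hx.symm
  own w hw hwl how := by
    simp only [Finset.mem_insert, forall_eq_or_imp]
    exact ⟨fun e => ho (by rw [show u = w from e]; exact how), h.own w hw hwl how⟩
  opp w hw hwl how hex := by
    by_cases hwu : w = u
    · subst hwu
      rw [h.cnt_insert hv hu hul hE hR] at hc
      obtain ⟨x, hx⟩ := Finset.card_pos.1 (Nat.pos_of_ne_zero hc)
      rw [Finset.mem_filter] at hx
      obtain ⟨hxE, rfl, hxS, hxR⟩ := hx
      exact ⟨x.2, hxS, hxE, hxR⟩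
    · obtain ⟨z, hz, hE', hR'⟩ := h.opp w hw hwl how hex
      refine ⟨z, hz, hE', ?_⟩
      simp [hwu, hR']

theorem add (h : G.AttrState p S T l R cnt) (hv : v ∈ l) (hu : u ∈ S) (hul : u ∉ l)
    (hE : (u, v) ∈ G.E) (hR : (u, v) ∉ R) (ho : G.owner u = p ∨ cnt u - 1 = 0) :
    G.AttrState p S T (l ++ [u]) (insert (u, v) R) (Function.update cnt u (cnt u - 1)) where
  nodup := by
    rw [List.nodup_append]
    exact ⟨h.nodup, by simp, fun a ha b hb e => hul (by simp_all)⟩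
  subset w hw := by
    rcases List.mem_append.1 hw with hw | hw
    · exact h.subset w hw
    · rw [List.mem_singleton.1 hw]
      exact hu
  target w hw hwT := List.mem_append_left _ (h.target w hw hwT)
  derived := by
    refine .snoc h.derived (List.ne_nil_of_mem hv) (fun _ => ⟨v, hv, hE⟩) fun ho' w hw hwE => ?_
    have hc := ho.resolve_left ho'
    rw [h.cnt_insert hv hu hul hE hR, Finset.card_eq_zero] at hc
    by_contra hwl
    have : (u, w) ∈ G.E.filter fun x => x.1 = u ∧ x.2 ∈ S ∧ x ∉ insert (u, v) R := by
      rw [Finset.mem_filter]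
      refine ⟨hwE, rfl, hw, ?_⟩
      rw [Finset.mem_insert, not_or]
      exact ⟨fun e => hwl (by cases e; exact hv), fun e => hwl (h.mem _ e)⟩
    rw [hc] at this
    simp at this
  mem := by
    simp only [Finset.mem_insert, forall_eq_or_imp]
    exact ⟨List.mem_append_left _ hv, fun x hx => List.mem_append_left _ (h.mem x hx)⟩
  cnt_eq w hw hwl := by
    simp only [List.mem_append, List.mem_singleton, not_or] at hwl
    rw [Function.update_of_ne hwl.2, h.cnt_eq w hw hwl.1]
    congr 1
    refine Finset.filter_congr fun x _ => ?_
    simp only [Finset.mem_insert, not_or]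
    refine and_congr_right fun hx => and_congr_right fun _ => ?_
    rw [iff_and_self]
    rintro _ rfl
    exact hwl.2 hx.symm
  own w hw hwl how := by
    simp only [List.mem_append, List.mem_singleton, not_or] at hwl
    simp only [Finset.mem_insert, forall_eq_or_imp]
    exact ⟨fun e => hwl.2 e.symm, h.own w hw hwl.1 how⟩
  opp w hw hwl how hex := by
    simp only [List.mem_append, List.mem_singleton, not_or] at hwl
    obtain ⟨z, hz, hE', hR'⟩ := h.opp w hw hwl.1 how hex
    refine ⟨z, hz, hE', ?_⟩
    simp [hwl.2, hR']

theorem init (hl : l.Nodup) (hlST : ∀ u, u ∈ l ↔ u ∈ S ∧ u ∈ T)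
    (hcnt : ∀ u ∈ S, cnt u = (G.E.filter fun x => x.1 = u ∧ x.2 ∈ S).card) :
    G.AttrState p S T l ∅ cnt where
  nodup := hl
  subset u hu := ((hlST u).1 hu).1
  target u hu huT := (hlST u).2 ⟨hu, huT⟩
  derived := .init fun u hu => ((hlST u).1 hu).2
  mem := by simp
  cnt_eq u hu _ := by simp [hcnt u hu]
  own := by simp
  opp u _ _ _ := by simp

end AttrState

end ColouredMullerGame

namespace Imp

open Imp.Expr Imp.Prog

/-! ### The attractor program -/

/-- The bit of position `u` in the set coded by `s`. -/
def Expr.bit (s u : Expr) : Expr := (s / get .pow u) % 2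

/-- Adds position `u` to the queue and to the attractor. -/
def pushProg (u : Id) : Prog :=
  .seq (.put .A 0 (var .A + get .pow (var u))) <|
  .seq (.put .q (var .tl) (var u)) (.put .tl 0 (var .tl + 1))

def attrTarget : Prog :=
  .seq (.put .cnt (var .v) 0) <|
  .ite .eq (bit (var .S) (var .v) * bit (var .T) (var .v)) 1 (pushProg .v) .skip

def attrCount : Prog :=
  .put .cnt (get .src (var .e)) (get .cnt (get .src (var .e)) +
    bit (var .S) (get .src (var .e)) * bit (var .S) (get .tgt (var .e)))

def attrEdge : Prog :=
  .seq (.put .u 0 (get .pr (var .v * var .m + var .i))) <|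
  .ite .eq (bit (var .S - var .A) (var .u)) 1
    (.seq (.put .cnt (var .u) (get .cnt (var .u) - 1)) <|
      .ite .eq ((get .own (var .u) + var .P) % 2 * get .cnt (var .u)) 0 (pushProg .u) .skip)
    .skip

def attrVertex : Prog :=
  .seq (.put .v 0 (get .q (var .hd))) <|
  .seq (.put .hd 0 (var .hd + 1)) <|
  .seq (.put .d 0 (get .deg (var .v))) <|
  .forLoop .i .d attrEdge

/-- `A := ` the attractor of player `P` to `T` in the subgame on `S`. -/
def attr : Prog :=
  .seq (.put .A 0 0) <|
  .seq (.put .tl 0 0) <|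
  .seq (.forLoop .v .n attrTarget) <|
  .seq (.forLoop .e .m attrCount) <|
  .seq (.put .hd 0 0) <|
  .whl .lt (var .hd) (var .tl) attrVertex

variable {n k : ℕ}

/-- The sources of the edges into `v`. -/
def preds (es : List (Fin n × Fin n)) (v : Fin n) : List (Fin n) :=
  (es.filter (·.2 = v)).map (·.1)

theorem mem_preds {es : List (Fin n × Fin n)} {u v : Fin n} : u ∈ preds es v ↔ (u, v) ∈ es := by
  simp [preds]

theorem nodup_preds {es : List (Fin n × Fin n)} (h : es.Nodup) (v : Fin n) :
    (preds es v).Nodup := by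
  refine (List.nodup_map_iff_inj_on (h.filter _)).2 ?_
  intro x hx y hy e
  simp only [List.mem_filter, decide_eq_true_eq] at hx hy
  exact Prod.ext e (hx.2.trans hy.2.symm)

theorem length_preds_le (es : List (Fin n × Fin n)) (v : Fin n) :
    (preds es v).length ≤ es.length := by
  rw [preds, List.length_map]
  exact List.length_filter_le _ _

theorem sum_length_preds (es : List (Fin n × Fin n)) : ∑ v, (preds es v).length = es.length := by
  induction es with
  | nil => simp [preds]
  | cons x es ih =>
    have : ∀ v, (preds (x :: es) v).length = (if x.2 = v then 1 else 0) + (preds es v).length := by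
      intro v
      by_cases h : x.2 = v <;> simp [preds, h, add_comm]
    simp [this, Finset.sum_add_distrib, ih, add_comm]

variable {G : ColouredMullerGame (Fin n) (Fin k)} {es : List (Fin n × Fin n)} {L : Limits}
  {σ σ' : Store}

/-- The limits suffice for a game with `n` positions and `m` edges. -/
structure Fits (L : Limits) (n m : ℕ) : Prop where
  lim : ∀ a ≠ Id.inp, L.lim a = L.b
  pow_le : 4 * 2 ^ n ≤ L.b
  mul_lt : n * m + m < L.b
  le_m : n ≤ m

theorem Fits.n_lt {n m : ℕ} (h : Fits L n m) : n < L.b := by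
  have := h.pow_le
  have : n < 2 ^ n := Nat.lt_two_pow_self
  omega

theorem Fits.m_lt {n m : ℕ} (h : Fits L n m) : m < L.b := by
  have := h.mul_lt
  omega

/-- The variables and arrays describing the game. -/
def envIds : List Id :=
  [.n, .k, .m, .N, .pow, .own, .col, .colm, .src, .tgt, .deg, .pr, .tf]

structure Env (G : ColouredMullerGame (Fin n) (Fin k)) (es : List (Fin n × Fin n)) (σ : Store) :
    Prop where
  n_eq : σ .n 0 = n
  k_eq : σ .k 0 = k
  m_eq : σ .m 0 = es.length
  N_eq : σ .N 0 = 2 ^ n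
  pow : ∀ i ≤ n, σ .pow i = 2 ^ i
  own : ∀ v : Fin n, σ .own v = (G.owner v).toNat
  col : ∀ v : Fin n, σ .col v = (G.c v : ℕ)
  colm : ∀ j : Fin k, σ .colm j = setCode (Finset.univ.filter (G.c · = j))
  src : ∀ e (h : e < es.length), σ .src e = (es[e].1 : ℕ)
  tgt : ∀ e (h : e < es.length), σ .tgt e = (es[e].2 : ℕ)
  deg : ∀ v : Fin n, σ .deg v = (preds es v).length
  pr : ∀ (v : Fin n) i (h : i < (preds es v).length),
    σ .pr (v * es.length + i) = ((preds es v)[i] : ℕ)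
  nodup : es.Nodup
  toFinset_eq : es.toFinset = G.E
  tf : ∀ X, σ .tf (setCode X) = if X ∈ G.F true then 1 else 0

theorem Env.congr (h : Env G es σ) (hσ : ∀ a ∈ envIds, σ' a = σ a) : Env G es σ' := by
  simp only [envIds, List.forall_mem_cons] at hσ
  obtain ⟨h1, h2, h3, h4, h5, h6, h7, h8, h9, h10, h11, h12, h13, -⟩ := hσ
  constructor
  · rw [h1]; exact h.n_eq
  · rw [h2]; exact h.k_eq
  · rw [h3]; exact h.m_eq
  · rw [h4]; exact h.N_eq
  · rw [h5]; exact h.pow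
  · rw [h6]; exact h.own
  · rw [h7]; exact h.col
  · rw [h8]; exact h.colm
  · rw [h9]; exact h.src
  · rw [h10]; exact h.tgt
  · rw [h11]; exact h.deg
  · rw [h12]; exact h.pr
  · exact h.nodup
  · exact h.toFinset_eq
  · rw [h13]; exact h.tf

theorem Env.agree (h : Env G es σ) {l : List Id} (hσ : Agree l σ σ')
    (hl : ∀ a ∈ envIds, a ∉ l) : Env G es σ' :=
  h.congr fun a ha => hσ a (hl a ha)

theorem Env.put (h : Env G es σ) {a : Id} (ha : a ∉ envIds) (i b : ℕ) : Env G es (σ.put a i b) :=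
  h.congr fun _ ha' => σ.put_of_ne i b fun e => ha (e ▸ ha')

theorem Env.pow_fin (h : Env G es σ) (v : Fin n) : σ .pow v = 2 ^ (v : ℕ) := h.pow v v.2.le

/-- `q[0], …, q[tl-1]` is the list `l`, and `A` is the code of its set. -/
structure Queue (l : List (Fin n)) (σ : Store) : Prop where
  code : σ .A 0 = setCode l.toFinset
  len : σ .tl 0 = l.length
  get : ∀ i (h : i < l.length), σ .q i = (l[i] : ℕ)

theorem Queue.congr {l : List (Fin n)} (h : Queue l σ) (hA : σ' .A = σ .A) (ht : σ' .tl = σ .tl)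
    (hq : σ' .q = σ .q) : Queue l σ' := by
  refine ⟨?_, ?_, ?_⟩
  · rw [hA]; exact h.code
  · rw [ht]; exact h.len
  · rw [hq]; exact h.get

theorem length_le_of_nodup {l : List (Fin n)} (hl : l.Nodup) : l.length ≤ n := by
  simpa using hl.length_le_card

theorem push_spec (hL : Fits L n es.length) (hE : Env G es σ) {l : List (Fin n)} (hl : l.Nodup)
    (hq : Queue l σ) {u : Fin n} (hul : u ∉ l) {x : Id} (hx : x ∉ (pushProg x).mods)
    (hx0 : x ≠ .inp) (hxu : σ x 0 = u) :
    Wp L (pushProg x) σ (fun σ' t => Queue (l ++ [u]) σ' ∧ t = 3) := by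
  have hn := hL.n_lt
  have hlen := length_le_of_nodup hl
  have hpow := hL.pow_le
  have hu := u.2
  have hn2 : n < 2 ^ n := Nat.lt_two_pow_self
  simp only [pushProg, mods, List.mem_append, List.mem_cons, List.not_mem_nil, or_false,
    not_or] at hx
  obtain ⟨hxA, hxq, hxt⟩ := hx
  have hset : (l ++ [u]).toFinset = insert u l.toFinset := by
    ext y
    simp
  have hcode : setCode (l ++ [u]).toFinset = setCode l.toFinset + 2 ^ (u : ℕ) := by
    rw [hset, setCode_insert (by simpa using hul)]
  have hlt := setCode_lt (l ++ [u]).toFinset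
  refine .put_seq ?_ ?_ ?_ ?_ (.put_seq ?_ ?_ ?_ ?_ (.put ?_ ?_ ?_ ?_ ⟨⟨?_, ?_, ?_⟩, rfl⟩))
  all_goals simp [hL.lim, hxu, hxA, hx0, hq.code, hq.len, hE.pow_fin]
  any_goals first | omega | exact (setCode_insert (by simpa using hul)).symm
  intro i hi
  by_cases h : i = l.length
  · subst h
    simp
  · have hi' : i < l.length := by omega
    simp [h, hi', hq.get i hi']

theorem bit_eval_of_le {s u : Expr} {K : ℕ} {X : Finset (Fin K)} {v : Fin K} (hE : Env G es σ)
    (hK : K ≤ n) (hs : s.eval σ = setCode X) (hu : u.eval σ = v) :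
    (bit s u).eval σ = if v ∈ X then 1 else 0 := by
  simp [bit, hs, hu, hE.pow v (v.2.le.trans hK), setCode_bit]

theorem bit_eval {s u : Expr} {X : Finset (Fin n)} {v : Fin n} (hE : Env G es σ)
    (hs : s.eval σ = setCode X) (hu : u.eval σ = v) :
    (bit s u).eval σ = if v ∈ X then 1 else 0 :=
  bit_eval_of_le hE le_rfl hs hu

theorem bit_inRange {s u : Expr} {lim : Id → ℕ} (hs : s.InRange lim σ) (hu : u.InRange lim σ)
    (hu' : u.eval σ < lim .pow) : (bit s u).InRange lim σ := by
  simp [bit, hs, hu, hu']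

variable {S T : Finset (Fin n)} {p : Bool}

theorem attrTarget_spec (hL : Fits L n es.length) (hE : Env G es σ) (hS : σ .S 0 = setCode S)
    (hT : σ .T 0 = setCode T) (hA : σ .A 0 = 0) (ht : σ .tl 0 = 0) :
    Wp L (.forLoop .v .n attrTarget) σ (fun σ' t =>
      (∃ l : List (Fin n), Queue l σ' ∧ l.Nodup ∧ ∀ u, u ∈ l ↔ u ∈ S ∧ u ∈ T) ∧
      (∀ u : Fin n, σ' .cnt u = 0) ∧ t ≤ n * 7 + 2) := by
  have hn := hL.n_lt
  have hb := L.le_b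
  refine (Wp.forLoop 5 (fun i σ' =>
    (∃ l : List (Fin n), Queue l σ' ∧ l.Nodup ∧ ∀ u, u ∈ l ↔ (u : ℕ) < i ∧ u ∈ S ∧ u ∈ T) ∧
    (∀ u : Fin n, (u : ℕ) < i → σ' .cnt u = 0)) (by decide) (by decide) (by decide) hE.n_eq hn
    (by omega) (by simp [hL.lim]; omega) (by simp [hL.lim]; omega) ?_ ?_).mono ?_
  · refine ⟨⟨[], ⟨by simp [hA], by simp [ht], by simp⟩, by simp, by simp⟩, by simp⟩
  · rintro i hi σ1 hag hv ⟨⟨l, hq, hl, hmem⟩, hcnt⟩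
    have hE1 : Env G es σ1 := hE.agree hag (by decide)
    have hS1 : σ1 .S 0 = setCode S := by rw [hag .S (by decide), hS]
    have hT1 : σ1 .T 0 = setCode T := by rw [hag .T (by decide), hT]
    refine .put_seq (by simp [hL.lim]; omega) trivial (by simp [hL.lim, hv]; omega)
      (by simp; omega) ?_
    simp only [eval_get, eval_lit, eval_ofNat, hv]
    set σ2 := σ1.put .cnt i 0 with hσ2
    have hE2 : Env G es σ2 := hE1.put (by decide) _ _
    have hv2 : σ2 .v 0 = i := by simp [hσ2, hv]
    have hq2 : Queue l σ2 := hq.congr (σ1.put_of_ne _ _ (by decide)) (σ1.put_of_ne _ _ (by decide))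
      (σ1.put_of_ne _ _ (by decide))
    have hc2 : ∀ u : Fin n, (u : ℕ) < i + 1 → σ2 .cnt u = 0 := by
      intro u hu
      by_cases h : (u : ℕ) = i
      · simp [hσ2, h]
      · simp [hσ2, h, hcnt u (by omega)]
    have e1 := bit_eval (s := var .S) (u := var .v) (v := ⟨i, hi⟩) hE2
      (X := S) (by simp [hσ2, hS1]) (by simp [hv2])
    have e2 := bit_eval (s := var .T) (u := var .v) (v := ⟨i, hi⟩) hE2
      (X := T) (by simp [hσ2, hT1]) (by simp [hv2])
    have hpos : 0 < L.b := by omega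
    have hbr : ∀ a : Id, a ≠ .inp → (bit (var a) (var .v)).InRange L.lim σ2 := fun a ha =>
      bit_inRange (by simp [hL.lim, ha, hpos]) (by simp [hL.lim, hpos])
        (by simp [hL.lim, hv2]; omega)
    refine .ite (by simp [hbr]) trivial (fun hc => ?_) (fun hc => ?_)
    · simp only [eval_mul, e1, e2, eval_ofNat, RAM.Test.holds_eq, mul_eq_one, ite_eq_left_iff,
        zero_ne_one, imp_false, not_not] at hc
      have hul : (⟨i, hi⟩ : Fin n) ∉ l := fun h => by
        have := ((hmem _).1 h).1
        simp at this
      refine (push_spec hL hE2 hl hq2 hul (x := .v) (by decide) (by decide) hv2).frame.mono ?_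
      rintro σ3 t ⟨⟨hq3, rfl⟩, hag3⟩
      refine ⟨by omega, ⟨l ++ [⟨i, hi⟩], ?_, ?_, ?_⟩, ?_⟩
      · exact hq3.congr (σ3.put_of_ne _ _ (by decide)) (σ3.put_of_ne _ _ (by decide))
          (σ3.put_of_ne _ _ (by decide))
      · rw [List.nodup_append]
        exact ⟨hl, by simp, fun a ha b hb e => hul (by simp_all)⟩
      · intro u
        simp only [List.mem_append, hmem, List.mem_singleton, Fin.ext_iff]
        constructor
        · rintro (h | h)
          · exact ⟨by omega, h.2⟩
          · obtain rfl : u = ⟨i, hi⟩ := Fin.ext h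
            exact ⟨by simp, hc⟩
        · rintro ⟨h1, h2⟩
          by_cases h : (u : ℕ) = i
          · exact .inr h
          · exact .inl ⟨by omega, h2⟩
      · intro u hu
        rw [Store.put_of_ne _ _ _ (by decide), hag3 .cnt (by decide)]
        exact hc2 u hu
    · simp only [eval_mul, e1, e2, eval_ofNat, RAM.Test.holds_eq, mul_eq_one, ite_eq_left_iff,
        zero_ne_one, imp_false, not_not] at hc
      refine .skip ⟨by omega, ⟨l, ?_, hl, ?_⟩, ?_⟩
      · exact hq2.congr (σ2.put_of_ne _ _ (by decide)) (σ2.put_of_ne _ _ (by decide))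
          (σ2.put_of_ne _ _ (by decide))
      · intro u
        rw [hmem]
        refine ⟨fun h => ⟨by omega, h.2⟩, fun h => ⟨?_, h.2⟩⟩
        by_contra h'
        obtain rfl : u = ⟨i, hi⟩ := Fin.ext (by simp only; omega)
        exact hc h.2
      · intro u hu
        rw [Store.put_of_ne _ _ _ (by decide)]
        exact hc2 u hu
  · rintro σ1 t ⟨⟨⟨l, hq, hl, hmem⟩, hcnt⟩, -, -, ht⟩
    exact ⟨⟨l, hq, hl, fun u => by simp [hmem]⟩, fun u => hcnt u u.2, by omega⟩

theorem attrCount_spec (hL : Fits L n es.length) (hE : Env G es σ) (hS : σ .S 0 = setCode S)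
    (hcnt : ∀ u : Fin n, σ .cnt u = 0) :
    Wp L (.forLoop .e .m attrCount) σ (fun σ' t =>
      (∀ u ∈ S, σ' .cnt u = es.countP (fun x => x.1 = u ∧ x.2 ∈ S)) ∧
      t ≤ es.length * 3 + 2) := by
  have hn := hL.n_lt
  have hm := hL.m_lt
  have hb := L.le_b
  have hpos : 0 < L.b := by omega
  refine (Wp.forLoop 1 (fun i σ' => ∀ u : Fin n, σ' .cnt u
    = (es.take i).countP (fun x => x.1 = u ∧ x.1 ∈ S ∧ x.2 ∈ S)) (by decide) (by decide)
    (by decide) hE.m_eq hm hpos (by simp [hL.lim, hpos]) (by simp [hL.lim, hpos]) ?_ ?_).mono ?_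
  · simp [hcnt]
  · intro i hi σ1 hag hv hJ
    have hE1 : Env G es σ1 := hE.agree hag (by decide)
    have hS1 : σ1 .S 0 = setCode S := by rw [hag .S (by decide), hS]
    have hs : (get .src (var .e)).eval σ1 = (es[i].1 : ℕ) := by simp [hv, hE1.src i hi]
    have ht : (get .tgt (var .e)).eval σ1 = (es[i].2 : ℕ) := by simp [hv, hE1.tgt i hi]
    have e1 := bit_eval (s := var .S) hE1 (X := S) (by simp [hS1]) hs
    have e2 := bit_eval (s := var .S) hE1 (X := S) (by simp [hS1]) ht
    have h1 := (es[i].1).2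
    have h2 := (es[i].2).2
    have hrs : (get .src (var .e)).InRange L.lim σ1 := by simp [hL.lim, hpos, hv]; omega
    have hrt : (get .tgt (var .e)).InRange L.lim σ1 := by simp [hL.lim, hpos, hv]; omega
    have hr : (var .S).InRange L.lim σ1 := by simp [hL.lim, hpos]
    have r1 := bit_inRange hr hrs (by rw [hs, hL.lim _ (by decide)]; omega)
    have r2 := bit_inRange hr hrt (by rw [ht, hL.lim _ (by decide)]; omega)
    have hval : (get .cnt (get .src (var .e)) + bit (var .S) (get .src (var .e)) *
        bit (var .S) (get .tgt (var .e))).eval σ1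
        = (es.take (i + 1)).countP (fun x => x.1 = es[i].1 ∧ x.1 ∈ S ∧ x.2 ∈ S) := by
      rw [List.take_succ_eq_append_getElem hi, List.countP_append, ← hJ es[i].1]
      rw [eval_add, eval_mul, e1, e2, eval_get, hs]
      by_cases h3 : es[i].1 ∈ S <;> by_cases h4 : es[i].2 ∈ S <;> simp [h3, h4]
    refine .put hrs ?_ (by rw [hs, hL.lim _ (by decide)]; omega) ?_ ⟨le_rfl, ?_⟩
    · rw [inRange_add, inRange_mul, inRange_get]
      exact ⟨⟨hrs, by rw [hs, hL.lim _ (by decide)]; omega⟩, r1, r2⟩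
    · rw [hval]
      have := List.countP_le_length (l := es.take (i + 1))
        (p := fun x => x.1 = es[i].1 ∧ x.1 ∈ S ∧ x.2 ∈ S)
      have := List.length_take_le' (i + 1) es
      omega
    · intro u
      rw [Store.put_of_ne _ _ _ (by decide), hs, hval, Store.put_apply]
      by_cases h : u = es[i].1
      · simp [h]
      · have h' : (u : ℕ) ≠ es[i].1 := fun e => h (Fin.ext e)
        rw [if_neg (by simp [h']), hJ, List.take_succ_eq_append_getElem hi, List.countP_append]
        simp [Ne.symm h]
  · rintro σ1 t ⟨hJ, -, -, ht⟩
    refine ⟨fun u hu => ?_, by omega⟩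
    rw [hJ, List.take_length]
    refine List.countP_congr fun x _ => ?_
    simp only [decide_eq_true_eq]
    refine and_congr_right fun e => ?_
    rw [e]
    simp [hu]

end Imp

namespace Imp

open Imp.Expr Imp.Prog

variable {n k : ℕ} {G : ColouredMullerGame (Fin n) (Fin k)} {es : List (Fin n × Fin n)}
  {L : Limits} {σ σ' : Store} {S T : Finset (Fin n)} {p : Bool}

theorem Env.mem_E (h : Env G es σ) {x : Fin n × Fin n} : x ∈ G.E ↔ x ∈ es := by
  rw [← h.toFinset_eq, List.mem_toFinset]

theorem Env.card_E (h : Env G es σ) : G.E.card = es.length := by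
  rw [← h.toFinset_eq, List.toFinset_card_of_nodup h.nodup]

theorem add_toNat_mod_two (a b : Bool) : (a.toNat + b.toNat) % 2 = 0 ↔ a = b := by
  cases a <;> cases b <;> decide

theorem attrEdge_spec (hL : Fits L n es.length) (hE : Env G es σ) (hS : σ .S 0 = setCode S)
    (hP : σ .P 0 = p.toNat) {l : List (Fin n)} {R : Finset (Fin n × Fin n)} {u v : Fin n} {i : ℕ}
    (hv : v ∈ l) (hi : i < (preds es v).length) (hui : (preds es v)[i] = u) (hR : (u, v) ∉ R)
    (hq : Queue l σ) (hst : G.AttrState p S T l R (fun u => σ .cnt u)) (hσv : σ .v 0 = v)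
    (hσi : σ .i 0 = i) :
    Wp L attrEdge σ (fun σ' t => t ≤ 7 ∧ ∃ l', l <+: l' ∧ Queue l' σ' ∧
      G.AttrState p S T l' (insert (u, v) R) (fun u => σ' .cnt u)) := by
  have hb := L.le_b
  have hpos : 0 < L.b := by omega
  have hn := hL.n_lt
  have hu := u.2
  have hidx : v * es.length + i < L.b := by
    have h1 : (v + 1 : ℕ) * es.length ≤ n * es.length := Nat.mul_le_mul_right _ v.2
    have h2 := length_preds_le es v
    have h3 := hL.mul_lt
    rw [Nat.add_mul] at h1
    omega
  have hlS : l.toFinset ⊆ S := fun x hx => hst.subset x (List.mem_toFinset.1 hx)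
  have hpr : σ .pr (v * es.length + i) = u := by rw [hE.pr v i hi, hui]
  have hEuv : (u, v) ∈ G.E := by
    rw [hE.mem_E, ← mem_preds, ← hui]
    exact List.getElem_mem hi
  refine .put_seq trivial (by simp [hL.lim, hpos, hσv, hσi, hE.m_eq, hidx])
    (by simp [hL.lim, hpos]) (by simp [hσv, hσi, hE.m_eq, hpr]; omega) ?_
  simp only [eval_get, eval_lit, eval_ofNat, eval_add, eval_mul, hσv, hσi, hE.m_eq, hpr]
  set σ1 := σ.put .u 0 u with hσ1
  have hE1 : Env G es σ1 := hE.put (by decide) _ _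
  have hu1 : σ1 .u 0 = u := by simp [hσ1]
  have hq1 : Queue l σ1 := hq.congr (σ.put_of_ne _ _ (by decide)) (σ.put_of_ne _ _ (by decide))
    (σ.put_of_ne _ _ (by decide))
  have hc1 : (fun u : Fin n => σ1 .cnt u) = fun u : Fin n => σ .cnt u := by
    rw [hσ1, σ.put_of_ne _ _ (by decide)]
  have hst1 := hst
  rw [← hc1] at hst1
  have e1 := bit_eval (s := var .S - var .A) (u := var .u) (v := u) hE1 (X := S \ l.toFinset)
    (by simp [hσ1, hS, hq.code, setCode_sdiff hlS]) (by simp [hu1])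
  refine .ite (bit_inRange (by simp [hL.lim, hpos]) (by simp [hL.lim, hpos])
    (by simp [hL.lim, hu1]; omega)) trivial (fun hc => ?_) (fun hc => ?_)
  · rw [e1] at hc
    simp only [eval_ofNat, RAM.Test.holds_eq, ite_eq_left_iff, zero_ne_one, imp_false, not_not,
      Finset.mem_sdiff, List.mem_toFinset] at hc
    obtain ⟨huS, hul⟩ := hc
    have hcb : σ .cnt u < L.b := by
      have h1 := hst.cnt_eq u huS hul
      have h2 := Finset.card_filter_le G.E (fun x => x.1 = u ∧ x.2 ∈ S ∧ x ∉ R)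
      rw [hE.card_E] at h2
      have := hL.m_lt
      omega
    have hcu : σ1 .cnt u = σ .cnt u := by simp [hσ1]
    refine .put_seq (by simp [hL.lim, hpos]) (by simp [hL.lim, hpos, hu1]; omega)
      (by simp [hL.lim, hu1]; omega) (by simp [hu1, hcu]; omega) ?_
    simp only [eval_get, eval_lit, eval_ofNat, eval_sub, hu1, hcu]
    set σ2 := σ1.put .cnt u (σ .cnt u - 1) with hσ2
    have hE2 : Env G es σ2 := hE1.put (by decide) _ _
    have hu2 : σ2 .u 0 = u := by simp [hσ2, hu1]
    have hq2 : Queue l σ2 := hq1.congr (σ1.put_of_ne _ _ (by decide))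
      (σ1.put_of_ne _ _ (by decide)) (σ1.put_of_ne _ _ (by decide))
    have hc2 : (fun u : Fin n => σ2 .cnt u)
        = Function.update (fun u : Fin n => σ .cnt u) u (σ .cnt u - 1) := by
      funext x
      by_cases hx : x = u
      · simp [hσ2, hx]
      · have : (x : ℕ) ≠ u := fun e => hx (Fin.ext e)
        simp [hσ2, this, hx, hσ1]
    have hP2 : σ2 .P 0 = p.toNat := by simp [hσ2, hσ1, hP]
    have hcu2 : σ2 .cnt u = σ .cnt u - 1 := by simp [hσ2]
    refine .ite (by simp [hL.lim, hpos, hu2]; omega) trivial (fun hc => ?_) (fun hc => ?_)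
    · simp only [eval_mul, eval_mod, eval_add, eval_get, eval_lit, eval_ofNat, hu2, hcu2, hP2,
        hE2.own, RAM.Test.holds_eq, mul_eq_zero, add_toNat_mod_two] at hc
      have hst2 := hst.add hv huS hul hEuv hR hc
      rw [← hc2] at hst2
      refine (push_spec hL hE2 hst.nodup hq2 hul (x := .u) (by decide) (by decide) hu2).frame.mono
        ?_
      rintro σ3 t ⟨⟨hq3, rfl⟩, hag⟩
      refine ⟨by omega, l ++ [u], List.prefix_append _ _, hq3, ?_⟩
      rw [hag .cnt (by decide)]
      exact hst2
    · simp only [eval_mul, eval_mod, eval_add, eval_get, eval_lit, eval_ofNat, hu2, hcu2, hP2,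
        hE2.own, RAM.Test.holds_eq, mul_eq_zero, add_toNat_mod_two, not_or] at hc
      have hst2 := hst.decrement hv huS hul hEuv hR hc.1 hc.2
      rw [← hc2] at hst2
      exact .skip ⟨by omega, l, List.prefix_refl _, hq2, hst2⟩
  · rw [e1] at hc
    simp only [eval_ofNat, RAM.Test.holds_eq, ite_eq_left_iff, zero_ne_one, imp_false, not_not,
      Finset.mem_sdiff, List.mem_toFinset] at hc
    refine .skip ⟨by omega, l, List.prefix_refl _, hq1, ?_⟩
    exact hst1.skip hv (by tauto)

/-- The edges processed when the first `h` positions of the queue `l` and the first `i`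
predecessors of `v` have been dealt with. -/
def processed (G : ColouredMullerGame (Fin n) (Fin k)) (es : List (Fin n × Fin n))
    (l : List (Fin n)) (v : Fin n) (i : ℕ) : Finset (Fin n × Fin n) :=
  G.E.filter fun x => x.2 ∈ l ∨ x.2 = v ∧ x.1 ∈ (preds es v).take i

theorem processed_zero (l : List (Fin n)) (v : Fin n) :
    processed G es l v 0 = G.E.filter fun x => x.2 ∈ l := by
  simp [processed]

theorem processed_succ (hE : Env G es σ) (l : List (Fin n)) (v : Fin n) (i : ℕ)
    (hi : i < (preds es v).length) :
    processed G es l v (i + 1) = insert ((preds es v)[i], v) (processed G es l v i) := by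
  have h1 : ((preds es v)[i], v) ∈ G.E := by
    rw [hE.mem_E, ← mem_preds]
    exact List.getElem_mem hi
  ext ⟨a, b⟩
  simp only [processed, List.take_succ_eq_append_getElem hi, List.mem_append, List.mem_singleton,
    Finset.mem_filter, Finset.mem_insert, Prod.mk.injEq]
  constructor
  · rintro ⟨h, h' | ⟨rfl, h' | h'⟩⟩
    · exact .inr ⟨h, .inl h'⟩
    · exact .inr ⟨h, .inr ⟨rfl, h'⟩⟩
    · exact .inl ⟨h', rfl⟩
  · rintro (⟨rfl, rfl⟩ | ⟨h, h' | h'⟩)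
    · exact ⟨h1, .inr ⟨rfl, .inr rfl⟩⟩
    · exact ⟨h, .inl h'⟩
    · exact ⟨h, .inr ⟨h'.1, .inl h'.2⟩⟩

theorem notMem_processed (hE : Env G es σ) {l : List (Fin n)} {v : Fin n} (hv : v ∉ l) (i : ℕ)
    (hi : i < (preds es v).length) : ((preds es v)[i], v) ∉ processed G es l v i := by
  have hnd := nodup_preds hE.nodup v
  simp only [processed, Finset.mem_filter, hv, false_or, true_and, not_and]
  intro _ h
  obtain ⟨j, hj, e⟩ := List.mem_iff_getElem.1 h
  rw [List.getElem_take] at e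
  have := hnd.getElem_inj_iff.1 e
  rw [List.length_take] at hj
  omega

theorem processed_length (hE : Env G es σ) (l : List (Fin n)) (v : Fin n) :
    processed G es l v (preds es v).length = G.E.filter fun x => x.2 ∈ l ++ [v] := by
  ext ⟨a, b⟩
  simp only [processed, List.take_length, Finset.mem_filter, List.mem_append, List.mem_singleton,
    mem_preds]
  refine and_congr_right fun h => or_congr_right ⟨fun h => h.1, ?_⟩
  rintro rfl
  exact ⟨rfl, hE.mem_E.1 h⟩

/-- The number of steps that the attractor program needs for the positions outside `l`. -/
def potential (es : List (Fin n × Fin n)) (l : List (Fin n)) : ℕ :=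
  ∑ v, if v ∈ l then 0 else (preds es v).length * 9 + 6

theorem potential_append (es : List (Fin n × Fin n)) {l : List (Fin n)} {v : Fin n} (hv : v ∉ l) :
    potential es (l ++ [v]) + ((preds es v).length * 9 + 6) = potential es l := by
  unfold potential
  rw [← Finset.add_sum_erase _ _ (Finset.mem_univ v), ← Finset.add_sum_erase _ _ (Finset.mem_univ v)]
  rw [if_pos (by simp), if_neg hv, zero_add, add_comm]
  congr 1
  refine Finset.sum_congr rfl fun w hw => ?_
  simp [Finset.ne_of_mem_erase hw]

theorem potential_le (es : List (Fin n × Fin n)) (l : List (Fin n)) :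
    potential es l ≤ es.length * 9 + n * 6 := by
  calc potential es l ≤ ∑ v, ((preds es v).length * 9 + 6) :=
        Finset.sum_le_sum fun v _ => by split <;> omega
    _ = es.length * 9 + n * 6 := by
        rw [Finset.sum_add_distrib, ← Finset.sum_mul, sum_length_preds]
        simp

theorem attrVertex_spec (hL : Fits L n es.length) (hE : Env G es σ) (hS : σ .S 0 = setCode S)
    (hP : σ .P 0 = p.toNat) {l : List (Fin n)} {h : ℕ} (hh : h < l.length) (hq : Queue l σ)
    (hst : G.AttrState p S T l (G.E.filter fun x => x.2 ∈ l.take h) (fun u => σ .cnt u))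
    (hσh : σ .hd 0 = h) :
    Wp L attrVertex σ (fun σ' t => t ≤ (preds es l[h]).length * 9 + 5 ∧ σ' .hd 0 = h + 1 ∧
      ∃ l', l <+: l' ∧ Queue l' σ' ∧ G.AttrState p S T l'
        (G.E.filter fun x => x.2 ∈ l'.take (h + 1)) (fun u => σ' .cnt u)) := by
  have hb := L.le_b
  have hpos : 0 < L.b := by omega
  have hn := hL.n_lt
  have hm := hL.m_lt
  have hlen := length_le_of_nodup hst.nodup
  have hget := hq.get h hh
  have hvl : l[h] ∈ l := List.getElem_mem hh
  have hvt : l[h] ∉ l.take h := fun h' => by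
    obtain ⟨j, hj, e⟩ := List.mem_iff_getElem.1 h'
    rw [List.getElem_take] at e
    have := hst.nodup.getElem_inj_iff.1 e
    rw [List.length_take] at hj
    omega
  have htake : l.take (h + 1) = l.take h ++ [l[h]] := List.take_succ_eq_append_getElem hh
  generalize l[h] = v at *
  have hv := v.2
  have hdeg := length_preds_le es v
  refine .put_seq trivial (by simp [hL.lim, hpos, hσh]; omega) (by simp [hL.lim, hpos])
    (by simp [hσh, hget]; omega) ?_
  simp only [eval_get, eval_lit, eval_ofNat, hσh, hget]
  refine .put_seq trivial (by simp [hL.lim, hpos]) (by simp [hL.lim, hpos])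
    (by simp [hσh]; omega) ?_
  refine .put_seq trivial (by simp [hL.lim, hpos]; omega) (by simp [hL.lim, hpos])
    (by simp [hE.deg]; omega) ?_
  simp only [eval_get, eval_lit, eval_ofNat, eval_add, Store.put_apply, reduceCtorEq, false_and,
    if_false, hσh, and_self, if_true, hE.deg]
  set σ1 := ((σ.put .v 0 v).put .hd 0 (h + 1)).put .d 0 (preds es v).length with hσ1
  have hag1 : Agree [.v, .hd, .d] σ σ1 := by
    intro a ha
    simp only [List.mem_cons, List.not_mem_nil, or_false, not_or] at ha
    rw [hσ1, Store.put_of_ne _ _ _ ha.2.2, Store.put_of_ne _ _ _ ha.2.1, Store.put_of_ne _ _ _ ha.1]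
  refine (Wp.forLoop 7 (fun i σ' => ∃ l', l <+: l' ∧ Queue l' σ' ∧ G.AttrState p S T l'
    (processed G es (l.take h) v i) (fun u => σ' .cnt u)) (N := (preds es v).length) (by decide)
    (by decide) (by decide) (by simp [hσ1]) (by omega) hpos (by simp [hL.lim, hpos])
    (by simp [hL.lim, hpos]) ?_ ?_).mono ?_
  · refine ⟨l, List.prefix_refl _, hq.congr ?_ ?_ ?_, ?_⟩
    · rw [Store.put_of_ne _ _ _ (by decide), hag1 _ (by decide)]
    · rw [Store.put_of_ne _ _ _ (by decide), hag1 _ (by decide)]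
    · rw [Store.put_of_ne _ _ _ (by decide), hag1 _ (by decide)]
    · rw [Store.put_of_ne _ _ _ (by decide), hag1 _ (by decide), processed_zero]
      exact hst
  · rintro i hi σ2 hag2 hi2 ⟨l', hl', hq2, hst2⟩
    have hE1 : Env G es σ1 := hE.agree hag1 (by decide)
    have hE2 : Env G es σ2 := hE1.agree hag2 (by decide)
    have := attrEdge_spec (T := T) (v := v) (i := i) (R := processed G es (l.take h) v i) hL hE2
      (by rw [hag2 _ (by decide), hag1 _ (by decide), hS])
      (by rw [hag2 _ (by decide), hag1 _ (by decide), hP]) (hl'.subset hvl) hi rfl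
      (notMem_processed hE hvt i hi) hq2 hst2 (by rw [hag2 _ (by decide)]; simp [hσ1]) hi2
    refine this.mono fun σ3 t => ?_
    rintro ⟨ht, l'', hl'', hq3, hst3⟩
    refine ⟨ht, l'', hl'.trans hl'', hq3.congr (σ3.put_of_ne _ _ (by decide))
      (σ3.put_of_ne _ _ (by decide)) (σ3.put_of_ne _ _ (by decide)), ?_⟩
    rw [σ3.put_of_ne _ _ (by decide), processed_succ hE _ _ _ hi]
    exact hst3
  · rintro σ2 t ⟨⟨l', hl', hq2, hst2⟩, hag2, -, ht⟩
    refine ⟨by omega, by rw [hag2 _ (by decide)]; simp [hσ1], l', hl', hq2, ?_⟩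
    rw [processed_length hE, ← htake] at hst2
    obtain ⟨r, rfl⟩ := hl'
    rw [List.take_append_of_le_length (by omega)]
    exact hst2

theorem attr_spec (hL : Fits L n es.length) (hE : Env G es σ) (hS : σ .S 0 = setCode S)
    (hT : σ .T 0 = setCode T) (hP : σ .P 0 = p.toNat) :
    Wp L attr σ (fun σ' t => (∃ A, σ' .A 0 = setCode A ∧ G.IsAttractor p S T A) ∧
      t ≤ 25 * es.length + 8) := by
  have hb := L.le_b
  have hpos : 0 < L.b := by omega
  have hnm := hL.le_m
  refine .put_seq trivial trivial (by simp [hL.lim, hpos]) hpos ?_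
  refine .put_seq trivial trivial (by simp [hL.lim, hpos]) hpos ?_
  simp only [eval_ofNat]
  set σ1 := (σ.put .A 0 0).put .tl 0 0 with hσ1
  have hag1 : Agree [.A, .tl] σ σ1 := by
    intro a ha
    simp only [List.mem_cons, List.not_mem_nil, or_false, not_or] at ha
    rw [hσ1, Store.put_of_ne _ _ _ ha.2, Store.put_of_ne _ _ _ ha.1]
  have hE1 : Env G es σ1 := hE.agree hag1 (by decide)
  have hS1 : σ1 .S 0 = setCode S := by rw [hag1 _ (by decide), hS]
  refine .seq ((attrTarget_spec hL hE1 hS1 (T := T) (by rw [hag1 _ (by decide), hT])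
    (by simp [hσ1]) (by simp [hσ1])).frame.mono ?_)
  rintro σ2 t2 ⟨⟨⟨l, hq2, hl, hlST⟩, hcnt2, ht2⟩, hag2⟩
  have hE2 : Env G es σ2 := hE1.agree hag2 (by decide)
  have hS2 : σ2 .S 0 = setCode S := by rw [hag2 _ (by decide), hS1]
  refine .seq ((attrCount_spec hL hE2 hS2 hcnt2).frame.mono ?_)
  rintro σ3 t3 ⟨⟨hcnt3, ht3⟩, hag3⟩
  have hE3 : Env G es σ3 := hE2.agree hag3 (by decide)
  refine .put_seq trivial trivial (by simp [hL.lim, hpos]) hpos ?_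
  simp only [eval_ofNat]
  set σ4 := σ3.put .hd 0 0 with hσ4
  have hE4 : Env G es σ4 := hE3.put (by decide) _ _
  have hS4 : σ4 .S 0 = setCode S := by
    rw [hσ4, σ3.put_of_ne _ _ (by decide), hag3 _ (by decide), hS2]
  have hP4 : σ4 .P 0 = p.toNat := by
    rw [hσ4, σ3.put_of_ne _ _ (by decide), hag3 _ (by decide), hag2 _ (by decide), hag1 _ (by decide),
      hP]
  have hpot := potential_le es []
  refine (Wp.whl (φ := potential es []) (fun φ σ' => Agree attrVertex.mods σ4 σ' ∧ ∃ l h,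
    h ≤ l.length ∧ σ' .hd 0 = h ∧ Queue l σ' ∧ G.AttrState p S T l
    (G.E.filter fun x => x.2 ∈ l.take h) (fun u => σ' .cnt u) ∧ φ = potential es (l.take h))
    ?_ ?_ ?_).mono ?_
  · refine ⟨fun _ _ => rfl, l, 0, by omega, by simp [hσ4], hq2.congr ?_ ?_ ?_, ?_, by simp⟩
    · rw [hσ4, σ3.put_of_ne _ _ (by decide), hag3 _ (by decide)]
    · rw [hσ4, σ3.put_of_ne _ _ (by decide), hag3 _ (by decide)]
    · rw [hσ4, σ3.put_of_ne _ _ (by decide), hag3 _ (by decide)]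
    · have : (G.E.filter fun x => x.2 ∈ l.take 0) = ∅ := by simp
      rw [this, hσ4, σ3.put_of_ne _ _ (by decide)]
      refine .init hl hlST fun u hu => ?_
      rw [hcnt3 u hu, ← hE.toFinset_eq, List.countP_eq_length_filter,
        ← List.toFinset_card_of_nodup (hE.nodup.filter _), List.toFinset_filter]
      simp
  · intro φ σ' _
    simp [hL.lim, hpos]
  · rintro φ σ5 ⟨hag5, l, h, hh, hhd, hq5, hst, rfl⟩ hlt
    simp only [eval_get, eval_lit, RAM.Test.holds_lt, hhd, hq5.len] at hlt
    have hE5 : Env G es σ5 := hE4.agree hag5 (by decide)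
    refine (attrVertex_spec (T := T) hL hE5 (by rw [hag5 _ (by decide), hS4])
      (by rw [hag5 _ (by decide), hP4]) hlt hq5 hst hhd).frame.mono ?_
    rintro σ6 t ⟨⟨ht, hhd6, l', hl', hq6, hst6⟩, hag6⟩
    have hlen := hl'.length_le
    refine ⟨_, ⟨fun a ha => by rw [hag6 a ha, hag5 a ha], l', h + 1, by omega, hhd6, hq6, hst6,
      rfl⟩, ?_⟩
    have hvt : l[h] ∉ l.take h := fun h' => by
      obtain ⟨j, hj, e⟩ := List.mem_iff_getElem.1 h'
      rw [List.getElem_take] at e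
      have := hst.nodup.getElem_inj_iff.1 e
      rw [List.length_take] at hj
      omega
    have hp := potential_append es hvt
    obtain ⟨r, rfl⟩ := hl'
    rw [List.take_append_of_le_length (by omega), List.take_succ_eq_append_getElem hlt]
    omega
  · rintro σ5 t ⟨⟨φ, hag5, l, h, hh, hhd, hq5, hst, -⟩, hlt, ht⟩
    simp only [eval_get, eval_lit, RAM.Test.holds_lt, hhd, hq5.len] at hlt
    refine ⟨⟨l.toFinset, hq5.code, hst.isAttractor fun x hx hxl => ?_⟩, by omega⟩
    rw [List.take_of_length_le (by omega)]
    exact Finset.mem_filter.2 ⟨hx, hxl⟩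

end Imp

namespace Imp

open Imp.Expr Imp.Prog

/-! ### The dynamic program over all subgames -/

def colourStep : Prog :=
  .ite .eq (bit (var .S) (var .v)) 1
    (.ite .eq (bit (var .cs) (get .col (var .v))) 0
      (.put .cs 0 (var .cs + get .pow (get .col (var .v)))) .skip) .skip

/-- `cs := ` the set of colours of `S`. -/
def colours : Prog := .seq (.put .cs 0 0) (.forLoop .v .n colourStep)

/-- Looks for positions won by the opponent of `sg` outside the attractor to colour `j`. -/
def tryColour : Prog :=
  .ite .eq (bit (var .cs) (var .j)) 1
    (.seq (.put .T 0 (get .colm (var .j))) <|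
      .seq attr <|
      .seq (.put .Y 0 (get .w (2 * (var .S - var .A) + (1 - var .sg)))) <|
      .ite .ne (var .Y) 0 (.put .X 0 (var .Y)) .skip)
    .skip

/-- Removes the attractor of the opponent of `sg` to `X` and stores the winning regions. -/
def finish : Prog :=
  .seq (.put .w (2 * var .S + var .sg) (var .S)) <|
  .seq (.put .P 0 (1 - var .sg)) <|
  .seq (.put .T 0 (var .X)) <|
  .seq attr <|
  .seq (.put .Y 0 (get .w (2 * (var .S - var .A) + var .sg))) <|
  .seq (.put .w (2 * var .S + var .sg) (var .Y)) <|
  .put .w (2 * var .S + (1 - var .sg)) (var .S - var .Y)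

def solveStep : Prog :=
  .seq colours <|
  .seq (.put .sg 0 (get .tf (var .cs))) <|
  .seq (.put .X 0 0) <|
  .seq (.put .P 0 (var .sg)) <|
  .seq (.forLoop .j .k tryColour) finish

def solve : Prog := .forLoop .S .N solveStep

variable {n k : ℕ} {G : ColouredMullerGame (Fin n) (Fin k)} {es : List (Fin n × Fin n)}
  {L : Limits} {σ σ' : Store} {S : Finset (Fin n)}

theorem colours_spec (hL : Fits L n es.length) (hkn : k ≤ n) (hE : Env G es σ)
    (hS : σ .S 0 = setCode S) :
    Wp L colours σ (fun σ' t => σ' .cs 0 = setCode (S.image G.c) ∧ t ≤ n * 5 + 3) := by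
  have hn := hL.n_lt
  have hb := L.le_b
  have hpos : 0 < L.b := by omega
  have hpow := hL.pow_le
  have h2 : 2 ^ k ≤ 2 ^ n := Nat.pow_le_pow_right (by omega) hkn
  refine .put_seq trivial trivial (by simp [hL.lim, hpos]) hpos ?_
  simp only [eval_ofNat]
  set σ0 := σ.put .cs 0 0 with hσ0
  have hE0 : Env G es σ0 := hE.put (by decide) _ _
  have hS0 : σ0 .S 0 = setCode S := by simp [hσ0, hS]
  refine (Wp.forLoop 3 (fun i σ' =>
    σ' .cs 0 = setCode ((S.filter fun v : Fin n => (v : ℕ) < i).image G.c)) (by decide) (by decide)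
    (by decide) hE0.n_eq hn hpos (by simp [hL.lim, hpos]) (by simp [hL.lim, hpos]) ?_ ?_).mono ?_
  · simp [hσ0]
  · intro i hi σ1 hag hv hJ
    have hE1 : Env G es σ1 := hE0.agree hag (by decide)
    have hS1 : σ1 .S 0 = setCode S := by rw [hag .S (by decide), hS0]
    have hcol : (get .col (var .v)).eval σ1 = (G.c ⟨i, hi⟩ : ℕ) := by
      simp [hv, hE1.col ⟨i, hi⟩]
    have hcn : (G.c ⟨i, hi⟩ : ℕ) < n := (G.c ⟨i, hi⟩).2.trans_le hkn
    have e1 := bit_eval (s := var .S) (u := var .v) (v := ⟨i, hi⟩) hE1 (X := S) (by simp [hS1])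
      (by simp [hv])
    have e2 := bit_eval_of_le (s := var .cs) (u := get .col (var .v)) hE1 hkn
      (by simpa using hJ) hcol
    have hvr : (var .v).InRange L.lim σ1 := by simp [hL.lim, hpos]
    have hcr : (get .col (var .v)).InRange L.lim σ1 := by simp [hL.lim, hpos, hv]; omega
    have hcp : (get .col (var .v)).eval σ1 < L.lim .pow := by
      rw [hcol, hL.lim _ (by decide)]
      omega
    have hsplit : (S.filter fun v : Fin n => (v : ℕ) < i + 1) = if (⟨i, hi⟩ : Fin n) ∈ S then
        insert ⟨i, hi⟩ (S.filter fun v : Fin n => (v : ℕ) < i) else S.filter fun v : Fin n => (v : ℕ) < i := by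
      split
      · rename_i h
        ext v
        simp only [Finset.mem_filter, Finset.mem_insert, Fin.ext_iff]
        constructor
        · rintro ⟨h1, h2⟩
          by_cases h3 : (v : ℕ) = i
          · exact .inl h3
          · exact .inr ⟨h1, by omega⟩
        · rintro (h1 | h1)
          · obtain rfl : v = ⟨i, hi⟩ := Fin.ext h1
            exact ⟨h, by simp⟩
          · exact ⟨h1.1, by omega⟩
      · rename_i h
        refine Finset.filter_congr fun v hv => ⟨fun h1 => ?_, fun h1 => by omega⟩
        by_contra h2
        obtain rfl : v = ⟨i, hi⟩ := Fin.ext (by simp only; omega)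
        exact h hv
    refine .ite (bit_inRange (by simp [hL.lim, hpos]) hvr (by simp [hL.lim, hv]; omega)) trivial
      (fun hc => ?_) (fun hc => ?_)
    · simp only [e1, eval_ofNat, RAM.Test.holds_eq, ite_eq_left_iff, zero_ne_one, imp_false,
        not_not] at hc
      rw [if_pos hc] at hsplit
      refine .ite (bit_inRange (by simp [hL.lim, hpos]) hcr hcp) trivial
        (fun hc' => ?_) (fun hc' => ?_)
      · simp only [e2, eval_ofNat, RAM.Test.holds_eq, ite_eq_right_iff, one_ne_zero,
          imp_false] at hc'
        have hval : (var .cs + get .pow (get .col (var .v))).eval σ1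
            = setCode ((S.filter fun v : Fin n => (v : ℕ) < i + 1).image G.c) := by
          rw [hsplit, Finset.image_insert, setCode_insert hc', ← hJ, eval_add, eval_get, eval_get,
            hcol, hE1.pow _ hcn.le]
          rfl
        refine .put trivial ?_ (by simp [hL.lim, hpos]) ?_ ⟨le_rfl, ?_⟩
        · rw [inRange_add, inRange_get, inRange_get]
          exact ⟨⟨trivial, by simp [hL.lim, hpos]⟩, hcr, hcp⟩
        · rw [hval]
          have := setCode_lt ((S.filter fun v : Fin n => (v : ℕ) < i + 1).image G.c)
          omega
        · rw [hval]
          simp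
      · simp only [e2, eval_ofNat, RAM.Test.holds_eq, ite_eq_right_iff, one_ne_zero,
          imp_false, not_not] at hc'
        refine .skip ⟨by omega, ?_⟩
        rw [hsplit, Finset.image_insert, Finset.insert_eq_of_mem hc', ← hJ]
        simp
    · simp only [e1, eval_ofNat, RAM.Test.holds_eq, ite_eq_left_iff, zero_ne_one, imp_false,
        not_not] at hc
      rw [if_neg hc] at hsplit
      refine .skip ⟨by omega, ?_⟩
      rw [hsplit, ← hJ]
      simp
  · rintro σ1 t ⟨hJ, -, -, ht⟩
    refine ⟨?_, by omega⟩
    rw [hJ]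
    simp

/-- The winning regions of all subgames with codes below `i` have been stored. -/
def Table (G : ColouredMullerGame (Fin n) (Fin k)) (i : ℕ) (σ : Store) : Prop :=
  ∀ U : Finset (Fin n), setCode U < i → ∃ D, G.IsSolution U D ∧
    ∀ τ : Bool, σ .w (2 * setCode U + τ.toNat) = setCode (D τ)

theorem Table.congr {i : ℕ} (h : Table G i σ) (hσ : σ' .w = σ .w) : Table G i σ' := by
  unfold Table
  rwa [hσ]

theorem one_sub_toNat (b : Bool) : 1 - b.toNat = (!b).toNat := by
  cases b <;> rfl

theorem toNat_le_one (b : Bool) : b.toNat ≤ 1 := by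
  cases b <;> decide

/-- Either no colour treated so far leaves anything to Player `!s`, or `X` is the winning region
of that player outside some attractor. -/
def Tried (G : ColouredMullerGame (Fin n) (Fin k)) (S : Finset (Fin n)) (s : Bool) (i : ℕ)
    (X : ℕ) : Prop :=
  (X = 0 ∧ ∀ j ∈ S.image G.c, (j : ℕ) < i → ∃ A D,
    G.IsAttractor s S (Finset.univ.filter (G.c · = j)) A ∧ G.IsSolution (S \ A) D ∧ D (!s) = ∅) ∨
  ∃ A T D, G.IsAttractor s S T A ∧ G.IsSolution (S \ A) D ∧ D (!s) ≠ ∅ ∧ X = setCode (D (!s))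

theorem tryColour_spec (hL : Fits L n es.length) (hkn : k ≤ n) (hE : Env G es σ) {s : Bool}
    {i : ℕ} (hi : i < k) (hS : σ .S 0 = setCode S) (hcs : σ .cs 0 = setCode (S.image G.c))
    (hsg : σ .sg 0 = s.toNat) (hP : σ .P 0 = s.toNat) (hj : σ .j 0 = i)
    (hW : Table G (setCode S) σ) (hX : Tried G S s i (σ .X 0)) :
    Wp L tryColour σ (fun σ' t => Tried G S s (i + 1) (σ' .X 0) ∧ t ≤ 25 * es.length + 13) := by
  have hn := hL.n_lt
  have hb := L.le_b
  have hpos : 0 < L.b := by omega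
  have hpow := hL.pow_le
  have e1 := bit_eval_of_le (s := var .cs) (u := var .j) (v := ⟨i, hi⟩) hE hkn
    (by simpa using hcs) (by simp [hj])
  have hST := setCode_lt S
  have hskip : (⟨i, hi⟩ : Fin k) ∉ S.image G.c → Tried G S s (i + 1) (σ .X 0) := fun h => by
    refine hX.imp_left fun h' => ⟨h'.1, fun j hj hji => h'.2 j hj ?_⟩
    by_contra hc
    obtain rfl : j = ⟨i, hi⟩ := Fin.ext (by simp only; omega)
    exact h hj
  refine .ite (bit_inRange (by simp [hL.lim, hpos]) (by simp [hL.lim, hpos])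
    (by simp [hL.lim, hj]; omega)) trivial (fun hc => ?_) (fun hc => ?_)
  · simp only [e1, eval_ofNat, RAM.Test.holds_eq, ite_eq_left_iff, zero_ne_one, imp_false,
      not_not] at hc
    have hcolm := hE.colm ⟨i, hi⟩
    have hTlt := setCode_lt (Finset.univ.filter (G.c · = ⟨i, hi⟩))
    simp only at hcolm
    refine .put_seq trivial (by simp [hL.lim, hpos, hj]; omega) (by simp [hL.lim, hpos])
      (by simp [hj, hcolm]; omega) ?_
    simp only [eval_get, eval_lit, eval_ofNat, hj, hcolm]
    set σ1 := σ.put .T 0 (setCode (Finset.univ.filter (G.c · = ⟨i, hi⟩))) with hσ1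
    have hE1 : Env G es σ1 := hE.put (by decide) _ _
    refine .seq ((attr_spec hL hE1 (S := S) (T := Finset.univ.filter (G.c · = ⟨i, hi⟩)) (p := s)
      (by simp [hσ1, hS]) (by simp [hσ1]) (by simp [hσ1, hP])).frame.mono ?_)
    rintro σ2 t ⟨⟨⟨A, hA, hAt⟩, ht⟩, hag2⟩
    have hS2 : σ2 .S 0 = setCode S := by rw [hag2 _ (by decide)]; simp [hσ1, hS]
    have hsg2 : σ2 .sg 0 = s.toNat := by rw [hag2 _ (by decide)]; simp [hσ1, hsg]
    have hX2 : σ2 .X 0 = σ .X 0 := by rw [hag2 _ (by decide)]; simp [hσ1]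
    have hW2 : Table G (setCode S) σ2 := hW.congr (by
      rw [hag2 _ (by decide), hσ1, Store.put_of_ne _ _ _ (by decide)])
    have hAne : A.Nonempty := by
      obtain ⟨v, hv, e⟩ := Finset.mem_image.1 hc
      exact ⟨v, hAt.target v hv (by simp [e])⟩
    obtain ⟨D, hD, hDw⟩ := hW2 (S \ A) (setCode_sdiff_lt hAt.subset hAne)
    have hw := hDw (!s)
    have hs1 := toNat_le_one (!s)
    rw [setCode_sdiff hAt.subset] at hw
    have hDlt := setCode_lt (D (!s))
    refine .put_seq trivial (by simp [hL.lim, hpos, hS2, hA, hsg2, one_sub_toNat]; omega)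
      (by simp [hL.lim, hpos]) (by simp [hS2, hA, hsg2, one_sub_toNat, hw]; omega) ?_
    simp only [eval_get, eval_lit, eval_ofNat, eval_add, eval_mul, eval_sub, hS2, hA, hsg2,
      one_sub_toNat, hw]
    refine .ite (by simp [hL.lim, hpos]) trivial (fun hY => ?_) (fun hY => ?_)
    · simp only [eval_get, eval_lit, Store.put_apply, and_self, if_true, eval_ofNat,
        RAM.Test.holds_ne, ne_eq, setCode_eq_zero] at hY
      refine .put trivial (by simp [hL.lim, hpos]) (by simp [hL.lim, hpos]) (by simp; omega) ⟨?_, by omega⟩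
      exact .inr ⟨A, _, D, hAt, hD, hY, by simp⟩
    · simp only [eval_get, eval_lit, Store.put_apply, and_self, if_true, eval_ofNat,
        RAM.Test.holds_ne, ne_eq, setCode_eq_zero, not_not] at hY
      refine .skip ⟨?_, by omega⟩
      simp only [Store.put_apply, reduceCtorEq, false_and, if_false, hX2]
      refine hX.imp_left fun h' => ⟨h'.1, fun j hj hji => ?_⟩
      by_cases hji' : (j : ℕ) < i
      · exact h'.2 j hj hji'
      · obtain rfl : j = ⟨i, hi⟩ := Fin.ext (by simp only; omega)
        exact ⟨A, D, hAt, hD, hY⟩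
  · simp only [e1, eval_ofNat, RAM.Test.holds_eq, ite_eq_left_iff, zero_ne_one, imp_false,
      not_not] at hc
    exact .skip ⟨hskip hc, by omega⟩

theorem finish_spec (hL : Fits L n es.length) (hE : Env G es σ) {s : Bool}
    (hF : S.image G.c ∈ G.F s) (hS : σ .S 0 = setCode S)
    (hsg : σ .sg 0 = s.toNat) (hW : Table G (setCode S) σ) (hX : Tried G S s k (σ .X 0)) :
    Wp L finish σ (fun σ' t => Table G (setCode S + 1) σ' ∧ t ≤ 25 * es.length + 14) := by
  have hb := L.le_b
  have hpos : 0 < L.b := by omega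
  have hpow := hL.pow_le
  have hST := setCode_lt S
  have hs1 := toNat_le_one s
  have hs2 := toNat_le_one (!s)
  obtain ⟨X, hXX, hXlt⟩ : ∃ X : Finset (Fin n), σ .X 0 = setCode X ∧ setCode X < 2 ^ n := by
    rcases hX with h | ⟨_, _, D, _, _, _, h⟩
    · exact ⟨∅, by simp [h.1], by simp⟩
    · exact ⟨_, h, setCode_lt _⟩
  refine .put_seq (by simp [hL.lim, hpos]) (by simp [hL.lim, hpos])
    (by simp [hL.lim, hS, hsg]; omega) (by simp [hS]; omega) ?_
  refine .put_seq trivial (by simp [hL.lim, hpos]) (by simp [hL.lim, hpos])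
    (by simp [hsg]; omega) ?_
  refine .put_seq trivial (by simp [hL.lim, hpos]) (by simp [hL.lim, hpos])
    (by simp [hXX]; omega) ?_
  simp only [eval_get, eval_lit, eval_ofNat, eval_add, eval_mul, eval_sub, hS, hsg,
    one_sub_toNat, hXX, Store.put_apply, reduceCtorEq, false_and, if_false]
  set σ1 := ((σ.put .w (2 * setCode S + s.toNat) (setCode S)).put .P 0 (!s).toNat).put .T 0
    (setCode X) with hσ1
  have hE1 : Env G es σ1 := ((hE.put (by decide) _ _).put (by decide) _ _).put (by decide) _ _
  refine .seq ((attr_spec hL hE1 (S := S) (T := X) (p := !s)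
    (by simp [hσ1, hS]) (by simp [hσ1]) (by simp [hσ1])).frame.mono ?_)
  rintro σ2 t ⟨⟨⟨B, hB, hBt⟩, ht⟩, hag2⟩
  have hS2 : σ2 .S 0 = setCode S := by rw [hag2 _ (by decide)]; simp [hσ1, hS]
  have hsg2 : σ2 .sg 0 = s.toNat := by rw [hag2 _ (by decide)]; simp [hσ1, hsg]
  have hw2 : ∀ i, σ2 .w i = if i = 2 * setCode S + s.toNat then setCode S else σ .w i := by
    intro i
    rw [hag2 _ (by decide)]
    simp [hσ1]
  have key : ∃ Z ⊆ S, σ2 .w (2 * (setCode S - setCode B) + s.toNat) = setCode Z ∧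
      G.IsSolution S (fun τ => if τ = s then Z else S \ Z) := by
    rcases hX with ⟨h0, h⟩ | ⟨A, T, D, hA, hD, hne, h⟩
    · have hX0 : X = ∅ := setCode_eq_zero.1 (hXX.symm.trans h0)
      obtain rfl := hBt.eq_empty hX0
      refine ⟨S, subset_rfl, by simp [hw2], ?_⟩
      exact ColouredMullerGame.isSolution_of_forall_empty hF fun j hj => h j hj j.2
    · have hXD : X = D (!s) := setCode_injective (hXX.symm.trans h)
      have hXS : X ⊆ S := hXD ▸ (hD.subset _).trans Finset.sdiff_subset
      have hBne : B.Nonempty := by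
        obtain ⟨v, hv⟩ := Finset.nonempty_iff_ne_empty.2 (hXD ▸ hne)
        exact ⟨v, hBt.target v (hXS hv) hv⟩
      have hlt := setCode_sdiff_lt hBt.subset hBne
      obtain ⟨D', hD', hDw⟩ := hW (S \ B) hlt
      refine ⟨D' s, (hD'.subset s).trans Finset.sdiff_subset, ?_, ?_⟩
      · rw [← setCode_sdiff hBt.subset, hw2, if_neg (by omega), hDw]
      · exact ColouredMullerGame.isSolution_of_attractor hA hD hXD hBt hD'
  obtain ⟨Z, hZS, hZ, hsol⟩ := key
  have hZlt := setCode_lt Z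
  refine .put_seq trivial (by simp [hL.lim, hpos, hS2, hB, hsg2]; omega) (by simp [hL.lim, hpos])
    (by simp [hS2, hB, hsg2, hZ]; omega) ?_
  refine .put_seq (by simp [hL.lim, hpos]) (by simp [hL.lim, hpos])
    (by simp [hL.lim, hS2, hsg2]; omega) (by simp [hS2, hB, hsg2, hZ]; omega) ?_
  refine .put (by simp [hL.lim, hpos]) (by simp [hL.lim, hpos])
    (by simp [hL.lim, hS2, hsg2, one_sub_toNat]; omega) (by simp [hS2]; omega) ⟨?_, by omega⟩
  simp only [eval_get, eval_lit, eval_ofNat, eval_add, eval_mul, eval_sub, hS2, hB, hsg2, hZ,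
    one_sub_toNat, Store.put_apply, reduceCtorEq, false_and, if_false, and_self, if_true]
  intro U hU
  simp only [Store.put_apply, true_and, reduceCtorEq, false_and, if_false]
  by_cases hUS : U = S
  · subst hUS
    refine ⟨_, hsol, fun τ => ?_⟩
    by_cases hτ : τ = s
    · subst hτ
      cases τ <;> simp
    · obtain rfl : τ = !s := by cases τ <;> cases s <;> simp_all
      simp [setCode_sdiff hZS]
  · have hUlt : setCode U < setCode S := by
      have : setCode U ≠ setCode S := fun e => hUS (setCode_injective e)
      omega
    obtain ⟨D, hD, hDw⟩ := hW U hUlt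
    refine ⟨D, hD, fun τ => ?_⟩
    have := toNat_le_one τ
    rw [if_neg (by omega), if_neg (by omega), hw2, if_neg (by omega), hDw]

theorem solveStep_spec (hL : Fits L n es.length) (hkn : k ≤ n) (hn0 : 0 < n) (hE : Env G es σ)
    (hS : σ .S 0 = setCode S) (hW : Table G (setCode S) σ) :
    Wp L solveStep σ (fun σ' t => Table G (setCode S + 1) σ' ∧ t ≤ 92 * (k * es.length)) := by
  have hn := hL.n_lt
  have hb := L.le_b
  have hpos : 0 < L.b := by omega
  have hpow := hL.pow_le
  have h2 : 2 ^ k ≤ 2 ^ n := Nat.pow_le_pow_right (by omega) hkn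
  refine .seq ((colours_spec hL hkn hE hS).frame.mono ?_)
  rintro σ1 t1 ⟨⟨hcs1, ht1⟩, hag1⟩
  have hE1 : Env G es σ1 := hE.agree hag1 (by decide)
  have hclt := setCode_lt (S.image G.c)
  obtain ⟨s, hF, htf⟩ : ∃ s, S.image G.c ∈ G.F s ∧
      σ1 .tf (setCode (S.image G.c)) = s.toNat := by
    have h := hE1.tf (S.image G.c)
    by_cases hF : S.image G.c ∈ G.F true
    · exact ⟨true, hF, by simp [h, hF]⟩
    · have hu := G.union_eq ▸ Finset.mem_univ (S.image G.c)
      exact ⟨false, (Finset.mem_union.1 hu).resolve_right hF, by simp [h, hF]⟩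
  have hs1 := toNat_le_one s
  refine .put_seq trivial (by simp [hL.lim, hpos, hcs1]; omega) (by simp [hL.lim, hpos])
    (by simp [hcs1, htf]; omega) ?_
  refine .put_seq trivial trivial (by simp [hL.lim, hpos]) (by simp; omega) ?_
  refine .put_seq trivial (by simp [hL.lim, hpos]) (by simp [hL.lim, hpos])
    (by simp [hcs1, htf]; omega) ?_
  simp only [eval_get, eval_lit, eval_ofNat, hcs1, htf, Store.put_apply, reduceCtorEq, false_and,
    if_false, and_self, if_true]
  set σ2 := ((σ1.put .sg 0 s.toNat).put .X 0 0).put .P 0 s.toNat with hσ2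
  have hE2 : Env G es σ2 := ((hE1.put (by decide) _ _).put (by decide) _ _).put (by decide) _ _
  have hS2 : σ2 .S 0 = setCode S := by simp [hσ2, hag1 .S (by decide), hS]
  have hW2 : Table G (setCode S) σ2 := hW.congr (by
    rw [hσ2, Store.put_of_ne _ _ _ (by decide), Store.put_of_ne _ _ _ (by decide),
      Store.put_of_ne _ _ _ (by decide), hag1 _ (by decide)])
  have hsg2 : σ2 .sg 0 = s.toNat := by simp [hσ2]
  have hP2 : σ2 .P 0 = s.toNat := by simp [hσ2]
  have hcs2 : σ2 .cs 0 = setCode (S.image G.c) := by simp [hσ2, hcs1]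
  refine .seq ((Wp.forLoop (25 * es.length + 13) (fun i σ' => Tried G S s i (σ' .X 0)) (by decide)
    (by decide) (by decide) hE2.k_eq (by omega) hpos (by simp [hL.lim, hpos])
    (by simp [hL.lim, hpos]) ?_ ?_).mono ?_)
  · exact .inl ⟨by simp [hσ2], by simp⟩
  · intro i hi σ3 hag3 hj hX
    refine (tryColour_spec hL hkn (hE2.agree hag3 (by decide)) hi
      (by rw [hag3 _ (by decide), hS2]) (by rw [hag3 _ (by decide), hcs2])
      (by rw [hag3 _ (by decide), hsg2]) (by rw [hag3 _ (by decide), hP2]) hj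
      (hW2.congr (by rw [hag3 _ (by decide)])) hX).mono ?_
    rintro σ4 t ⟨hX4, ht⟩
    exact ⟨ht, by simpa using hX4⟩
  · rintro σ3 t3 ⟨hX3, hag3, -, ht3⟩
    refine (finish_spec hL (hE2.agree hag3 (by decide)) hF (by rw [hag3 _ (by decide), hS2])
      (by rw [hag3 _ (by decide), hsg2]) (hW2.congr (by rw [hag3 _ (by decide)])) hX3).mono ?_
    rintro σ4 t4 ⟨hW4, ht4⟩
    refine ⟨hW4, ?_⟩
    have hk : 0 < k := (Nat.zero_le _).trans_lt (G.c ⟨0, hn0⟩).2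
    have hnm := hL.le_m
    have hkm : es.length ≤ k * es.length := Nat.le_mul_of_pos_left _ hk
    have hkm' : k ≤ k * es.length := Nat.le_mul_of_pos_right _ (by omega)
    have e : k * (25 * es.length + 13 + 2) = 25 * (k * es.length) + 15 * k := by ring
    rw [e] at ht3
    omega

theorem solve_spec (hL : Fits L n es.length) (hkn : k ≤ n) (hn0 : 0 < n) (hE : Env G es σ) :
    Wp L solve σ (fun σ' t => Table G (2 ^ n) σ' ∧ t ≤ 2 ^ n * (92 * (k * es.length) + 2) + 2) := by
  have hb := L.le_b
  have hpos : 0 < L.b := by omega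
  have hpow := hL.pow_le
  refine (Wp.forLoop (92 * (k * es.length)) (fun i σ' => Table G i σ') (by decide) (by decide)
    (by decide) hE.N_eq (by have := Nat.two_pow_pos n; omega) hpos (by simp [hL.lim, hpos])
    (by simp [hL.lim, hpos]) ?_ ?_).mono ?_
  · intro U hU
    omega
  · intro i hi σ1 hag hS hW
    obtain ⟨S, rfl⟩ := exists_setCode_eq hi
    refine (solveStep_spec hL hkn hn0 (hE.agree hag (by decide)) hS hW).mono ?_
    rintro σ2 t ⟨hW2, ht⟩
    exact ⟨ht, hW2.congr (σ2.put_of_ne _ _ (by decide))⟩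
  · rintro σ1 t ⟨hW, -, -, ht⟩
    exact ⟨hW, ht⟩

end Imp

namespace Imp

open Imp.Expr Imp.Prog

/-! ### Reading the input and writing the output -/

def readPosition : Prog :=
  .seq (.put .pow (var .v + 1) (get .pow (var .v) * 2)) <|
  .seq (.put .own (var .v) (get .inp (5 + var .v))) <|
  .seq (.put .col (var .v) (get .inp (5 + var .n + var .v))) <|
  .put .colm (get .col (var .v)) (get .colm (get .col (var .v)) + get .pow (var .v))

def readEdge : Prog :=
  .seq (.put .u 0 (get .inp (5 + 2 * var .n + 2 * var .e))) <|
  .seq (.put .v 0 (get .inp (5 + 2 * var .n + 2 * var .e + 1))) <|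
  .seq (.put .src (var .e) (var .u)) <|
  .seq (.put .tgt (var .e) (var .v)) <|
  .seq (.put .pr (var .v * var .m + get .deg (var .v)) (var .u)) <|
  .put .deg (var .v) (get .deg (var .v) + 1)

def readSet : Prog :=
  .put .tf (get .inp (5 + 2 * var .n + 2 * var .m + var .f0 + var .e)) 1

def readInput : Prog :=
  .seq (.put .n 0 (get .inp 0)) <|
  .seq (.put .k 0 (get .inp 1)) <|
  .seq (.put .m 0 (get .inp 2)) <|
  .seq (.put .f0 0 (get .inp 3)) <|
  .seq (.put .f1 0 (get .inp 4)) <|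
  .seq (.put .pow 0 1) <|
  .seq (.forLoop .v .n readPosition) <|
  .seq (.put .N 0 (get .pow (var .n))) <|
  .seq (.forLoop .e .m readEdge) (.forLoop .e .f1 readSet)

def writeWinner : Prog :=
  .put .inp (var .v) (bit (get .w (2 * (var .N - 1) + 1)) (var .v))

def mullerProg : Prog :=
  .seq readInput <| .seq solve (.forLoop .v .n writeWinner)

variable {n k : ℕ} {G : ColouredMullerGame (Fin n) (Fin k)} {es : List (Fin n × Fin n)}
  {Fs : Bool → List (Finset (Fin k))} {L : Limits} {σ σ' : Store}

/-- The array `inp` holds the representation of the game. -/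
structure HasInput (G : ColouredMullerGame (Fin n) (Fin k)) (es : List (Fin n × Fin n))
    (Fs : Bool → List (Finset (Fin k))) (σ : Store) : Prop where
  n_eq : σ .inp 0 = n
  k_eq : σ .inp 1 = k
  m_eq : σ .inp 2 = es.length
  f0_eq : σ .inp 3 = (Fs false).length
  f1_eq : σ .inp 4 = (Fs true).length
  own : ∀ v : Fin n, σ .inp (5 + v) = (G.owner v).toNat
  col : ∀ v : Fin n, σ .inp (5 + n + v) = (G.c v : ℕ)
  src : ∀ e (h : e < es.length), σ .inp (5 + 2 * n + 2 * e) = (es[e].1 : ℕ)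
  tgt : ∀ e (h : e < es.length), σ .inp (5 + 2 * n + 2 * e + 1) = (es[e].2 : ℕ)
  set : ∀ j (h : j < (Fs true).length),
    σ .inp (5 + 2 * n + 2 * es.length + (Fs false).length + j) = setCode (Fs true)[j]

theorem HasInput.congr (h : HasInput G es Fs σ) (hσ : σ' .inp = σ .inp) :
    HasInput G es Fs σ' := by
  constructor <;> rw [hσ]
  exacts [h.n_eq, h.k_eq, h.m_eq, h.f0_eq, h.f1_eq, h.own, h.col, h.src, h.tgt, h.set]

def inputLength (n : ℕ) (es : List (Fin n × Fin n)) (Fs : Bool → List (Finset (Fin k))) : ℕ :=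
  5 + 2 * n + 2 * es.length + (Fs false).length + (Fs true).length

theorem getD_flatMap_pair (es : List (Fin n × Fin n)) (l : List ℕ) (e : ℕ) (he : e < es.length) :
    (es.flatMap (fun x => [(x.1 : ℕ), (x.2 : ℕ)]) ++ l).getD (2 * e) 0 = es[e].1 ∧
    (es.flatMap (fun x => [(x.1 : ℕ), (x.2 : ℕ)]) ++ l).getD (2 * e + 1) 0 = es[e].2 := by
  induction es generalizing e with
  | nil => simp at he
  | cons x es ih =>
    cases e with
    | zero => simp
    | succ e =>
      have := ih e (by simpa using he)
      simpa [Nat.mul_add] using this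

theorem length_flatMap_pair (es : List (Fin n × Fin n)) :
    (es.flatMap (fun x => [(x.1 : ℕ), (x.2 : ℕ)])).length = 2 * es.length := by
  induction es with
  | nil => rfl
  | cons x es ih =>
    simp only [List.flatMap_cons, List.length_append, List.length_cons, List.length_nil, ih]
    omega

theorem getD_append_add (l l' : List ℕ) {a : ℕ} (h : l.length = a) (i : ℕ) :
    (l ++ l').getD (a + i) 0 = l'.getD i 0 := by
  subst h
  rw [List.getD_append_right _ _ _ _ (by omega)]
  congr 1
  omega

theorem getD_ofFn_append (f : Fin n → ℕ) (l : List ℕ) (v : Fin n) :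
    (List.ofFn f ++ l).getD v 0 = f v := by
  rw [List.getD_append _ _ _ _ (by simp)]
  simp

theorem hasInput_of_representation {x : List ℕ} (hσ : ∀ i, σ .inp i = x.getD i 0)
    (hx : x = [n, k, es.length, (Fs false).length, (Fs true).length]
      ++ List.ofFn (fun v => (G.owner v).toNat) ++ List.ofFn (fun v => (G.c v : ℕ))
      ++ es.flatMap (fun e => [(e.1 : ℕ), (e.2 : ℕ)])
      ++ (Fs false).map setCode ++ (Fs true).map setCode) :
    HasInput G es Fs σ ∧ x.length = inputLength n es Fs := by
  have hlen : x.length = inputLength n es Fs := by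
    rw [hx]
    simp only [List.length_append, List.length_ofFn, length_flatMap_pair, List.length_map,
      List.length_cons, List.length_nil, inputLength]
    omega
  refine ⟨?_, hlen⟩
  simp only [List.append_assoc] at hx
  constructor
  · simp [hσ, hx]
  · simp [hσ, hx]
  · simp [hσ, hx]
  · simp [hσ, hx]
  · simp [hσ, hx]
  · intro v
    rw [hσ, hx, getD_append_add (a := 5) _ _ rfl, getD_ofFn_append]
  · intro v
    rw [hσ, hx, add_assoc, getD_append_add (a := 5) _ _ rfl, getD_append_add _ _ (List.length_ofFn),
      getD_ofFn_append]
  · intro e he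
    rw [hσ, hx, show 5 + 2 * n + 2 * e = 5 + (n + (n + 2 * e)) by ring, getD_append_add (a := 5) _ _ rfl,
      getD_append_add _ _ (List.length_ofFn), getD_append_add _ _ (List.length_ofFn),
      (getD_flatMap_pair es _ e he).1]
  · intro e he
    rw [hσ, hx, show 5 + 2 * n + 2 * e + 1 = 5 + (n + (n + (2 * e + 1))) by ring,
      getD_append_add (a := 5) _ _ rfl, getD_append_add _ _ (List.length_ofFn),
      getD_append_add _ _ (List.length_ofFn), (getD_flatMap_pair es _ e he).2]
  · intro j hj
    rw [hσ, hx, show 5 + 2 * n + 2 * es.length + (Fs false).length + j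
      = 5 + (n + (n + (2 * es.length + ((Fs false).length + j)))) by ring,
      getD_append_add (a := 5) _ _ rfl, getD_append_add _ _ (List.length_ofFn),
      getD_append_add _ _ (List.length_ofFn), getD_append_add _ _ (length_flatMap_pair es),
      getD_append_add _ _ (List.length_map _)]
    simp [hj]

theorem readPosition_spec (hL : Fits L n es.length) (hkn : k ≤ n)
    (hinp : L.lim .inp = inputLength n es Fs) (hI : HasInput G es Fs σ) (hn : σ .n 0 = n)
    (hpow : σ .pow 0 = 1) (hcolm : ∀ j, σ .colm j = 0) :
    Wp L (.forLoop .v .n readPosition) σ (fun σ' t => (∀ i ≤ n, σ' .pow i = 2 ^ i) ∧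
      (∀ v : Fin n, σ' .own v = (G.owner v).toNat ∧ σ' .col v = (G.c v : ℕ)) ∧
      (∀ j : Fin k, σ' .colm j = setCode (Finset.univ.filter (G.c · = j))) ∧ t ≤ n * 6 + 2) := by
  have hnb := hL.n_lt
  have hb := L.le_b
  have hpos : 0 < L.b := by omega
  have hpl := hL.pow_le
  have hn2 : n < 2 ^ n := Nat.lt_two_pow_self
  unfold inputLength at hinp
  refine (Wp.forLoop 4 (fun i σ' => (∀ j ≤ i, σ' .pow j = 2 ^ j) ∧
    (∀ v : Fin n, (v : ℕ) < i → σ' .own v = (G.owner v).toNat ∧ σ' .col v = (G.c v : ℕ)) ∧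
    ∀ j : Fin k, σ' .colm j = setCode (Finset.univ.filter fun v : Fin n => G.c v = j ∧ v < i))
    (by decide) (by decide) (by decide) hn hnb hpos (by simp [hL.lim, hpos])
    (by simp [hL.lim, hpos]) ?_ ?_).mono ?_
  · refine ⟨fun j hj => ?_, fun v hv => by omega, fun j => by simp [hcolm]⟩
    obtain rfl : j = 0 := by omega
    simp [hpow]
  · rintro i hi σ1 hag hv ⟨hJ1, hJ2, hJ3⟩
    have hI1 : HasInput G es Fs σ1 := hI.congr (hag _ (by decide))
    have hn1 : σ1 .n 0 = n := by rw [hag _ (by decide), hn]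
    have h2i : 2 ^ (i + 1) ≤ 2 ^ n := Nat.pow_le_pow_right (by omega) hi
    have h2s : 2 ^ (i + 1) = 2 ^ i * 2 := pow_succ 2 i
    have hown := hI1.own ⟨i, hi⟩
    have hcol := hI1.col ⟨i, hi⟩
    have hone := toNat_le_one (G.owner ⟨i, hi⟩)
    have hc := (G.c ⟨i, hi⟩).2
    have hcm := hJ3 (G.c ⟨i, hi⟩)
    have hcode : setCode (Finset.univ.filter fun v : Fin n => G.c v = G.c ⟨i, hi⟩ ∧ v < i) + 2 ^ i
        = setCode (Finset.univ.filter fun v : Fin n => G.c v = G.c ⟨i, hi⟩ ∧ v < i + 1) := by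
      rw [← setCode_insert (u := (⟨i, hi⟩ : Fin n)) (by simp)]
      congr 1
      ext v
      simp only [Finset.mem_insert, Finset.mem_filter, Finset.mem_univ, true_and]
      constructor
      · rintro (rfl | h)
        · exact ⟨rfl, by simp⟩
        · exact ⟨h.1, by omega⟩
      · rintro ⟨h1, h2⟩
        by_cases h3 : (v : ℕ) = i
        · exact .inl (Fin.ext h3)
        · exact .inr ⟨h1, by omega⟩
    have hlt := setCode_lt (Finset.univ.filter fun v : Fin n => G.c v = G.c ⟨i, hi⟩ ∧ v < i + 1)
    simp only at hown hcol hcm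
    refine .put_seq (by simp [hL.lim, hpos]) (by simp [hL.lim, hpos, hv]; omega)
      (by simp [hL.lim, hv]; omega) (by simp [hv, hJ1]; omega) ?_
    refine .put_seq (by simp [hL.lim, hpos]) (by simp [hL.lim, hpos, hinp, hv]; omega)
      (by simp [hL.lim, hv]; omega) (by simp [hv, hown]; omega) ?_
    refine .put_seq (by simp [hL.lim, hpos]) (by simp [hL.lim, hpos, hinp, hv, hn1]; omega)
      (by simp [hL.lim, hv]; omega) (by simp [hv, hn1, hcol]; omega) ?_
    simp only [eval_get, eval_lit, eval_ofNat, eval_add, eval_mul, Store.put_apply, reduceCtorEq,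
      false_and, if_false, hv, hn1, hown, hcol, hJ1 i le_rfl]
    refine .put (by simp [hL.lim, hpos, hv]; omega) (by simp [hL.lim, hpos, hv]; omega)
      (by simp [hL.lim, hv]; omega) (by simp [hv, hcm, hJ1]; omega) ⟨by omega, ?_, ?_, ?_⟩
    · intro j hj
      by_cases h : j = i + 1
      · simp [h, h2s]
      · simp [h, hJ1 j (by omega)]
    · intro v hvi
      by_cases h : (v : ℕ) = i
      · obtain rfl : v = ⟨i, hi⟩ := Fin.ext h
        simp
      · have := hJ2 v (by omega)
        simp [h, this]
    · intro j
      by_cases h : j = G.c ⟨i, hi⟩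
      · subst h
        simp only [eval_get, eval_lit, eval_add, Store.put_apply, reduceCtorEq, false_and,
          if_false, hv, and_self, if_true, hcm]
        rw [if_neg (by simp), hJ1 i le_rfl, hcode]
      · have h' : (j : ℕ) ≠ G.c ⟨i, hi⟩ := fun e => h (Fin.ext e)
        simp only [eval_get, eval_lit, eval_add, Store.put_apply, reduceCtorEq, false_and,
          if_false, hv, and_self, if_true, true_and, h', hJ3]
        congr 1
        refine Finset.filter_congr fun v _ => and_congr_right fun e => ⟨fun h => by omega, ?_⟩
        intro h3
        by_contra h4
        obtain rfl : v = ⟨i, hi⟩ := Fin.ext (by simp only; omega)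
        exact h e.symm
  · rintro σ1 t ⟨⟨h1, h2, h3⟩, -, -, ht⟩
    refine ⟨h1, fun v => h2 v v.2, fun j => ?_, ht⟩
    rw [h3]
    congr 1
    ext v
    simp

theorem mul_add_inj {m a b i j : ℕ} (hi : i < m) (hj : j < m) (h : a * m + i = b * m + j) :
    a = b ∧ i = j := by
  have h1 : (a * m + i) / m = a := by
    rw [mul_comm, Nat.mul_add_div (by omega), Nat.div_eq_of_lt hi, add_zero]
  have h2 : (b * m + j) / m = b := by
    rw [mul_comm, Nat.mul_add_div (by omega), Nat.div_eq_of_lt hj, add_zero]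
  have h3 : a = b := by rw [← h1, h, h2]
  subst h3
  exact ⟨rfl, by omega⟩

theorem preds_take_succ {i : ℕ} (hi : i < es.length) (v : Fin n) :
    preds (es.take (i + 1)) v
      = preds (es.take i) v ++ if es[i].2 = v then [es[i].1] else [] := by
  rw [List.take_succ_eq_append_getElem hi, preds, List.filter_append, List.map_append]
  congr 1
  by_cases h : es[i].2 = v <;> simp [h]

theorem readEdge_spec (hL : Fits L n es.length) (hinp : L.lim .inp = inputLength n es Fs)
    (hI : HasInput G es Fs σ) (hn : σ .n 0 = n) (hm : σ .m 0 = es.length)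
    (hdeg : ∀ v, σ .deg v = 0) :
    Wp L (.forLoop .e .m readEdge) σ (fun σ' t =>
      (∀ e (h : e < es.length), σ' .src e = (es[e].1 : ℕ) ∧ σ' .tgt e = (es[e].2 : ℕ)) ∧
      (∀ v : Fin n, σ' .deg v = (preds es v).length) ∧
      (∀ (v : Fin n) i (h : i < (preds es v).length),
        σ' .pr (v * es.length + i) = ((preds es v)[i] : ℕ)) ∧ t ≤ es.length * 8 + 2) := by
  have hnb := hL.n_lt
  have hmb := hL.m_lt
  have hnm := hL.mul_lt
  have hb := L.le_b
  have hpos : 0 < L.b := by omega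
  unfold inputLength at hinp
  refine (Wp.forLoop 6 (fun i σ' =>
    (∀ e (h : e < es.length), e < i → σ' .src e = (es[e].1 : ℕ) ∧ σ' .tgt e = (es[e].2 : ℕ)) ∧
    (∀ v : Fin n, σ' .deg v = (preds (es.take i) v).length) ∧
    (∀ (v : Fin n) j (h : j < (preds (es.take i) v).length),
        σ' .pr (v * es.length + j) = ((preds (es.take i) v)[j] : ℕ)))
    (by decide) (by decide) (by decide) hm hmb hpos (by simp [hL.lim, hpos])
    (by simp [hL.lim, hpos]) ?_ ?_).mono ?_
  · exact ⟨fun e h h' => by omega, fun v => by simp [hdeg, preds], fun v j h => by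
      simp [preds] at h⟩
  · rintro i hi σ1 hag hv ⟨hJ1, hJ2, hJ3⟩
    have hI1 : HasInput G es Fs σ1 := hI.congr (hag _ (by decide))
    have hn1 : σ1 .n 0 = n := by rw [hag _ (by decide), hn]
    have hm1 : σ1 .m 0 = es.length := by rw [hag _ (by decide), hm]
    have hsrc := hI1.src i hi
    have htgt := hI1.tgt i hi
    have hlen : ∀ v, (preds (es.take i) v).length ≤ i := fun v =>
      (length_preds_le _ v).trans (List.length_take_le _ _)
    have hsucc := fun v => preds_take_succ (es := es) hi v
    generalize hx : es[i] = x at *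
    obtain ⟨u, v⟩ := x
    simp only at hsrc htgt hsucc
    have hlv := hlen v
    have hu := u.2
    have hvn := v.2
    have hidx : v * es.length + (preds (es.take i) v).length < L.b := by
      have h1 : (v + 1 : ℕ) * es.length ≤ n * es.length := Nat.mul_le_mul_right _ v.2
      rw [Nat.add_mul] at h1
      omega
    refine .put_seq trivial (by simp [hL.lim, hpos, hinp, hv, hn1]; omega)
      (by simp [hL.lim, hpos]) (by simp [hv, hn1, hsrc]; omega) ?_
    refine .put_seq trivial (by simp [hL.lim, hpos, hinp, hv, hn1]; omega)
      (by simp [hL.lim, hpos]) (by simp [hv, hn1, htgt]; omega) ?_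
    simp only [eval_get, eval_lit, eval_ofNat, eval_add, eval_mul, Store.put_apply, reduceCtorEq,
      false_and, if_false, hv, hn1, hsrc, htgt]
    refine .put_seq (by simp [hL.lim, hpos]) (by simp [hL.lim, hpos])
      (by simp [hL.lim, hv]; omega) (by simp; omega) ?_
    refine .put_seq (by simp [hL.lim, hpos]) (by simp [hL.lim, hpos])
      (by simp [hL.lim, hv]; omega) (by simp; omega) ?_
    refine .put_seq (by simp [hL.lim, hpos]; omega) (by simp [hL.lim, hpos])
      (by simp [hL.lim, hm1, hJ2, hidx]) (by simp; omega) ?_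
    refine .put (by simp [hL.lim, hpos]) (by simp [hL.lim, hpos]; omega)
      (by simp [hL.lim]; omega) (by simp [hJ2]; omega) ⟨by omega, ?_, ?_, ?_⟩
    · intro e he hei
      by_cases h : e = i
      · subst h
        simp [hv, hx]
      · simp [hv, h, hJ1 e he (by omega)]
    · intro w
      by_cases h : w = v
      · subst h
        simp [hsucc, hJ2]
      · have h' : (w : ℕ) ≠ v := fun e => h (Fin.ext e)
        simp [hsucc, hJ2, h', Ne.symm h]
    · intro w j hj
      have hjm : j < es.length := by
        have := length_preds_le (es.take (i + 1)) w
        have := List.length_take_le (i + 1) es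
        omega
      simp only [hsucc] at hj ⊢
      by_cases h : w = v
      · subst h
        simp only [if_true, List.length_append, List.length_singleton] at hj
        by_cases hj' : j = (preds (es.take i) w).length
        · subst hj'
          simp [hm1, hJ2]
        · have hj2 : j < (preds (es.take i) w).length := by omega
          simp [hm1, hJ2, hj', hJ3 w j hj2, List.getElem_append_left hj2]
      · simp only [Ne.symm h, if_false, List.append_nil] at hj ⊢
        have hne : ¬ (w * es.length + j = v * es.length + (preds (es.take i) v).length) := fun e =>
          h (Fin.ext (mul_add_inj hjm (by omega) e).1)
        simp [hm1, hJ2, hne, hJ3 w j hj]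
  · rintro σ1 t ⟨⟨h1, h2, h3⟩, -, -, ht⟩
    rw [List.take_length] at h2 h3
    exact ⟨fun e h => h1 e h h, h2, h3, ht⟩

theorem readSet_spec (hL : Fits L n es.length) (hkn : k ≤ n)
    (hinp : L.lim .inp = inputLength n es Fs) (hI : HasInput G es Fs σ) (hn : σ .n 0 = n)
    (hm : σ .m 0 = es.length) (hf0 : σ .f0 0 = (Fs false).length)
    (hf1 : σ .f1 0 = (Fs true).length) (hf : (Fs true).length < L.b)
    (htf : ∀ v, σ .tf v = 0) :
    Wp L (.forLoop .e .f1 readSet) σ (fun σ' t =>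
      (∀ X, σ' .tf (setCode X) = if X ∈ Fs true then 1 else 0) ∧
      t ≤ (Fs true).length * 3 + 2) := by
  have hb := L.le_b
  have hpos : 0 < L.b := by omega
  have hpow := hL.pow_le
  have h2 : 2 ^ k ≤ 2 ^ n := Nat.pow_le_pow_right (by omega) hkn
  unfold inputLength at hinp
  refine (Wp.forLoop 1 (fun i σ' => ∀ X, σ' .tf (setCode X) = if X ∈ (Fs true).take i then 1 else 0)
    (by decide) (by decide) (by decide) hf1 hf hpos (by simp [hL.lim, hpos])
    (by simp [hL.lim, hpos]) ?_ ?_).mono ?_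
  · simp [htf]
  · intro i hi σ1 hag hv hJ
    have hset := (hI.congr (σ' := σ1) (hag _ (by decide))).set i hi
    have hlt := setCode_lt (Fs true)[i]
    have hn1 : σ1 .n 0 = n := by rw [hag _ (by decide), hn]
    have hm1 : σ1 .m 0 = es.length := by rw [hag _ (by decide), hm]
    have hf1 : σ1 .f0 0 = (Fs false).length := by rw [hag _ (by decide), hf0]
    refine .put (by simp [hL.lim, hpos, hinp, hv, hn1, hm1, hf1]; omega) trivial
      (by simp [hL.lim, hv, hn1, hm1, hf1, hset]; omega) (by simp; omega) ⟨le_rfl, ?_⟩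
    intro X
    have hmem : X ∈ (Fs true).take (i + 1) ↔ X ∈ (Fs true).take i ∨ X = (Fs true)[i] := by
      rw [List.take_succ_eq_append_getElem hi, List.mem_append, List.mem_singleton]
    by_cases h : X = (Fs true)[i]
    · simp [hv, hn1, hm1, hf1, hset, hmem, ← h]
    · have h' : setCode X ≠ setCode (Fs true)[i] := fun e => h (setCode_injective e)
      simp [hv, hn1, hm1, hf1, hset, h', hJ, hmem, h]
  · rintro σ1 t ⟨h, -, -, ht⟩
    rw [List.take_length] at h
    exact ⟨h, ht⟩

theorem readInput_spec (hL : Fits L n es.length) (hkn : k ≤ n)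
    (hinp : L.lim .inp = inputLength n es Fs) (hI : HasInput G es Fs σ)
    (hf0 : (Fs false).length < L.b) (hf1 : (Fs true).length < L.b) (hnd : es.Nodup)
    (hes : es.toFinset = G.E) (hF : (Fs true).toFinset = G.F true)
    (hσ : ∀ a ≠ Id.inp, ∀ i, σ a i = 0) :
    Wp L readInput σ (fun σ' t => Env G es σ' ∧
      t ≤ n * 6 + es.length * 8 + (Fs true).length * 3 + 13) := by
  have hnb := hL.n_lt
  have hmb := hL.m_lt
  have hb := L.le_b
  have hpos : 0 < L.b := by omega
  have hpow := hL.pow_le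
  have hpp := Nat.two_pow_pos n
  have hinp' := hinp
  unfold inputLength at hinp'
  refine .put_seq trivial (by simp [hinp']) (by simp [hL.lim, hpos])
    (by simp [hI.n_eq]; omega) ?_
  refine .put_seq trivial (by simp [hinp']; omega) (by simp [hL.lim, hpos])
    (by simp [hI.k_eq]; omega) ?_
  refine .put_seq trivial (by simp [hinp']; omega) (by simp [hL.lim, hpos])
    (by simp [hI.m_eq]; omega) ?_
  refine .put_seq trivial (by simp [hinp']; omega) (by simp [hL.lim, hpos])
    (by simp [hI.f0_eq]; omega) ?_
  refine .put_seq trivial (by simp [hinp']; omega) (by simp [hL.lim, hpos])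
    (by simp [hI.f1_eq]; omega) ?_
  refine .put_seq trivial trivial (by simp [hL.lim, hpos]) (by simp; omega) ?_
  simp only [eval_get, eval_ofNat, Store.put_apply, reduceCtorEq, false_and, if_false,
    hI.n_eq, hI.k_eq, hI.m_eq, hI.f0_eq, hI.f1_eq]
  set σ1 := (((((σ.put .n 0 n).put .k 0 k).put .m 0 es.length).put .f0 0 (Fs false).length).put
    .f1 0 (Fs true).length).put .pow 0 1 with hσ1
  have hI1 : HasInput G es Fs σ1 := hI.congr (by
    funext i
    simp [hσ1])
  refine .seq ((readPosition_spec hL hkn hinp hI1 (by simp [hσ1]) (by simp [hσ1])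
    (by simp [hσ1, hσ])).frame.mono ?_)
  rintro σ2 t2 ⟨⟨hpow2, hoc2, hcolm2, ht2⟩, hag2⟩
  have hn2 : σ2 .n 0 = n := by rw [hag2 _ (by decide)]; simp [hσ1]
  refine .put_seq trivial (by simp [hL.lim, hpos, hn2]; omega) (by simp [hL.lim, hpos])
    (by simp [hn2, hpow2]; omega) ?_
  simp only [eval_get, eval_lit, eval_ofNat, hn2, hpow2 n le_rfl]
  set σ3 := σ2.put .N 0 (2 ^ n) with hσ3
  have hI3 : HasInput G es Fs σ3 := hI1.congr (by
    rw [hσ3, Store.put_of_ne _ _ _ (by decide), hag2 _ (by decide)])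
  have hag13 : ∀ a, a ≠ .N → a ∉ (forLoop .v .n readPosition).mods → σ3 a = σ1 a := by
    intro a h1 h2
    rw [hσ3, Store.put_of_ne _ _ _ h1, hag2 _ h2]
  refine .seq ((readEdge_spec hL hinp hI3 (by simp [hσ3, hn2])
    (by rw [hag13 _ (by decide) (by decide)]; simp [hσ1])
    (by rw [hag13 _ (by decide) (by decide)]; simp [hσ1, hσ])).frame.mono ?_)
  rintro σ4 t4 ⟨⟨hst4, hdeg4, hpr4, ht4⟩, hag4⟩
  refine (readSet_spec hL hkn hinp (hI3.congr (hag4 _ (by decide)))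
    (by rw [hag4 _ (by decide), hag13 _ (by decide) (by decide)]; simp [hσ1])
    (by rw [hag4 _ (by decide), hag13 _ (by decide) (by decide)]; simp [hσ1])
    (by rw [hag4 _ (by decide), hag13 _ (by decide) (by decide)]; simp [hσ1])
    (by rw [hag4 _ (by decide), hag13 _ (by decide) (by decide)]; simp [hσ1]) hf1
    (by rw [hag4 _ (by decide), hag13 _ (by decide) (by decide)]; simp [hσ1, hσ])).frame.mono ?_
  rintro σ5 t5 ⟨⟨htf5, ht5⟩, hag5⟩
  have hag35 : ∀ a, a ∉ (forLoop .e .f1 readSet).mods → a ∉ (forLoop .e .m readEdge).mods →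
      σ5 a = σ3 a := by
    intro a h1 h2
    rw [hag5 _ h1, hag4 _ h2]
  have hag25 : ∀ a, a ∉ (forLoop .e .f1 readSet).mods → a ∉ (forLoop .e .m readEdge).mods →
      a ≠ .N → σ5 a = σ2 a := by
    intro a h1 h2 h3
    rw [hag35 a h1 h2, hσ3, Store.put_of_ne _ _ _ h3]
  refine ⟨⟨?_, ?_, ?_, ?_, ?_, ?_, ?_, ?_, ?_, ?_, ?_, ?_, hnd, hes, ?_⟩, by omega⟩
  · rw [hag25 _ (by decide) (by decide) (by decide), hn2]
  · rw [hag35 _ (by decide) (by decide), hag13 _ (by decide) (by decide)]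
    simp [hσ1]
  · rw [hag35 _ (by decide) (by decide), hag13 _ (by decide) (by decide)]
    simp [hσ1]
  · rw [hag35 _ (by decide) (by decide)]
    simp [hσ3]
  · rw [hag25 _ (by decide) (by decide) (by decide)]
    exact hpow2
  · rw [hag25 _ (by decide) (by decide) (by decide)]
    exact fun v => (hoc2 v).1
  · rw [hag25 _ (by decide) (by decide) (by decide)]
    exact fun v => (hoc2 v).2
  · rw [hag25 _ (by decide) (by decide) (by decide)]
    exact hcolm2
  · rw [hag5 _ (by decide)]
    exact fun e h => (hst4 e h).1
  · rw [hag5 _ (by decide)]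
    exact fun e h => (hst4 e h).2
  · rw [hag5 _ (by decide)]
    exact hdeg4
  · rw [hag5 _ (by decide)]
    exact hpr4
  · intro X
    rw [htf5, ← hF]
    simp

theorem writeWinner_spec (hL : Fits L n es.length) (hE : Env G es σ)
    (hinp : L.lim .inp = inputLength n es Fs) {D : Finset (Fin n)}
    (hD : σ .w (2 * (2 ^ n - 1) + 1) = setCode D) :
    Wp L (.forLoop .v .n writeWinner) σ (fun σ' t =>
      (∀ v : Fin n, σ' .inp v = (decide (v ∈ D)).toNat) ∧ t ≤ n * 3 + 2) := by
  have hnb := hL.n_lt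
  have hb := L.le_b
  have hpos : 0 < L.b := by omega
  have hpow := hL.pow_le
  have hpp := Nat.two_pow_pos n
  unfold inputLength at hinp
  refine (Wp.forLoop 1 (fun i σ' => ∀ v : Fin n, (v : ℕ) < i →
    σ' .inp v = (decide (v ∈ D)).toNat) (by decide) (by decide) (by decide) hE.n_eq hnb hpos
    (by simp [hL.lim, hpos]) (by simp [hL.lim, hpos]) ?_ ?_).mono ?_
  · intro v hv
    omega
  · intro i hi σ1 hag hv hJ
    have hE1 : Env G es σ1 := hE.agree hag (by decide)
    have hN := hE1.N_eq
    have hw : σ1 .w (2 * (2 ^ n - 1) + 1) = setCode D := by rw [hag _ (by decide), hD]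
    have e1 := bit_eval (s := get .w (2 * (var .N - 1) + 1)) (u := var .v) (v := ⟨i, hi⟩) (X := D)
      hE1 (by simp [hN, hw]) (by simp [hv])
    have hvr : (var .v).InRange L.lim σ1 := by simp [hL.lim, hpos]
    refine .put hvr (bit_inRange (by simp [hL.lim, hpos, hN]; omega) hvr
      (by simp [hL.lim, hv]; omega)) (by simp [hinp, hv]; omega) ?_ ⟨le_rfl, ?_⟩
    · rw [e1]
      split <;> omega
    · intro v hvi
      rw [e1]
      by_cases h : (v : ℕ) = i
      · obtain rfl : v = ⟨i, hi⟩ := Fin.ext h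
        by_cases hvD : (⟨i, hi⟩ : Fin n) ∈ D <;> simp [hv, hvD]
      · simp [hv, h, hJ v (by omega)]
  · rintro σ1 t ⟨h, -, -, ht⟩
    exact ⟨fun v => h v v.2, ht⟩

theorem mullerProg_spec (hL : Fits L n es.length) (hkn : k ≤ n) (hn0 : 0 < n)
    (hinp : L.lim .inp = inputLength n es Fs) (hI : HasInput G es Fs σ)
    (hf0 : (Fs false).length ≤ 2 ^ n) (hf1 : (Fs true).length ≤ 2 ^ n) (hnd : es.Nodup)
    (hes : es.toFinset = G.E) (hF : (Fs true).toFinset = G.F true)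
    (hσ : ∀ a ≠ Id.inp, ∀ i, σ a i = 0) :
    Wp L mullerProg σ (fun σ' t => ∃ win : Fin n → Bool,
      (∀ v : Fin n, σ' .inp v = (win v).toNat) ∧
      (∀ (v : Fin n) (τ : Bool), v ∈ G.Win τ ↔ win v = τ) ∧
      t ≤ 200 * (2 ^ n * k * es.length)) := by
  have hpow := hL.pow_le
  have hpp := Nat.two_pow_pos n
  refine .seq ((readInput_spec hL hkn hinp hI (by omega) (by omega) hnd hes hF hσ).mono ?_)
  rintro σ1 t1 ⟨hE1, ht1⟩
  refine .seq ((solve_spec hL hkn hn0 hE1).frame.mono ?_)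
  rintro σ2 t2 ⟨⟨hW, ht2⟩, hag⟩
  obtain ⟨D, hD, hDw⟩ := hW Finset.univ (by rw [setCode_univ]; omega)
  have hw := hDw true
  rw [setCode_univ, Bool.toNat_true] at hw
  refine (writeWinner_spec hL (hE1.agree hag (by decide)) hinp hw).mono ?_
  rintro σ3 t3 ⟨hout, ht3⟩
  refine ⟨fun v => decide (v ∈ D true), hout, fun v τ => hD.mem_win_iff v τ, ?_⟩
  have hk : 0 < k := (Nat.zero_le _).trans_lt (G.c ⟨0, hn0⟩).2
  have hnm := hL.le_m
  have hkm : es.length ≤ k * es.length := Nat.le_mul_of_pos_left _ hk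
  have hX : k * es.length ≤ 2 ^ n * (k * es.length) := Nat.le_mul_of_pos_left _ hpp
  have hY : 2 ^ n ≤ 2 ^ n * (k * es.length) := Nat.le_mul_of_pos_right _ (by omega)
  have e : 2 ^ n * (92 * (k * es.length) + 2) = 92 * (2 ^ n * (k * es.length)) + 2 * 2 ^ n := by
    ring
  rw [e] at ht2
  rw [mul_assoc (2 ^ n)]
  omega

/-! ### The RAM program -/

open RAM (Cmd State Exec)

/-- Computes the length of the input in register `0`. -/
def basePrologue : Cmd 16 :=
  .seq (.load 0 1) <| .seq (.arith .add 0 0 0) <| .seq (.const 1 2) <| .seq (.load 2 1) <|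
  .seq (.arith .add 2 2 2) <| .seq (.arith .add 0 0 2) <| .seq (.const 1 3) <|
  .seq (.load 2 1) <| .seq (.arith .add 0 0 2) <| .seq (.const 1 4) <| .seq (.load 2 1) <|
  .seq (.arith .add 0 0 2) <| .seq (.const 1 5) (.arith .add 0 0 1)

theorem exec_basePrologue {s w N M A B : ℕ} {μ : State 16} (hr : ∀ i, μ.reg i = 0)
    (h0 : μ.mem 0 = N) (h2 : μ.mem 2 = M) (h3 : μ.mem 3 = A) (h4 : μ.mem 4 = B)
    (hs : 5 ≤ s) (hw : 5 + 2 * N + 2 * M + A + B < 2 ^ w) :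
    ∃ t ≤ 14, ∃ μ', Exec s w basePrologue μ t μ' ∧ μ'.mem = μ.mem ∧
      μ'.reg 0 = 5 + 2 * N + 2 * M + A + B := by
  refine ⟨_, ?_, _, .seq (.load _ _ _ ?_) <| .seq (.arith _ _ _ _ _ ?_) <|
    .seq (.const _ _ _ ?_) <| .seq (.load _ _ _ ?_) <| .seq (.arith _ _ _ _ _ ?_) <|
    .seq (.arith _ _ _ _ _ ?_) <| .seq (.const _ _ _ ?_) <| .seq (.load _ _ _ ?_) <|
    .seq (.arith _ _ _ _ _ ?_) <| .seq (.const _ _ _ ?_) <| .seq (.load _ _ _ ?_) <|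
    .seq (.arith _ _ _ _ _ ?_) <| .seq (.const _ _ _ ?_) (.arith _ _ _ _ _ ?_), rfl, ?_⟩
  all_goals try simp [State.setReg, RAM.Op.eval, hr, h0, h2, h3, h4]
  all_goals omega

end Imp

namespace Imp

open RAM (Cmd State Exec)

theorem cube_add_sq_le (n : ℕ) : n * (n * n) + n * n ≤ 16 * 2 ^ n := by
  rcases lt_or_ge n 5 with h | h
  · interval_cases n <;> norm_num
  · induction n, h using Nat.le_induction with
    | base => norm_num
    | succ n hn ih =>
      rw [pow_succ]
      nlinarith

/-- The parameters of the machine for a game with `n` positions and an input of length `len`. -/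
def limits (n len : ℕ) (hn : 0 < n) (hlen : len ≤ 64 * 2 ^ n) : Limits where
  lim a := if a = .inp then len else 64 * 2 ^ n
  b := 64 * 2 ^ n
  base := len
  s := len + 4096 * 2 ^ n + 64
  w := 70 * n
  le_b := Nat.le_mul_of_pos_right _ (by positivity)
  pow_le := by
    rw [show 64 = 2 ^ 6 by norm_num, ← pow_add, ← pow_mul]
    exact Nat.pow_le_pow_right (by omega) (by omega)
  s_le := by
    have h1 : 2 ^ (13 + n) ≤ 2 ^ (70 * n) := Nat.pow_le_pow_right (by omega) (by omega)
    rw [pow_add] at h1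
    have := Nat.two_pow_pos n
    omega
  inp_le := by simp
  base_le := by omega
  addr_lt a ha i hi := by
    rw [if_neg ha] at hi
    omega

theorem card_le_card_E {n k : ℕ} (G : ColouredMullerGame (Fin n) (Fin k)) : n ≤ G.E.card := by
  choose f hf using G.exists_succ
  have := Finset.card_le_card_of_injOn (s := Finset.univ) (t := G.E) (fun u => (u, f u))
    (fun u _ => hf u) (fun u _ v _ h => (Prod.mk.inj h).1)
  simpa using this

theorem card_E_le {n k : ℕ} (G : ColouredMullerGame (Fin n) (Fin k)) : G.E.card ≤ n * n := by
  simpa using Finset.card_le_univ G.E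

/-- The initial store. -/
def initStore (x : List ℕ) : Store := fun a i => if a = .inp then x.getD i 0 else 0

theorem mullerProg_small : mullerProg.Small = true := by decide

end Imp

/-- There is a program that, given any (nonempty) coloured Muller game `G` with at most as many
colours as positions, computes the partition of the positions into the two winning regions
(memory word `v` finally holds the winner from position `v`), in `O(2^|V| |C| |E|)` steps and
`O(|G| + 2^|V| |V|)` bits of space, on a machine whose words have `O(|V|)` bits. -/
theorem mainTheorem3 :
    ∃ (r : ℕ) (p : RAM.Cmd r) (K : ℕ),
      ∀ (n k : ℕ) (G : ColouredMullerGame (Fin n) (Fin k)) (x : List ℕ),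
        0 < n → k ≤ n → IsRepresentation G x →
        ∃ (s w t : ℕ) (m : ℕ → ℕ) (win : Fin n → Bool),
          RAM.RunsTo p x s w t m ∧
          (∀ v : Fin n, m v = (win v).toNat) ∧
          (∀ (v : Fin n) (σ : Bool), v ∈ G.Win σ ↔ win v = σ) ∧
          t ≤ K * (2 ^ n * k * G.E.card) ∧
          (s + r) * w ≤ K * (G.size + 2 ^ n * n) ∧
          w ≤ K * n := by
  refine ⟨16, .seq Imp.basePrologue Imp.mullerProg.compile, 300000, ?_⟩
  rintro n k G x hn hkn ⟨es, Fs, hnd, hes, hFs, hx⟩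
  have hm : es.length = G.E.card := by rw [← hes, List.toFinset_card_of_nodup hnd]
  have hF : ∀ τ, (Fs τ).length ≤ 2 ^ n := fun τ => by
    rw [← List.toFinset_card_of_nodup (hFs τ).1]
    refine (Finset.card_le_univ _).trans ?_
    simpa using Nat.pow_le_pow_right (by omega) hkn
  have hF0 := hF false
  have hF1 := hF true
  have hcube := Imp.cube_add_sq_le n
  have hEle := Imp.card_E_le G
  have hE := Imp.card_le_card_E G
  have hX := Nat.two_pow_pos n
  have hn2 : n < 2 ^ n := Nat.lt_two_pow_self
  obtain ⟨hI, hlen⟩ := Imp.hasInput_of_representation (σ := Imp.initStore x)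
    (fun i => by simp [Imp.initStore]) hx
  have hlen' : x.length ≤ 64 * 2 ^ n := by
    rw [hlen, Imp.inputLength]
    omega
  let L := Imp.limits n x.length hn hlen'
  have hinp : L.lim .inp = x.length := by simp [L, Imp.limits]
  have hbs := L.base_le
  have hsw := L.s_le
  have hbig : 64 * 2 ^ n < 2 ^ L.w := lt_of_lt_of_le (by change _ < x.length + _ + _; omega) hsw
  have hk : 0 < k := (Nat.zero_le _).trans_lt (G.c ⟨0, hn⟩).2
  have hxval : ∀ i, x.getD i 0 < 64 * 2 ^ n := by
    have h2k : 2 ^ k ≤ 2 ^ n := Nat.pow_le_pow_right (by omega) hkn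
    have : ∀ a ∈ x, a < 64 * 2 ^ n := by
      intro a ha
      rw [hx] at ha
      simp only [List.mem_append, List.mem_cons, List.not_mem_nil, or_false, List.mem_ofFn,
        List.mem_flatMap, List.mem_map] at ha
      rcases ha with (((((rfl | rfl | rfl | rfl | rfl) | ⟨v, rfl⟩) | ⟨v, rfl⟩) | ⟨e, _, rfl | rfl⟩) |
        ⟨X, _, rfl⟩) | ⟨X, _, rfl⟩
      all_goals try omega
      · have := Imp.toNat_le_one (G.owner v)
        omega
      · have := setCode_lt X
        omega
      · have := setCode_lt X
        omega
    intro i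
    by_cases hi : i < x.length
    · rw [List.getD_eq_getElem _ _ hi]
      exact this _ (List.getElem_mem hi)
    · rw [List.getD_eq_default _ _ (by omega)]
      omega
  have hL : Imp.Fits L n es.length := by
    refine ⟨fun a ha => if_neg ha, ?_, ?_, by omega⟩
    · change _ ≤ 64 * 2 ^ n
      omega
    · change _ < 64 * 2 ^ n
      have h1 : n * es.length ≤ n * (n * n) := Nat.mul_le_mul_left _ (by omega)
      omega
  obtain ⟨t, σ', hrun, win, hout, hwin, ht⟩ := Imp.mullerProg_spec (L := L) hL hkn hn
    (hinp.trans hlen) hI hF0 hF1 hnd hes (hFs true).2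
    (fun a ha i => by simp [Imp.initStore, ha])
  have hbase : 5 + 2 * n + 2 * es.length + (Fs false).length + (Fs true).length = x.length :=
    hlen.symm
  obtain ⟨t0, ht0, μ, hμ, hmem, hreg⟩ := Imp.exec_basePrologue (s := L.s) (w := L.w)
    (μ := RAM.initState 16 x) (fun _ => rfl) (N := n) (M := es.length) (A := (Fs false).length)
    (B := (Fs true).length) hI.n_eq hI.m_eq hI.f0_eq hI.f1_eq
    (by change 5 ≤ x.length + _ + _; omega) (by omega)
  have hrep : Imp.Rep L (Imp.initStore x) μ := by
    refine ⟨hreg.trans hbase, fun a i hi => ?_, fun a i _ => ?_⟩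
    · rw [hmem]
      by_cases ha : a = .inp
      · simp [RAM.initState, Imp.addr, Imp.initStore, ha]
      · simp only [RAM.initState, Imp.addr, Imp.initStore, if_neg ha]
        refine List.getD_eq_default _ _ ?_
        change x.length ≤ _ + x.length
        omega
    · unfold Imp.initStore
      change _ < 64 * 2 ^ n
      split
      · exact hxval i
      · omega
  obtain ⟨t', ht', μ', hμ', hrep'⟩ := hrun.exec_compile Imp.mullerProg_small hrep
  refine ⟨L.s, L.w, t0 + t', μ'.mem, win, ⟨?_, ?_, μ', .seq hμ hμ', rfl⟩, ?_, hwin, ?_, ?_, ?_⟩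
  · change x.length ≤ x.length + _ + _
    omega
  · intro a ha
    obtain ⟨i, hi, rfl⟩ := List.getElem_of_mem ha
    have := hxval i
    rw [List.getD_eq_getElem _ _ hi] at this
    omega
  · intro v
    rw [← hout v, ← hrep'.mem .inp v]
    · rfl
    · rw [hinp]
      omega
  · rw [← hm]
    have : 0 < 2 ^ n * k * es.length := by
      have : 0 < es.length := by omega
      positivity
    omega
  · have hs : L.s + 16 ≤ 4240 * 2 ^ n := by
      change x.length + 4096 * 2 ^ n + 64 + 16 ≤ _
      rw [← hbase]
      nlinarith
    calc (L.s + 16) * (70 * n) ≤ 4240 * 2 ^ n * (70 * n) := Nat.mul_le_mul_right _ hs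
      _ = 296800 * (2 ^ n * n) := by ring
      _ ≤ 300000 * (G.size + 2 ^ n * n) := by omega
  · change 70 * n ≤ _
    omega
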